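/- Let $\Omega=\mathbb R\times(0,1)$, let $r>0$, let $\Omega_r=(-r,r)\times(0,1)$, and let $k>0$ with $k\notin\pi\mathbb N=\{0,\pi,2\pi,\dots\}$. For $n\in\mathbb N$ put $\varphi_0=1$, $\varphi_n(y)=\sqrt2\cos(n\pi y)$ for $n\ge1$, and let $k_n$ be the square root of $k^2-n^2\pi^2$ with $\operatorname{Re}k_n\ge0$, $\operatorname{Im}k_n\ge0$. Write $\mathrm H^2_{\mathrm{loc}}(\Omega)$ for the space of functions on $\Omega$ that lie in $\mathrm H^2(\Omega_R)$ for every $R>0$; all functions are complex valued. A function $u\in\mathrm H^2_{\mathrm{loc}}(\Omega)$ is called outgoing if for every $n\in\mathbb N$ the coefficient $w_n(x)=\int_0^1u(x,y)\varphi_n(y)\,\mathrm dy$ satisfies $\left|w_n'(x)\frac{x}{|x|}-ik_nw_n(x)\right|\to0$ as $|x|\to\infty$. For every $s\in\mathrm L^2(\Omega_r)$, extended by $0$ to $\Omega$, the problem $$\Delta u_k+k^2u_k=-s\ \text{ in }\Omega,\qquad \partial_\nu u_k=0\ \text{ on }\partial\Omega,\qquad u_k\ \text{outgoing}$$ has exactly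 one solution $u_k\in\mathrm H^2_{\mathrm{loc}}(\Omega)$, and the operator $$\mathcal H_k:\mathrm L^2(\Omega_r)\to\mathrm H^2(\Omega_r),\qquad s\mapsto u_k|_{\Omega_r},$$ is thus well defined; it is linear and continuous. Hence there is a constant $C>0$ depending only on $k$ and $r$ such that $$\|u_k\|_{\mathrm H^2(\Omega_r)}\le C\,\|s\|_{\mathrm L^2(\Omega_r)}\qquad\text{for all }s\in\mathrm L^2(\Omega_r).$$ Moreover, for fixed $r$, the best such constant, i.e. the operator norm $\|\mathcal H_k\|$, tends to $+\infty$ as the distance from $k$ to $\pi\mathbb N$ tends to $0$: for every $M$ there is $\delta>0$ such that $\|\mathcal H_k\|>M$ for all $k>0$, $k\notin\pi\mathbb N$, with $\operatorname{dist}(k,\pi\mathbb N)<\delta$. Here $\|v\|_{\mathrm H^2(\Omega_r)}^2=\|v\|^2+\sum_{j}\|\partial_jv\|^2+\sum_{i,j}\|\partial_i\partial_jv\|^2$ with $\mathrm L^2(\Omega_r)$ norms. -/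

import Mathlib

open MeasureTheory Set Filter Topology

noncomputable section

namespace Waveguide

/-- The infinite waveguide `ℝ × (0,1)`. -/
def guide : Set (ℝ × ℝ) := univ ×ˢ Ioo 0 1

/-- The restricted waveguide `(-r,r) × (0,1)`. -/
def box (r : ℝ) : Set (ℝ × ℝ) := Ioo (-r) r ×ˢ Ioo 0 1

/-- The admissible frequencies: `k > 0` with `k ≠ nπ` for all `n ∈ ℕ`. -/
abbrev Frequency : Type := {k : ℝ // 0 < k ∧ ∀ n : ℕ, k ≠ n * Real.pi}

/-- The set `πℕ = {0, π, 2π, …}`. -/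
def cutoffs : Set ℝ := range fun n : ℕ => (n : ℝ) * Real.pi

/-- The canonical basis `(1,0)`, `(0,1)` of the plane. -/
def basisVec (i : Fin 2) : ℝ × ℝ := if i = 0 then (1, 0) else (0, 1)

/-- The partial derivative `∂ᵢφ` of a differentiable function. -/
def partialDeriv (i : Fin 2) (φ : ℝ × ℝ → ℝ) (p : ℝ × ℝ) : ℝ := fderiv ℝ φ p (basisVec i)

/-- Real test functions: smooth with compact support contained in `V`. -/
structure IsTest (V : Set (ℝ × ℝ)) (φ : ℝ × ℝ → ℝ) : Prop where
  smooth : ContDiff ℝ ((⊤ : ℕ∞) : WithTop ℕ∞) φ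
  compact : HasCompactSupport φ
  supp : tsupport φ ⊆ V

/-- The complex space `L²(U)`. -/
abbrev L2 (U : Set (ℝ × ℝ)) : Type := Lp ℂ 2 (volume.restrict U)

/-- `g` is the weak partial derivative `∂ᵢf` in `U`, for `f, g ∈ L²(U)`. -/
def IsWeakPartial (U : Set (ℝ × ℝ)) (i : Fin 2) (f g : L2 U) : Prop :=
  ∀ φ : ℝ × ℝ → ℝ, IsTest U φ →
    ∫ p in U, partialDeriv i φ p • f p = -∫ p in U, φ p • g p

theorem IsTest.memLp {V : Set (ℝ × ℝ)} {φ : ℝ × ℝ → ℝ} (hφ : IsTest V φ)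
    (μ : Measure (ℝ × ℝ)) [IsFiniteMeasureOnCompacts μ] : MemLp φ 2 μ :=
  hφ.smooth.continuous.memLp_of_hasCompactSupport hφ.compact

theorem IsTest.memLp_partialDeriv {V : Set (ℝ × ℝ)} {φ : ℝ × ℝ → ℝ} (hφ : IsTest V φ)
    (i : Fin 2) (μ : Measure (ℝ × ℝ)) [IsFiniteMeasureOnCompacts μ] :
    MemLp (partialDeriv i φ) 2 μ := by
  have hc : Continuous (partialDeriv i φ) :=
    (hφ.smooth.continuous_fderiv (by simp)).clm_apply continuous_const
  exact hc.memLp_of_hasCompactSupport (hφ.compact.fderiv_apply ℝ (basisVec i))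

theorem integrable_test_smul {U : Set (ℝ × ℝ)} {φ : ℝ × ℝ → ℝ}
    (hφ : MemLp φ 2 (volume.restrict U)) (f : L2 U) :
    IntegrableOn (fun p => φ p • f p) U :=
  memLp_one_iff_integrable.1 ((Lp.memLp f).smul hφ)

theorem IsWeakPartial.zero (U : Set (ℝ × ℝ)) (i : Fin 2) :
    IsWeakPartial U i (0 : L2 U) (0 : L2 U) := by
  intro φ _
  have h := Lp.coeFn_zero ℂ 2 (volume.restrict U)
  have h1 : ∫ p in U, partialDeriv i φ p • (0 : L2 U) p = 0 := by
    rw [integral_eq_zero_of_ae]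
    filter_upwards [h] with p hp
    simp only [hp, Pi.zero_apply, smul_zero]
  have h2 : ∫ p in U, φ p • (0 : L2 U) p = 0 := by
    rw [integral_eq_zero_of_ae]
    filter_upwards [h] with p hp
    simp only [hp, Pi.zero_apply, smul_zero]
  rw [h1, h2, neg_zero]

theorem integral_test_smul_add {U : Set (ℝ × ℝ)} {φ : ℝ × ℝ → ℝ}
    (hφ : MemLp φ 2 (volume.restrict U)) (f g : L2 U) :
    ∫ p in U, φ p • (f + g) p = (∫ p in U, φ p • f p) + ∫ p in U, φ p • g p := by
  rw [← integral_add (integrable_test_smul hφ f) (integrable_test_smul hφ g)]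
  apply integral_congr_ae
  filter_upwards [Lp.coeFn_add f g] with p hp
  simp only [hp, Pi.add_apply, smul_add]

theorem integral_test_smul_smul {U : Set (ℝ × ℝ)} (φ : ℝ × ℝ → ℝ) (c : ℂ) (f : L2 U) :
    ∫ p in U, φ p • (c • f) p = c * ∫ p in U, φ p • f p := by
  rw [← integral_const_mul]
  apply integral_congr_ae
  filter_upwards [Lp.coeFn_smul c f] with p hp
  simp only [hp, Pi.smul_apply, smul_eq_mul, mul_smul_comm]

theorem IsWeakPartial.add {U : Set (ℝ × ℝ)} {i : Fin 2} {f g f' g' : L2 U}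
    (h : IsWeakPartial U i f g) (h' : IsWeakPartial U i f' g') :
    IsWeakPartial U i (f + f') (g + g') := by
  intro φ hφ
  rw [integral_test_smul_add (hφ.memLp_partialDeriv i _), integral_test_smul_add (hφ.memLp _),
    h φ hφ, h' φ hφ, neg_add]

theorem IsWeakPartial.smul {U : Set (ℝ × ℝ)} {i : Fin 2} {f g : L2 U} (c : ℂ)
    (h : IsWeakPartial U i f g) : IsWeakPartial U i (c • f) (c • g) := by
  intro φ hφ
  rw [integral_test_smul_smul, integral_test_smul_smul, h φ hφ, mul_neg]

/-- Labels for a function, its first partial derivatives `∂ⱼ` and its second partial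
derivatives `∂ᵢ∂ⱼ`. -/
abbrev JetIndex : Type := Unit ⊕ Fin 2 ⊕ Fin 2 × Fin 2

/-- The Hilbert space `H²(U)`: a function in `L²(U)` is stored together with its weak derivatives
of order one and two, all required to lie in `L²(U)` (for open `U` they are determined by the
function). The norm inherited from the `ℓ²` product is
`(‖u‖² + ∑ⱼ ‖∂ⱼu‖² + ∑ᵢⱼ ‖∂ᵢ∂ⱼu‖²)^(1/2)`, with `L²(U)` norms. -/
def H2 (U : Set (ℝ × ℝ)) : Submodule ℂ (PiLp 2 fun _ : JetIndex => L2 U) where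
  carrier := {v | (∀ j, IsWeakPartial U j (v (.inl ())) (v (.inr (.inl j)))) ∧
    ∀ i j, IsWeakPartial U i (v (.inr (.inl j))) (v (.inr (.inr (i, j))))}
  zero_mem' := ⟨fun j => IsWeakPartial.zero U j, fun i _ => IsWeakPartial.zero U i⟩
  add_mem' h h' := ⟨fun j => (h.1 j).add (h'.1 j), fun i j => (h.2 i j).add (h'.2 i j)⟩
  smul_mem' c _ h := ⟨fun j => (h.1 j).smul c, fun i j => (h.2 i j).smul c⟩

/-- The underlying function of an element of `H²(U)`. -/
def val {U : Set (ℝ × ℝ)} (v : H2 U) : L2 U := v.1 (.inl ())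

/-- The weak derivative `∂ⱼv`. -/
def grad {U : Set (ℝ × ℝ)} (v : H2 U) (j : Fin 2) : L2 U := v.1 (.inr (.inl j))

/-- The weak derivative `∂ᵢ∂ⱼv`. -/
def hess {U : Set (ℝ × ℝ)} (v : H2 U) (i j : Fin 2) : L2 U := v.1 (.inr (.inr (i, j)))

/-- `v ∈ H²(U)` is the restriction to `U` of the function `u` (almost everywhere). -/
def IsRestriction {U : Set (ℝ × ℝ)} (v : H2 U) (u : ℝ × ℝ → ℂ) : Prop :=
  val v =ᵐ[volume.restrict U] u

/-- `u ∈ H²_loc` of the waveguide, up to its boundary: `u ∈ H²((-R,R) × (0,1))` for all `R`. -/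
def MemH2loc (u : ℝ × ℝ → ℂ) : Prop :=
  ∀ R : ℝ, 0 < R → ∃ v : H2 (box R), IsRestriction v u

/-- `Δu + k²u = -s` almost everywhere in the waveguide, for `u ∈ H²_loc`. -/
def SolvesHelmholtz (k : ℝ) (s u : ℝ × ℝ → ℂ) : Prop :=
  ∀ R : ℝ, 0 < R → ∀ v : H2 (box R), IsRestriction v u →
    ∀ᵐ p ∂volume.restrict (box R), hess v 0 0 p + hess v 1 1 p + (k : ℂ) ^ 2 * u p = -s p

/-- The homogeneous Neumann condition `∂_ν u = 0` on `ℝ × {0,1}` for `u ∈ H²_loc`: the boundary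
term in Green's formula `∫ (Δu) φ + ∇u · ∇φ = ∫_∂ (∂_ν u) φ` vanishes for all `φ ∈ C_c^∞(ℝ²)`
(here `φ` need not vanish on `ℝ × {0,1}`). -/
def NeumannCondition (u : ℝ × ℝ → ℂ) : Prop :=
  ∀ R : ℝ, 0 < R → ∀ v : H2 (box R), IsRestriction v u →
    ∀ φ : ℝ × ℝ → ℝ, IsTest (Ioo (-R) R ×ˢ univ) φ →
      ∫ p in box R, (φ p • (hess v 0 0 p + hess v 1 1 p) +
        (partialDeriv 0 φ p • grad v 0 p + partialDeriv 1 φ p • grad v 1 p)) = 0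

/-- The transverse modes: `φ₀ = 1` and `φₙ(y) = √2 cos(nπy)` for `n ≥ 1`. -/
def mode (n : ℕ) (y : ℝ) : ℝ :=
  if n = 0 then 1 else Real.sqrt 2 * Real.cos (n * Real.pi * y)

/-- The modal wavenumber `kₙ`: the square root of `k² - n²π²` with nonnegative real and imaginary
parts. -/
def waveNumber (k : ℝ) (n : ℕ) : ℂ :=
  if n * Real.pi ≤ k then (Real.sqrt (k ^ 2 - (n * Real.pi) ^ 2) : ℂ)
  else Complex.I * (Real.sqrt ((n * Real.pi) ^ 2 - k ^ 2) : ℂ)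

/-- The radiation condition: for each `n`, the coefficient `w(x) = ⟨u(x,·), φₙ⟩` in `L²(0,1)`
(taken as its `C¹` representative) satisfies `w'(x) x/|x| - i kₙ w(x) → 0` as `|x| → ∞`. -/
def IsOutgoing (k : ℝ) (u : ℝ × ℝ → ℂ) : Prop :=
  ∀ n : ℕ, ∃ w : ℝ → ℂ, ContDiff ℝ 1 w ∧
    (∀ᵐ x : ℝ, w x = ∫ y in Ioo (0 : ℝ) 1, mode n y • u (x, y)) ∧
    Tendsto (fun x : ℝ => ‖deriv w x * ((x / |x| : ℝ) : ℂ) - Complex.I * waveNumber k n * w x‖)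
      (cocompact ℝ) (𝓝 0)

/-- `u ∈ H²_loc` is a solution of `Δu + k²u = -s` in the waveguide, `∂_ν u = 0` on its boundary,
`u` outgoing. -/
structure IsSolution (k : ℝ) (s u : ℝ × ℝ → ℂ) : Prop where
  memH2loc : MemH2loc u
  helmholtz : SolvesHelmholtz k s u
  neumann : NeumannCondition u
  outgoing : IsOutgoing k u

/-- The extension by zero of a source `s ∈ L²((-r,r) × (0,1))`. -/
def extendByZero {r : ℝ} (s : L2 (box r)) : ℝ × ℝ → ℂ := (box r).indicator s

end Waveguide

end

namespace Waveguide

/-- `F` is absolutely continuous on every bounded interval, with almost everywhere derivative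
`f`. -/
structure IsPrimitive (F f : ℝ → ℂ) : Prop where
  locInt : LocallyIntegrable f
  integral_eq : ∀ a b : ℝ, ∫ x in a..b, f x = F b - F a

namespace IsPrimitive

variable {F f G g : ℝ → ℂ}

theorem intervalIntegrable (h : IsPrimitive F f) (a b : ℝ) : IntervalIntegrable f volume a b :=
  (h.locInt.integrableOn_isCompact isCompact_uIcc).intervalIntegrable

theorem eq_add (h : IsPrimitive F f) (a x : ℝ) : F x = F a + ∫ t in a..x, f t := by
  rw [h.integral_eq]; ring

theorem continuous (h : IsPrimitive F f) : Continuous F := by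
  have : F = fun x => F 0 + ∫ t in (0 : ℝ)..x, f t := funext fun x => h.eq_add 0 x
  rw [this]
  exact continuous_const.add (intervalIntegral.continuous_primitive h.intervalIntegrable 0)

theorem of_hasDerivAt (h : ∀ x, HasDerivAt F (f x) x) (hf : Continuous f) : IsPrimitive F f :=
  ⟨hf.locallyIntegrable, fun a b =>
    intervalIntegral.integral_eq_sub_of_hasDerivAt (fun x _ => h x) (hf.intervalIntegrable a b)⟩

theorem hasDerivAt (h : IsPrimitive F f) (hf : Continuous f) (x : ℝ) : HasDerivAt F (f x) x := by
  have : F = fun x => F 0 + ∫ t in (0 : ℝ)..x, f t := funext fun x => h.eq_add 0 x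
  rw [this]
  exact ((hf.integral_hasStrictDerivAt 0 x).hasDerivAt).const_add _

theorem contDiff_one (h : IsPrimitive F f) (hf : Continuous f) : ContDiff ℝ 1 F := by
  rw [contDiff_one_iff_deriv]
  have hd : deriv F = f := funext fun x => (h.hasDerivAt hf x).deriv
  exact ⟨fun x => (h.hasDerivAt hf x).differentiableAt, hd ▸ hf⟩

theorem ae_hasDerivAt (h : IsPrimitive F f) : ∀ᵐ x, HasDerivAt F (f x) x := by
  filter_upwards [_root_.LocallyIntegrable.ae_hasDerivAt_integral h.locInt] with x hx
  have : F = fun x => F 0 + ∫ t in (0 : ℝ)..x, f t := funext fun x => h.eq_add 0 x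
  rw [this]
  exact (hx 0).const_add _

theorem absolutelyContinuousOnInterval (h : IsPrimitive F f) (a b : ℝ) :
    AbsolutelyContinuousOnInterval F a b := by
  have hn : ∀ x y : ℝ, IntervalIntegrable (fun t => ‖f t‖) volume x y :=
    fun x y => (h.intervalIntegrable x y).norm
  have hG := (hn a b).absolutelyContinuousOnInterval_intervalIntegral (c := a) (by simp)
  refine squeeze_zero (fun t => Finset.sum_nonneg fun i _ => dist_nonneg) (fun t => ?_) hG
  refine Finset.sum_le_sum fun i _ => ?_
  rw [dist_comm, dist_eq_norm, ← h.integral_eq, dist_comm, Real.dist_eq,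
    intervalIntegral.integral_interval_sub_left (hn _ _) (hn _ _)]
  exact intervalIntegral.norm_integral_le_abs_integral_norm

theorem mul (hF : IsPrimitive F f) (hG : IsPrimitive G g) :
    IsPrimitive (fun x => F x * G x) (fun x => f x * G x + F x * g x) := by
  have hloc : LocallyIntegrable (fun x => f x * G x + F x * g x) := by
    refine LocallyIntegrable.add ?_ ?_
    · rw [← locallyIntegrableOn_univ]
      exact (locallyIntegrableOn_univ.2 hF.locInt).mul_continuousOn hG.continuous.continuousOn
        isClosed_univ.isLocallyClosed
    · rw [← locallyIntegrableOn_univ]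
      exact (locallyIntegrableOn_univ.2 hG.locInt).continuousOn_mul hF.continuous.continuousOn
        isClosed_univ.isLocallyClosed
  refine ⟨hloc, fun a b => ?_⟩
  set J : ℝ → ℂ := fun x => ∫ t in a..x, f t * G t + F t * g t with hJ
  have hJp : IsPrimitive J (fun x => f x * G x + F x * g x) := by
    refine ⟨hloc, fun x y => ?_⟩
    have hi : ∀ x y : ℝ, IntervalIntegrable (fun x => f x * G x + F x * g x) volume x y :=
      fun x y => (hloc.integrableOn_isCompact isCompact_uIcc).intervalIntegrable
    rw [hJ]
    exact (intervalIntegral.integral_interval_sub_left (hi _ _) (hi _ _)).symm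
  have hAC : AbsolutelyContinuousOnInterval (fun x => F x * G x - J x) a b :=
    (((hF.absolutelyContinuousOnInterval a b).smul
      (hG.absolutelyContinuousOnInterval a b))).sub (hJp.absolutelyContinuousOnInterval a b)
  obtain ⟨C, hC⟩ := hAC.const_of_ae_hasDerivAt_zero (by
    filter_upwards [hF.ae_hasDerivAt, hG.ae_hasDerivAt, hJp.ae_hasDerivAt] with x h1 h2 h3 _
    convert! (h1.mul h2).sub h3 using 1
    ring)
  have ha := hC a (by simp)
  have hb := hC b (by simp)
  have hJa : J a = 0 := by simp [hJ]
  have : J b = F b * G b - F a * G a := by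
    rw [hJa, sub_zero] at ha
    rw [ha]; rw [← hb]; ring
  exact this

theorem congr {f' : ℝ → ℂ} (h : IsPrimitive F f) (hf : f =ᵐ[volume] f') : IsPrimitive F f' :=
  ⟨h.locInt.congr hf, fun a b => by
    rw [← h.integral_eq]
    exact (intervalIntegral.integral_congr_ae (hf.mono fun x hx _ => hx)).symm⟩

theorem add (hF : IsPrimitive F f) (hG : IsPrimitive G g) :
    IsPrimitive (fun x => F x + G x) (fun x => f x + g x) :=
  ⟨hF.locInt.add hG.locInt, fun a b => by
    rw [intervalIntegral.integral_add (hF.intervalIntegrable a b) (hG.intervalIntegrable a b),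
      hF.integral_eq, hG.integral_eq]; ring⟩

theorem const_mul (c : ℂ) (hF : IsPrimitive F f) :
    IsPrimitive (fun x => c * F x) (fun x => c * f x) :=
  ⟨hF.locInt.smul c, fun a b => by
    rw [intervalIntegral.integral_const_mul, hF.integral_eq]; ring⟩

end IsPrimitive

end Waveguide

namespace Waveguide

/-- The transverse frequency `nπ`. -/
noncomputable def freq (n : ℕ) : ℝ := n * Real.pi

/-- The mode `φₙ` as a complex valued function. -/
noncomputable def modeC (n : ℕ) (y : ℝ) : ℂ := (mode n y : ℂ)

/-- The normalization constant of the mode `φₙ`. -/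
noncomputable def modeAmp (n : ℕ) : ℝ := if n = 0 then 1 else Real.sqrt 2

/-- The derivative `φₙ'` of a mode. -/
noncomputable def modeD (n : ℕ) (y : ℝ) : ℂ :=
  ((-(modeAmp n * freq n * Real.sin (freq n * y)) : ℝ) : ℂ)

theorem freq_nonneg (n : ℕ) : 0 ≤ freq n := by unfold freq; positivity

theorem mode_eq (n : ℕ) (y : ℝ) : mode n y = modeAmp n * Real.cos (freq n * y) := by
  unfold mode modeAmp freq
  split_ifs with h
  · simp [h]
  · rfl

theorem modeAmp_sq_le (n : ℕ) : modeAmp n ^ 2 ≤ 2 := by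
  unfold modeAmp; split_ifs <;> norm_num

theorem abs_mode_le (n : ℕ) (y : ℝ) : |mode n y| ≤ 2 := by
  have h1 : |modeAmp n| ≤ 2 := by
    refine abs_le_of_sq_le_sq ?_ (by norm_num)
    linarith [modeAmp_sq_le n]
  rw [mode_eq, abs_mul]
  calc |modeAmp n| * |Real.cos (freq n * y)| ≤ 2 * 1 :=
        mul_le_mul h1 (Real.abs_cos_le_one _) (abs_nonneg _) (by norm_num)
    _ = 2 := by norm_num

theorem norm_modeC_le (n : ℕ) (y : ℝ) : ‖modeC n y‖ ≤ 2 := by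
  rw [modeC, Complex.norm_real]; exact abs_mode_le n y

theorem hasDerivAt_modeC (n : ℕ) (y : ℝ) : HasDerivAt (modeC n) (modeD n y) y := by
  have h : HasDerivAt (fun y => mode n y) (-(modeAmp n * freq n * Real.sin (freq n * y))) y := by
    simp only [mode_eq]
    have := (((hasDerivAt_id y).const_mul (freq n)).cos).const_mul (modeAmp n)
    convert! this using 1
    simp; ring
  exact h.ofReal_comp

theorem hasDerivAt_modeD (n : ℕ) (y : ℝ) :
    HasDerivAt (modeD n) (-(freq n : ℂ) ^ 2 * modeC n y) y := by
  have h : HasDerivAt (fun y => -(modeAmp n * freq n * Real.sin (freq n * y)))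
      (-(freq n) ^ 2 * mode n y) y := by
    simp only [mode_eq]
    have := ((((hasDerivAt_id y).const_mul (freq n)).sin).const_mul (modeAmp n * freq n)).neg
    convert! this using 1
    simp; ring
  convert! h.ofReal_comp using 1
  simp [modeC]

@[fun_prop]
theorem continuous_modeC (n : ℕ) : Continuous (modeC n) :=
  continuous_iff_continuousAt.2 fun y => (hasDerivAt_modeC n y).continuousAt

@[fun_prop]
theorem continuous_modeD (n : ℕ) : Continuous (modeD n) :=
  continuous_iff_continuousAt.2 fun y => (hasDerivAt_modeD n y).continuousAt

@[fun_prop]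
theorem continuous_mode (n : ℕ) : Continuous (mode n) := by
  have : mode n = fun y => modeAmp n * Real.cos (freq n * y) := funext (mode_eq n)
  rw [this]; fun_prop

theorem isPrimitive_modeC (n : ℕ) : IsPrimitive (modeC n) (modeD n) :=
  .of_hasDerivAt (hasDerivAt_modeC n) (continuous_modeD n)

theorem isPrimitive_modeD (n : ℕ) :
    IsPrimitive (modeD n) (fun y => -(freq n : ℂ) ^ 2 * modeC n y) :=
  .of_hasDerivAt (hasDerivAt_modeD n) (continuous_const.mul (continuous_modeC n))

@[simp] theorem modeD_zero_right (n : ℕ) : modeD n 0 = 0 := by simp [modeD]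

@[simp] theorem modeD_one_right (n : ℕ) : modeD n 1 = 0 := by
  simp [modeD, freq, Real.sin_nat_mul_pi]

theorem integral_modeD_mul_modeD (n m : ℕ) :
    ∫ y in (0 : ℝ)..1, modeD n y * modeD m y
      = (freq m : ℂ) ^ 2 * ∫ y in (0 : ℝ)..1, modeC n y * modeC m y := by
  have h := ((isPrimitive_modeC n).mul (isPrimitive_modeD m)).integral_eq 0 1
  simp only [modeD_zero_right, modeD_one_right, mul_zero, sub_zero] at h
  rw [intervalIntegral.integral_add
    (Continuous.intervalIntegrable (by fun_prop) _ _)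
    (Continuous.intervalIntegrable (by fun_prop) _ _)] at h
  rw [eq_neg_of_add_eq_zero_left h, ← intervalIntegral.integral_neg,
    ← intervalIntegral.integral_const_mul]
  congr 1; ext y; ring

theorem freq_injective : Function.Injective freq := by
  intro a b h
  have := mul_right_cancel₀ Real.pi_ne_zero h
  exact_mod_cast this

theorem integral_modeC_mul_modeC_of_ne {n m : ℕ} (h : n ≠ m) :
    ∫ y in (0 : ℝ)..1, modeC n y * modeC m y = 0 := by
  have h1 := integral_modeD_mul_modeD n m
  have h2 := integral_modeD_mul_modeD m n
  have e1 : ∫ y in (0 : ℝ)..1, modeD m y * modeD n y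
      = ∫ y in (0 : ℝ)..1, modeD n y * modeD m y := by congr 1; ext y; ring
  have e2 : ∫ y in (0 : ℝ)..1, modeC m y * modeC n y
      = ∫ y in (0 : ℝ)..1, modeC n y * modeC m y := by congr 1; ext y; ring
  rw [e1, e2, h1] at h2
  have h3 : ((freq m : ℂ) ^ 2 - (freq n : ℂ) ^ 2) *
      ∫ y in (0 : ℝ)..1, modeC n y * modeC m y = 0 := by rw [sub_mul, h2, sub_self]
  refine (mul_eq_zero.1 h3).resolve_left fun h4 => h ?_
  have h5 : freq m ^ 2 = freq n ^ 2 := by exact_mod_cast sub_eq_zero.1 h4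
  exact freq_injective ((pow_left_inj₀ (freq_nonneg n) (freq_nonneg m) two_ne_zero).1 h5.symm)

theorem integral_modeC_mul_self (n : ℕ) : ∫ y in (0 : ℝ)..1, modeC n y * modeC n y = 1 := by
  rcases Nat.eq_zero_or_pos n with rfl | hn
  · simp [modeC, mode]
  have h1 := integral_modeD_mul_modeD n n
  have hf : (freq n : ℂ) ≠ 0 := by
    have : freq n ≠ 0 := by unfold freq; positivity
    exact_mod_cast this
  have h2 : ∀ y, modeD n y * modeD n y = 2 * (freq n : ℂ) ^ 2 -
      (freq n : ℂ) ^ 2 * (modeC n y * modeC n y) := by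
    intro y
    have ha : modeAmp n ^ 2 = 2 := by
      unfold modeAmp; rw [if_neg hn.ne']; exact Real.sq_sqrt (by norm_num)
    have hr : (modeAmp n * freq n * Real.sin (freq n * y)) ^ 2
        = 2 * freq n ^ 2 - freq n ^ 2 * mode n y ^ 2 := by
      rw [mode_eq, mul_pow, mul_pow, mul_pow, ha, Real.sin_sq]; ring
    have hr' : ((modeAmp n * freq n * Real.sin (freq n * y) : ℝ) : ℂ) ^ 2
        = 2 * (freq n : ℂ) ^ 2 - (freq n : ℂ) ^ 2 * (mode n y : ℂ) ^ 2 := by exact_mod_cast hr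
    calc modeD n y * modeD n y
        = ((modeAmp n * freq n * Real.sin (freq n * y) : ℝ) : ℂ) ^ 2 := by
          rw [modeD]; push_cast; ring
      _ = _ := by rw [hr', modeC]; ring
  simp only [h2] at h1
  rw [intervalIntegral.integral_sub intervalIntegrable_const
    (Continuous.intervalIntegrable (by fun_prop) _ _)] at h1
  simp only [intervalIntegral.integral_const_mul, intervalIntegral.integral_const, sub_zero,
    one_smul] at h1
  have h3 : (2 * (freq n : ℂ) ^ 2) * ((∫ y in (0 : ℝ)..1, modeC n y * modeC n y) - 1) = 0 := by
    linear_combination -h1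
  exact sub_eq_zero.1 ((mul_eq_zero.1 h3).resolve_left (by simpa using hf))

/-! ### Functions with separated variables -/

theorem volume_restrict_box (R : ℝ) : (volume : Measure (ℝ × ℝ)).restrict (box R)
    = (volume.restrict (Ioo (-R) R)).prod (volume.restrict (Ioo (0 : ℝ) 1)) := by
  rw [Measure.prod_restrict]; rfl

/-- The function `(x, y) ↦ F x * G y`. -/
def sep (F G : ℝ → ℂ) (p : ℝ × ℝ) : ℂ := F p.1 * G p.2

theorem memLp_sep {R : ℝ} {F G : ℝ → ℂ} (hF : MemLp F 2 (volume.restrict (Ioo (-R) R)))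
    (hG : MemLp G 2 (volume.restrict (Ioo (0 : ℝ) 1))) :
    MemLp (sep F G) 2 (volume.restrict (box R)) := by
  rw [volume_restrict_box, memLp_two_iff_integrable_sq_norm]
  · have h1 := (memLp_two_iff_integrable_sq_norm hF.1).1 hF
    have h2 := (memLp_two_iff_integrable_sq_norm hG.1).1 hG
    simpa [sep, mul_pow] using h1.mul_prod h2
  · exact (hF.1.comp_fst).mul hG.1.comp_snd

open Classical in
/-- The class of `(x, y) ↦ F x * G y` in `L²`. -/
noncomputable def tens (R : ℝ) (F G : ℝ → ℂ) : L2 (box R) :=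
  if h : MemLp (sep F G) 2 (volume.restrict (box R)) then h.toLp else 0

variable {R : ℝ} {F G F' G' : ℝ → ℂ}

theorem coeFn_tens (hF : MemLp F 2 (volume.restrict (Ioo (-R) R)))
    (hG : MemLp G 2 (volume.restrict (Ioo (0 : ℝ) 1))) :
    tens R F G =ᵐ[volume.restrict (box R)] sep F G := by
  have h := memLp_sep hF hG
  rw [tens, dif_pos h]
  exact h.coeFn_toLp

theorem Continuous.memLp_Ioo (h : Continuous F) (a b : ℝ) :
    MemLp F 2 (volume.restrict (Ioo a b)) := by
  obtain ⟨C, hC⟩ := (isCompact_Icc (a := a) (b := b)).exists_bound_of_continuousOn h.continuousOn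
  refine MemLp.of_bound h.aestronglyMeasurable C ?_
  filter_upwards [ae_restrict_mem measurableSet_Ioo] with x hx
  exact hC x (Ioo_subset_Icc_self hx)

theorem inner_tens (hF : MemLp F 2 (volume.restrict (Ioo (-R) R)))
    (hG : MemLp G 2 (volume.restrict (Ioo (0 : ℝ) 1))) (h : L2 (box R)) :
    inner ℂ (tens R F G) h = ∫ p in box R, h p * (starRingEnd ℂ) (sep F G p) := by
  rw [L2.inner_def]
  apply integral_congr_ae
  filter_upwards [coeFn_tens hF hG] with p hp
  rw [hp]; rfl

theorem inner_tens_tens (hF : MemLp F 2 (volume.restrict (Ioo (-R) R)))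
    (hG : MemLp G 2 (volume.restrict (Ioo (0 : ℝ) 1)))
    (hF' : MemLp F' 2 (volume.restrict (Ioo (-R) R)))
    (hG' : MemLp G' 2 (volume.restrict (Ioo (0 : ℝ) 1))) :
    inner ℂ (tens R F G) (tens R F' G')
      = (∫ x in Ioo (-R) R, F' x * (starRingEnd ℂ) (F x)) *
        ∫ y in Ioo (0 : ℝ) 1, G' y * (starRingEnd ℂ) (G y) := by
  rw [inner_tens hF hG, ← integral_prod_mul, ← volume_restrict_box]
  apply integral_congr_ae
  filter_upwards [coeFn_tens hF' hG'] with p hp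
  rw [hp]; simp only [sep, map_mul]; ring

/-- The squared norm of a function in `L²(-R,R)`. -/
noncomputable def normSq (R : ℝ) (F : ℝ → ℂ) : ℝ := ∫ x in Ioo (-R) R, ‖F x‖ ^ 2

theorem normSq_nonneg (R : ℝ) (F : ℝ → ℂ) : 0 ≤ normSq R F :=
  integral_nonneg fun _ => by positivity

theorem integral_mul_conj (s : Set ℝ) (F : ℝ → ℂ) :
    ∫ x in s, F x * (starRingEnd ℂ) (F x) = ((∫ x in s, ‖F x‖ ^ 2 : ℝ) : ℂ) := by
  rw [← integral_complex_ofReal]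
  congr 1; ext x
  rw [Complex.mul_conj, Complex.normSq_eq_norm_sq]

theorem norm_tens_sq (hF : MemLp F 2 (volume.restrict (Ioo (-R) R)))
    (hG : MemLp G 2 (volume.restrict (Ioo (0 : ℝ) 1))) :
    ‖tens R F G‖ ^ 2 = normSq R F * ∫ y in Ioo (0 : ℝ) 1, ‖G y‖ ^ 2 := by
  have h := inner_tens_tens hF hG hF hG
  rw [inner_self_eq_norm_sq_to_K, integral_mul_conj, integral_mul_conj] at h
  unfold normSq
  apply Complex.ofReal_injective
  push_cast
  exact h

theorem integral_Ioo_eq {a b : ℝ} (hab : a ≤ b) (f : ℝ → ℂ) :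
    ∫ x in Ioo a b, f x = ∫ x in a..b, f x := by
  rw [intervalIntegral.integral_of_le hab, integral_Ioc_eq_integral_Ioo]

theorem conj_modeC (n : ℕ) (y : ℝ) : (starRingEnd ℂ) (modeC n y) = modeC n y :=
  Complex.conj_ofReal _

theorem conj_modeD (n : ℕ) (y : ℝ) : (starRingEnd ℂ) (modeD n y) = modeD n y :=
  Complex.conj_ofReal _

theorem integral_norm_modeC_sq (n : ℕ) : ∫ y in Ioo (0 : ℝ) 1, ‖modeC n y‖ ^ 2 = 1 := by
  apply Complex.ofReal_injective
  rw [← integral_mul_conj, integral_Ioo_eq zero_le_one]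
  simp only [conj_modeC]
  rw [integral_modeC_mul_self]; simp

theorem integral_norm_modeD_sq (n : ℕ) :
    ∫ y in Ioo (0 : ℝ) 1, ‖modeD n y‖ ^ 2 = freq n ^ 2 := by
  apply Complex.ofReal_injective
  rw [← integral_mul_conj, integral_Ioo_eq zero_le_one]
  simp only [conj_modeD]
  rw [integral_modeD_mul_modeD, integral_modeC_mul_self]; simp

theorem memLp_modeC (n : ℕ) : MemLp (modeC n) 2 (volume.restrict (Ioo (0 : ℝ) 1)) :=
  Continuous.memLp_Ioo (continuous_modeC n) 0 1

theorem memLp_modeD (n : ℕ) : MemLp (modeD n) 2 (volume.restrict (Ioo (0 : ℝ) 1)) :=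
  Continuous.memLp_Ioo (continuous_modeD n) 0 1

theorem memLp_modeDD (n : ℕ) : MemLp (fun y => -(freq n : ℂ) ^ 2 * modeC n y) 2
    (volume.restrict (Ioo (0 : ℝ) 1)) :=
  (memLp_modeC n).const_mul _

end Waveguide

namespace Waveguide

variable {R : ℝ} {F G f g : ℝ → ℂ} {φ : ℝ × ℝ → ℝ} {V U : Set (ℝ × ℝ)}

/-! ### Integration by parts on slices -/

theorem IsTest.continuous_partialDeriv (hφ : IsTest V φ) (i : Fin 2) :
    Continuous (partialDeriv i φ) :=
  (hφ.smooth.continuous_fderiv (by simp)).clm_apply continuous_const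

theorem IsTest.mono (hφ : IsTest V φ) (h : V ⊆ U) : IsTest U φ :=
  ⟨hφ.smooth, hφ.compact, hφ.supp.trans h⟩

theorem hasDerivAt_slice_fst (hφ : ContDiff ℝ ((⊤ : ℕ∞) : WithTop ℕ∞) φ) (x y : ℝ) :
    HasDerivAt (fun x => φ (x, y)) (partialDeriv 0 φ (x, y)) x := by
  have h1 : HasFDerivAt φ (fderiv ℝ φ (x, y)) (x, y) :=
    (hφ.differentiable (by simp) _).hasFDerivAt
  have h2 : HasDerivAt (fun x : ℝ => (x, y)) ((1 : ℝ), (0 : ℝ)) x :=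
    (hasDerivAt_id x).prodMk (hasDerivAt_const x y)
  simpa [partialDeriv, basisVec] using! h1.comp_hasDerivAt x h2

theorem hasDerivAt_slice_snd (hφ : ContDiff ℝ ((⊤ : ℕ∞) : WithTop ℕ∞) φ) (x y : ℝ) :
    HasDerivAt (fun y => φ (x, y)) (partialDeriv 1 φ (x, y)) y := by
  have h1 : HasFDerivAt φ (fderiv ℝ φ (x, y)) (x, y) :=
    (hφ.differentiable (by simp) _).hasFDerivAt
  have h2 : HasDerivAt (fun y : ℝ => (x, y)) ((0 : ℝ), (1 : ℝ)) y :=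
    (hasDerivAt_const y x).prodMk (hasDerivAt_id y)
  simpa [partialDeriv, basisVec] using! h1.comp_hasDerivAt y h2

theorem integrable_smul_sep {ψ : ℝ × ℝ → ℝ} (hψ : Continuous ψ) (hF : LocallyIntegrable F)
    (hG : LocallyIntegrable G) (R : ℝ) :
    Integrable (fun p => ψ p • sep F G p)
      ((volume.restrict (Ioo (-R) R)).prod (volume.restrict (Ioo (0 : ℝ) 1))) := by
  have h1 : Integrable F (volume.restrict (Ioo (-R) R)) :=
    (hF.integrableOn_isCompact (isCompact_Icc (a := -R) (b := R))).mono_set Ioo_subset_Icc_self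
  have h2 : Integrable G (volume.restrict (Ioo (0 : ℝ) 1)) :=
    (hG.integrableOn_isCompact (isCompact_Icc (a := 0) (b := 1))).mono_set Ioo_subset_Icc_self
  obtain ⟨C, hC⟩ := ((isCompact_Icc (a := -R) (b := R)).prod
    (isCompact_Icc (a := (0 : ℝ)) (b := 1))).exists_bound_of_continuousOn hψ.continuousOn
  refine (h1.mul_prod h2).bdd_smul C hψ.aestronglyMeasurable ?_
  rw [Measure.prod_restrict]
  filter_upwards [ae_restrict_mem (measurableSet_Ioo.prod measurableSet_Ioo)] with p hp
  exact hC p ⟨Ioo_subset_Icc_self hp.1, Ioo_subset_Icc_self hp.2⟩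

/-- One-dimensional integration by parts without boundary terms. -/
theorem integral_parts {a b : ℝ} (hab : a ≤ b) {ψ ψ' : ℝ → ℝ} (hF : IsPrimitive F f)
    (hψ : ∀ x, HasDerivAt ψ (ψ' x) x) (hψ' : Continuous ψ') (ha : ψ a • F a = 0)
    (hb : ψ b • F b = 0) :
    ∫ x in Ioo a b, ψ' x • F x = -∫ x in Ioo a b, ψ x • f x := by
  have hψp : IsPrimitive (fun x => (ψ x : ℂ)) (fun x => (ψ' x : ℂ)) :=
    .of_hasDerivAt (fun x => (hψ x).ofReal_comp) (by fun_prop)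
  have hψc : Continuous ψ := continuous_iff_continuousAt.2 fun x => (hψ x).continuousAt
  have h := (hψp.mul hF).integral_eq a b
  have hFc := hF.continuous
  have i2 : IntervalIntegrable (fun x => (ψ x : ℂ) * f x) volume a b :=
    (hF.intervalIntegrable a b).continuousOn_mul (by fun_prop)
  rw [intervalIntegral.integral_add (Continuous.intervalIntegrable (by fun_prop) _ _) i2] at h
  simp only [Complex.real_smul] at ha hb ⊢
  rw [ha, hb, sub_zero] at h
  rw [integral_Ioo_eq hab, integral_Ioo_eq hab]
  exact eq_neg_of_add_eq_zero_left h

theorem integral_partialDeriv_zero_smul_sep (hR : 0 < R)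
    (hφ : IsTest (Ioo (-R) R ×ˢ univ) φ) (hF : IsPrimitive F f) (hG : Continuous G) :
    ∫ p in box R, partialDeriv 0 φ p • sep F G p = -∫ p in box R, φ p • sep f G p := by
  rw [volume_restrict_box,
    integral_prod_symm _ (integrable_smul_sep (hφ.continuous_partialDeriv 0)
      hF.continuous.locallyIntegrable hG.locallyIntegrable R),
    integral_prod_symm _ (integrable_smul_sep hφ.smooth.continuous hF.locInt
      hG.locallyIntegrable R), ← integral_neg]
  congr 1
  ext y
  have h0 : ∀ x, x ∉ Ioo (-R) R → φ (x, y) = 0 := fun x hx =>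
    image_eq_zero_of_notMem_tsupport fun h => hx (hφ.supp h).1
  have h := integral_parts (ψ := fun x => φ (x, y)) (ψ' := fun x => partialDeriv 0 φ (x, y))
    (by linarith : -R ≤ R) hF (fun x => hasDerivAt_slice_fst hφ.smooth x y)
    ((hφ.continuous_partialDeriv 0).comp (by fun_prop)) (by simp [h0]) (by simp [h0])
  simp only [sep, ← smul_mul_assoc]
  rw [integral_mul_const, integral_mul_const, h, neg_mul]

theorem integral_partialDeriv_one_smul_sep (hφ : IsTest V φ) (hF : LocallyIntegrable F)
    (hG : IsPrimitive G g) (h0 : ∀ x, φ (x, 0) • G 0 = 0) (h1 : ∀ x, φ (x, 1) • G 1 = 0) :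
    ∫ p in box R, partialDeriv 1 φ p • sep F G p = -∫ p in box R, φ p • sep F g p := by
  rw [volume_restrict_box,
    integral_prod _ (integrable_smul_sep (hφ.continuous_partialDeriv 1)
      hF hG.continuous.locallyIntegrable R),
    integral_prod _ (integrable_smul_sep hφ.smooth.continuous hF hG.locInt R), ← integral_neg]
  congr 1
  ext x
  have h := integral_parts (ψ := fun y => φ (x, y)) (ψ' := fun y => partialDeriv 1 φ (x, y))
    zero_le_one hG (fun y => hasDerivAt_slice_snd hφ.smooth x y)
    ((hφ.continuous_partialDeriv 1).comp (by fun_prop)) (h0 x) (h1 x)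
  simp only [sep, ← mul_smul_comm]
  rw [integral_const_mul, integral_const_mul, h, mul_neg]

theorem box_subset (R : ℝ) : box R ⊆ Ioo (-R) R ×ˢ univ := prod_mono le_rfl (subset_univ _)

theorem isWeakPartial_zero_tens (hR : 0 < R) (hF : IsPrimitive F f) (hG : Continuous G)
    (hf : MemLp f 2 (volume.restrict (Ioo (-R) R))) :
    IsWeakPartial (box R) 0 (tens R F G) (tens R f G) := by
  intro φ hφ
  have hGL := Continuous.memLp_Ioo hG 0 1
  have e1 : ∫ p in box R, partialDeriv 0 φ p • tens R F G p
      = ∫ p in box R, partialDeriv 0 φ p • sep F G p := integral_congr_ae (by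
    filter_upwards [coeFn_tens (Continuous.memLp_Ioo hF.continuous (-R) R) hGL] with p hp
    rw [hp])
  have e2 : ∫ p in box R, φ p • tens R f G p = ∫ p in box R, φ p • sep f G p :=
    integral_congr_ae (by filter_upwards [coeFn_tens hf hGL] with p hp; rw [hp])
  rw [e1, e2, integral_partialDeriv_zero_smul_sep hR (hφ.mono (box_subset R)) hF hG]

theorem isWeakPartial_one_tens (hF : LocallyIntegrable F) (hG : IsPrimitive G g)
    (hFL : MemLp F 2 (volume.restrict (Ioo (-R) R)))
    (hg : MemLp g 2 (volume.restrict (Ioo (0 : ℝ) 1))) :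
    IsWeakPartial (box R) 1 (tens R F G) (tens R F g) := by
  intro φ hφ
  have e1 : ∫ p in box R, partialDeriv 1 φ p • tens R F G p
      = ∫ p in box R, partialDeriv 1 φ p • sep F G p := integral_congr_ae (by
    filter_upwards [coeFn_tens hFL (Continuous.memLp_Ioo hG.continuous 0 1)] with p hp
    rw [hp])
  have e2 : ∫ p in box R, φ p • tens R F g p = ∫ p in box R, φ p • sep F g p :=
    integral_congr_ae (by filter_upwards [coeFn_tens hFL hg] with p hp; rw [hp])
  have h0 : ∀ x y, y ∉ Ioo (0 : ℝ) 1 → φ (x, y) = 0 := fun x y hy =>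
    image_eq_zero_of_notMem_tsupport fun h => hy (hφ.supp h).2
  rw [e1, e2, integral_partialDeriv_one_smul_sep hφ hF hG (by simp [h0]) (by simp [h0])]

/-! ### The Hilbert space `H²` -/

/-- Integration against a real function of class `L²`, as a functional on `L²`. -/
noncomputable def testCLM {φ : ℝ × ℝ → ℝ} (hφ : MemLp φ 2 (volume.restrict U)) :
    L2 U →L[ℂ] ℂ := innerSL ℂ (hφ.ofReal (K := ℂ)).toLp

theorem testCLM_apply (hφ : MemLp φ 2 (volume.restrict U)) (h : L2 U) :
    testCLM hφ h = ∫ p in U, φ p • h p := by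
  rw [testCLM, innerSL_apply_apply, L2.inner_def]
  apply integral_congr_ae
  filter_upwards [(hφ.ofReal (K := ℂ)).coeFn_toLp] with p hp
  rw [hp, Complex.real_smul, mul_comm]
  simp [RCLike.inner_apply]

theorem isClosed_setOf_isWeakPartial {E : Type*} [TopologicalSpace E] {a b : E → L2 U}
    (ha : Continuous a) (hb : Continuous b) (i : Fin 2) :
    IsClosed {v : E | IsWeakPartial U i (a v) (b v)} := by
  simp only [IsWeakPartial, ofPred_forall]
  refine isClosed_iInter fun φ => isClosed_iInter fun hφ => ?_
  simp only [← testCLM_apply (hφ.memLp _), ← testCLM_apply (hφ.memLp_partialDeriv i _)]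
  exact isClosed_eq ((ContinuousLinearMap.continuous _).comp ha)
    ((ContinuousLinearMap.continuous _).comp hb).neg

theorem isClosed_H2 (U : Set (ℝ × ℝ)) :
    IsClosed (H2 U : Set (PiLp 2 fun _ : JetIndex => L2 U)) := by
  have hc : ∀ i, Continuous fun v : PiLp 2 fun _ : JetIndex => L2 U => v i :=
    fun i => PiLp.continuous_apply 2 _ i
  have : (H2 U : Set (PiLp 2 fun _ : JetIndex => L2 U)) =
      (⋂ j, {v | IsWeakPartial U j (v (.inl ())) (v (.inr (.inl j)))}) ∩
      ⋂ i, ⋂ j, {v | IsWeakPartial U i (v (.inr (.inl j))) (v (.inr (.inr (i, j))))} := by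
    ext v
    simp [H2]
  rw [this]
  refine (isClosed_iInter fun j => ?_).inter (isClosed_iInter fun i => isClosed_iInter fun j => ?_)
  · exact isClosed_setOf_isWeakPartial (hc _) (hc _) j
  · exact isClosed_setOf_isWeakPartial (hc _) (hc _) i

instance (U : Set (ℝ × ℝ)) : CompleteSpace (H2 U) := (isClosed_H2 U).completeSpace_coe

/-- A component of the jet of an element of `H²`. -/
noncomputable def jetCLM (U : Set (ℝ × ℝ)) (i : JetIndex) : H2 U →L[ℂ] L2 U :=
  (PiLp.proj 2 (fun _ : JetIndex => L2 U) i).comp (H2 U).subtypeL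

theorem val_eq (v : H2 U) : val v = jetCLM U (.inl ()) v := rfl

theorem norm_H2_sq (v : H2 U) : ‖v‖ ^ 2 = ∑ i, ‖jetCLM U i v‖ ^ 2 :=
  PiLp.norm_sq_eq_of_L2 _ _

theorem inner_H2 (v w : H2 U) : inner ℂ v w = ∑ i, inner ℂ (jetCLM U i v) (jetCLM U i w) :=
  PiLp.inner_apply _ _

theorem norm_jetCLM_le (v : H2 U) (i : JetIndex) : ‖jetCLM U i v‖ ≤ ‖v‖ := by
  refine le_of_sq_le_sq ?_ (norm_nonneg _)
  rw [norm_H2_sq]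
  exact Finset.single_le_sum (f := fun i => ‖jetCLM U i v‖ ^ 2) (fun _ _ => by positivity)
    (Finset.mem_univ i)

theorem IsWeakPartial.unique (hU : IsOpen U) {i : Fin 2} {a b b' : L2 U}
    (h : IsWeakPartial U i a b) (h' : IsWeakPartial U i a b') : b = b' := by
  have hz : ∀ᵐ p, p ∈ U → (b p - b' p) = 0 := by
    refine hU.ae_eq_zero_of_integral_contDiff_smul_eq_zero ?_ fun φ h1 h2 h3 => ?_
    · refine (locallyIntegrableOn_iff hU.isLocallyClosed).2 fun K hK hKc => ?_
      have hm : MemLp (fun p => b p - b' p) 2 (volume.restrict U) := (Lp.memLp b).sub (Lp.memLp b')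
      have : IsFiniteMeasure (volume.restrict K) :=
        ⟨by simpa using hKc.measure_lt_top⟩
      exact ((hm.mono_measure (Measure.restrict_mono hK le_rfl)).integrable one_le_two)
    · have hφ : IsTest U φ := ⟨h1, h2, h3⟩
      have e : ∫ p, φ p • (b p - b' p) = ∫ p in U, φ p • (b p - b' p) := by
        rw [setIntegral_eq_integral_of_forall_compl_eq_zero]
        intro p hp
        rw [image_eq_zero_of_notMem_tsupport fun hh => hp (h3 hh), zero_smul]
      rw [e]
      simp only [smul_sub]
      rw [integral_sub (integrable_test_smul (hφ.memLp _) b)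
        (integrable_test_smul (hφ.memLp _) b'), sub_eq_zero]
      exact neg_injective ((h φ hφ).symm.trans (h' φ hφ))
  apply Lp.ext
  rw [EventuallyEq, ae_restrict_iff' hU.measurableSet]
  filter_upwards [hz] with p hp hpU
  exact sub_eq_zero.1 (hp hpU)

theorem H2.ext (hU : IsOpen U) {v w : H2 U} (h : val v = val w) : v = w := by
  have hg : ∀ j, grad v j = grad w j := fun j =>
    IsWeakPartial.unique hU (v.2.1 j) (by
      have := w.2.1 j
      change IsWeakPartial U j (val v) _
      rw [h]; exact this)
  have hh : ∀ i j, hess v i j = hess w i j := fun i j =>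
    IsWeakPartial.unique hU (v.2.2 i j) (by
      have := w.2.2 i j
      change IsWeakPartial U i (grad v j) _
      rw [hg]; exact this)
  apply Subtype.ext
  apply PiLp.ext
  rintro (_ | j | ⟨i, j⟩)
  exacts [h, hg j, hh i j]

theorem isOpen_box (R : ℝ) : IsOpen (box R) := isOpen_Ioo.prod isOpen_Ioo

/-! ### Jets of functions with separated variables -/

/-- The number of derivatives in the direction `j` contained in a jet index. -/
def order (j : Fin 2) : JetIndex → ℕ
  | .inl _ => 0
  | .inr (.inl i) => if i = j then 1 else 0
  | .inr (.inr (i, i')) => (if i = j then 1 else 0) + (if i' = j then 1 else 0)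

/-- Selection of a function, its first or its second derivative. -/
def der (w q p : ℝ → ℂ) : ℕ → ℝ → ℂ
  | 0 => w
  | 1 => q
  | _ => p

/-- The derivatives of the mode `φₙ`. -/
noncomputable def modeDer (n : ℕ) : ℕ → ℝ → ℂ :=
  der (modeC n) (modeD n) fun y => -(freq n : ℂ) ^ 2 * modeC n y

/-- The function `w`, with derivatives `q` and `p` of order one and two, is locally `H²`. -/
structure IsProfile (w q p : ℝ → ℂ) : Prop where
  fst : IsPrimitive w q
  snd : IsPrimitive q p
  memLp : ∀ R, MemLp p 2 (volume.restrict (Ioo (-R) R))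

variable {w q p : ℝ → ℂ}

theorem IsProfile.memLp_der (h : IsProfile w q p) (R : ℝ) :
    ∀ a, MemLp (der w q p a) 2 (volume.restrict (Ioo (-R) R))
  | 0 => Continuous.memLp_Ioo h.fst.continuous _ _
  | 1 => Continuous.memLp_Ioo h.snd.continuous _ _
  | _ + 2 => h.memLp R

theorem memLp_modeDer (n : ℕ) : ∀ a, MemLp (modeDer n a) 2 (volume.restrict (Ioo (0 : ℝ) 1))
  | 0 => memLp_modeC n
  | 1 => memLp_modeD n
  | _ + 2 => memLp_modeDD n

/-- The element `w(x) φₙ(y)` of `H²`. -/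
noncomputable def jet (hR : 0 < R) (h : IsProfile w q p) (n : ℕ) : H2 (box R) :=
  ⟨WithLp.toLp 2 fun i => tens R (der w q p (order 0 i)) (modeDer n (order 1 i)), by
    have hw := h.fst.continuous.locallyIntegrable (μ := volume)
    have hq := h.snd.continuous.locallyIntegrable (μ := volume)
    have a0 := isWeakPartial_zero_tens hR h.fst (continuous_modeC n) (h.memLp_der R 1)
    have a1 := isWeakPartial_one_tens hw (isPrimitive_modeC n) (h.memLp_der R 0) (memLp_modeD n)
    have a00 := isWeakPartial_zero_tens hR h.snd (continuous_modeC n) (h.memLp R)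
    have a01 := isWeakPartial_zero_tens hR h.fst (continuous_modeD n) (h.memLp_der R 1)
    have a10 := isWeakPartial_one_tens hq (isPrimitive_modeC n) (h.memLp_der R 1) (memLp_modeD n)
    have a11 := isWeakPartial_one_tens hw (isPrimitive_modeD n) (h.memLp_der R 0) (memLp_modeDD n)
    constructor
    · intro j
      fin_cases j
      exacts [a0, a1]
    · intro i j
      fin_cases i <;> fin_cases j
      exacts [a00, a01, a10, a11]⟩

theorem jetCLM_jet (hR : 0 < R) (h : IsProfile w q p) (n : ℕ) (i : JetIndex) :
    jetCLM (box R) i (jet hR h n) = tens R (der w q p (order 0 i)) (modeDer n (order 1 i)) := rfl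

theorem integral_norm_modeDer_sq (n : ℕ) : ∀ a < 3,
    ∫ y in Ioo (0 : ℝ) 1, ‖modeDer n a y‖ ^ 2 = (freq n ^ 2) ^ a
  | 0, _ => by simpa using! integral_norm_modeC_sq n
  | 1, _ => by simpa using! integral_norm_modeD_sq n
  | 2, _ => by
    have : ∀ y, ‖modeDer n 2 y‖ ^ 2 = (freq n ^ 2) ^ 2 * ‖modeC n y‖ ^ 2 := by
      intro y
      simp only [modeDer, der, norm_mul, norm_neg, norm_pow, Complex.norm_real, mul_pow]
      simp
    simp only [this]
    rw [integral_const_mul, integral_norm_modeC_sq, mul_one]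

theorem integral_modeDer_mul_of_ne {n m : ℕ} (hnm : n ≠ m) : ∀ a : ℕ,
    ∫ y in Ioo (0 : ℝ) 1, modeDer m a y * (starRingEnd ℂ) (modeDer n a y) = 0
  | 0 => by
    rw [integral_Ioo_eq zero_le_one]
    simp only [modeDer, der, conj_modeC]
    exact integral_modeC_mul_modeC_of_ne hnm.symm
  | 1 => by
    rw [integral_Ioo_eq zero_le_one]
    simp only [modeDer, der, conj_modeD]
    rw [integral_modeD_mul_modeD, integral_modeC_mul_modeC_of_ne hnm.symm, mul_zero]
  | _ + 2 => by
    rw [integral_Ioo_eq zero_le_one]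
    simp only [modeDer, der, map_mul, map_neg, map_pow, Complex.conj_ofReal, conj_modeC]
    have : ∀ y, -(freq m : ℂ) ^ 2 * modeC m y * (-(freq n : ℂ) ^ 2 * modeC n y)
        = ((freq m : ℂ) ^ 2 * (freq n : ℂ) ^ 2) * (modeC m y * modeC n y) := fun y => by ring
    simp only [this]
    rw [intervalIntegral.integral_const_mul, integral_modeC_mul_modeC_of_ne hnm.symm, mul_zero]

theorem inner_jet_of_ne (hR : 0 < R) (h : IsProfile w q p) {w' q' p' : ℝ → ℂ}
    (h' : IsProfile w' q' p') {n m : ℕ} (hnm : n ≠ m) :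
    inner ℂ (jet hR h n) (jet hR h' m) = 0 := by
  rw [inner_H2]
  refine Finset.sum_eq_zero fun i _ => ?_
  rw [jetCLM_jet, jetCLM_jet, inner_tens_tens (h.memLp_der R _) (memLp_modeDer n _)
    (h'.memLp_der R _) (memLp_modeDer m _), integral_modeDer_mul_of_ne hnm, mul_zero]

theorem norm_jet_sq (hR : 0 < R) (h : IsProfile w q p) (n : ℕ) :
    ‖jet hR h n‖ ^ 2 = (1 + freq n ^ 2 + freq n ^ 4) * normSq R w
      + (1 + 2 * freq n ^ 2) * normSq R q + normSq R p := by
  have : ∀ i, ‖jetCLM (box R) i (jet hR h n)‖ ^ 2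
      = normSq R (der w q p (order 0 i)) * (freq n ^ 2) ^ (order 1 i) := by
    intro i
    rw [jetCLM_jet, norm_tens_sq (h.memLp_der R _) (memLp_modeDer n _),
      integral_norm_modeDer_sq n _ (by
        rcases i with _ | j | ⟨i, j⟩
        · simp [order]
        · simp only [order]; split_ifs <;> norm_num
        · simp only [order]; split_ifs <;> norm_num)]
  rw [norm_H2_sq]
  simp only [this, Fintype.sum_sum_type, Fintype.sum_prod_type, Fin.sum_univ_two, order, der]
  simp
  ring

/-! ### Orthogonal series -/

theorem summable_of_orthogonal {E : Type*} [NormedAddCommGroup E] [InnerProductSpace ℂ E]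
    [CompleteSpace E] {v : ℕ → E} (hv : ∀ n m, n ≠ m → inner ℂ (v n) (v m) = 0)
    {c : ℕ → ℝ} (hc : Summable c) (hle : ∀ n, ‖v n‖ ^ 2 ≤ c n) :
    Summable v ∧ ‖∑' n, v n‖ ^ 2 ≤ ∑' n, c n := by
  have hV : OrthogonalFamily ℂ (fun n => (Submodule.span ℂ {v n} : Submodule ℂ E))
      fun n => (Submodule.span ℂ {v n}).subtypeₗᵢ := by
    intro n m hnm x y
    obtain ⟨a, ha⟩ := Submodule.mem_span_singleton.1 x.2
    obtain ⟨b, hb⟩ := Submodule.mem_span_singleton.1 y.2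
    change inner ℂ (x : E) (y : E) = 0
    rw [← ha, ← hb, inner_smul_left, inner_smul_right, hv n m hnm, mul_zero, mul_zero]
  let f : ∀ n, Submodule.span ℂ {v n} := fun n => ⟨v n, Submodule.mem_span_singleton_self _⟩
  have hs : Summable fun n => ‖f n‖ ^ 2 :=
    Summable.of_nonneg_of_le (fun n => by positivity) hle hc
  have hsv : Summable v := (hV.summable_iff_norm_sq_summable f).2 hs
  refine ⟨hsv, ?_⟩
  refine le_of_tendsto ((hsv.hasSum.norm).pow 2) (Eventually.of_forall fun s => ?_)
  have h1 : ‖∑ n ∈ s, v n‖ ^ 2 = ∑ n ∈ s, ‖v n‖ ^ 2 := hV.norm_sum f s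
  rw [h1]
  exact (Finset.sum_le_sum fun n _ => hle n).trans
    (hc.sum_le_tsum s fun n _ => (sq_nonneg _).trans (hle n))

end Waveguide

namespace Waveguide

/-! ### Completeness of the modes -/

theorem integral_cos_mul_cos_pow {f : ℝ → ℂ} (hf : IntegrableOn f (Ioo 0 1))
    (h : ∀ n : ℕ, ∫ y in Ioo (0 : ℝ) 1, Real.cos (n * (Real.pi * y)) • f y = 0) (m : ℕ) :
    ∀ n : ℕ, ∫ y in Ioo (0 : ℝ) 1,
      (Real.cos (n * (Real.pi * y)) * Real.cos (Real.pi * y) ^ m) • f y = 0 := by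
  have hi : ∀ (n m : ℕ), Integrable (fun y => (Real.cos (n * (Real.pi * y)) *
      Real.cos (Real.pi * y) ^ m) • f y) (volume.restrict (Ioo (0 : ℝ) 1)) := by
    intro n m
    have hc : Continuous fun y => Real.cos (n * (Real.pi * y)) * Real.cos (Real.pi * y) ^ m := by
      fun_prop
    refine hf.bdd_smul 1 hc.aestronglyMeasurable (ae_of_all _ fun y => ?_)
    rw [Real.norm_eq_abs, abs_mul, abs_pow]
    exact mul_le_one₀ (Real.abs_cos_le_one _) (by positivity)
      (pow_le_one₀ (abs_nonneg _) (Real.abs_cos_le_one _))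
  induction m with
  | zero => intro n; simpa using h n
  | succ m ih =>
    intro n
    rcases n with _ | n
    · have := ih 1
      simpa [pow_succ'] using this
    · have e : ∀ y, (Real.cos ((n + 1 : ℕ) * (Real.pi * y)) * Real.cos (Real.pi * y) ^ (m + 1)) • f y
          = (1 / 2 : ℝ) • ((Real.cos ((n + 2 : ℕ) * (Real.pi * y)) * Real.cos (Real.pi * y) ^ m) • f y)
          + (1 / 2 : ℝ) • ((Real.cos (n * (Real.pi * y)) * Real.cos (Real.pi * y) ^ m) • f y) := by
        intro y
        rw [smul_smul, smul_smul, ← add_smul]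
        congr 1
        have e1 : ((n + 2 : ℕ) : ℝ) * (Real.pi * y) = (n + 1 : ℕ) * (Real.pi * y) + Real.pi * y := by
          push_cast; ring
        have e2 : (n : ℝ) * (Real.pi * y) = (n + 1 : ℕ) * (Real.pi * y) - Real.pi * y := by
          push_cast; ring
        rw [e1, e2, Real.cos_add, Real.cos_sub]
        ring
      simp only [e]
      have hs : ∀ n : ℕ, Integrable (fun y => (1 / 2 : ℝ) • ((Real.cos (n * (Real.pi * y)) *
          Real.cos (Real.pi * y) ^ m) • f y)) (volume.restrict (Ioo (0 : ℝ) 1)) :=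
        fun n => (hi n m).smul (1 / 2 : ℝ)
      rw [integral_add (hs _) (hs _), integral_smul, integral_smul, ih, ih]
      simp

theorem ae_eq_zero_of_integral_mode {f : ℝ → ℂ} (hf : IntegrableOn f (Ioo 0 1))
    (h : ∀ n : ℕ, ∫ y in Ioo (0 : ℝ) 1, mode n y • f y = 0) :
    f =ᵐ[volume.restrict (Ioo (0 : ℝ) 1)] 0 := by
  have hcos : ∀ n : ℕ, ∫ y in Ioo (0 : ℝ) 1, Real.cos (n * (Real.pi * y)) • f y = 0 := by
    intro n
    have h1 := h n
    simp only [mode_eq, mul_smul] at h1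
    rw [integral_smul] at h1
    have ha : modeAmp n ≠ 0 := by unfold modeAmp; split_ifs <;> norm_num
    have h2 := (smul_eq_zero.1 h1).resolve_left ha
    simpa only [freq, mul_assoc] using h2
  have hpoly : ∀ P : Polynomial ℝ,
      ∫ y in Ioo (0 : ℝ) 1, P.eval (Real.cos (Real.pi * y)) • f y = 0 := by
    intro P
    simp only [Polynomial.eval_eq_sum_range, Finset.sum_smul, mul_smul]
    have hm : ∀ i : ℕ, Integrable (fun y => Real.cos (Real.pi * y) ^ i • f y)
        (volume.restrict (Ioo (0 : ℝ) 1)) := fun i => by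
      have hc : Continuous fun y => Real.cos (Real.pi * y) ^ i := by fun_prop
      refine hf.bdd_smul 1 hc.aestronglyMeasurable (ae_of_all _ fun y => ?_)
      rw [Real.norm_eq_abs, abs_pow]
      exact pow_le_one₀ (abs_nonneg _) (Real.abs_cos_le_one _)
    have hm' : ∀ i : ℕ, Integrable (fun y => P.coeff i • Real.cos (Real.pi * y) ^ i • f y)
        (volume.restrict (Ioo (0 : ℝ) 1)) := fun i => (hm i).smul (P.coeff i)
    rw [integral_finsetSum _ fun i _ => hm' i]
    refine Finset.sum_eq_zero fun i _ => ?_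
    rw [integral_smul]
    have := integral_cos_mul_cos_pow hf hcos i 0
    simp only [Nat.cast_zero, zero_mul, Real.cos_zero, one_mul] at this
    rw [this, smul_zero]
  have hcont : ∀ g : ℝ → ℝ, Continuous g → ∫ y in Ioo (0 : ℝ) 1, g y • f y = 0 := by
    intro g hg
    obtain ⟨K, hK, hKf⟩ : ∃ K : ℝ, 0 ≤ K ∧ ∫ y in Ioo (0 : ℝ) 1, ‖f y‖ ≤ K :=
      ⟨_, integral_nonneg fun _ => norm_nonneg _, le_rfl⟩
    rw [← norm_le_zero_iff]
    refine le_of_forall_pos_le_add fun ε hε => ?_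
    rw [zero_add]
    have hG : ContinuousOn (fun t => g (Real.arccos t / Real.pi)) (Icc (-1) 1) := by
      have := Real.continuous_arccos
      exact Continuous.continuousOn (by fun_prop)
    obtain ⟨P, hP⟩ := exists_polynomial_near_of_continuousOn (-1) 1 _ hG (ε / (K + 1))
      (by positivity)
    obtain ⟨D, hD⟩ := (isCompact_Icc (a := (0 : ℝ)) (b := 1)).exists_bound_of_continuousOn
      hg.continuousOn
    have hgi : Integrable (fun y => g y • f y) (volume.restrict (Ioo (0 : ℝ) 1)) := by
      refine hf.bdd_smul D hg.aestronglyMeasurable ?_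
      filter_upwards [ae_restrict_mem measurableSet_Ioo] with y hy
      exact hD y (Ioo_subset_Icc_self hy)
    have hPc : Continuous fun y => P.eval (Real.cos (Real.pi * y)) :=
      P.continuous.comp (by fun_prop)
    obtain ⟨D', hD'⟩ := (isCompact_Icc (a := (0 : ℝ)) (b := 1)).exists_bound_of_continuousOn
      hPc.continuousOn
    have hPi : Integrable (fun y => P.eval (Real.cos (Real.pi * y)) • f y)
        (volume.restrict (Ioo (0 : ℝ) 1)) := by
      refine hf.bdd_smul D' hPc.aestronglyMeasurable ?_
      filter_upwards [ae_restrict_mem measurableSet_Ioo] with y hy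
      exact hD' y (Ioo_subset_Icc_self hy)
    have e : ∫ y in Ioo (0 : ℝ) 1, g y • f y
        = ∫ y in Ioo (0 : ℝ) 1, (g y • f y - P.eval (Real.cos (Real.pi * y)) • f y) := by
      rw [integral_sub hgi hPi, hpoly, sub_zero]
    rw [e]
    calc ‖∫ y in Ioo (0 : ℝ) 1, (g y • f y - P.eval (Real.cos (Real.pi * y)) • f y)‖
        ≤ ∫ y in Ioo (0 : ℝ) 1, ε / (K + 1) * ‖f y‖ := by
          refine norm_integral_le_of_norm_le (hf.norm.const_mul _) ?_
          filter_upwards [ae_restrict_mem measurableSet_Ioo] with y hy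
          rw [← sub_smul, norm_smul]
          refine mul_le_mul_of_nonneg_right ?_ (norm_nonneg _)
          have h1 := hP (Real.cos (Real.pi * y)) ⟨Real.neg_one_le_cos _, Real.cos_le_one _⟩
          have h2 : Real.arccos (Real.cos (Real.pi * y)) = Real.pi * y :=
            Real.arccos_cos (by have := Real.pi_pos; have := hy.1; positivity)
              (by have := Real.pi_pos; nlinarith [hy.2])
          rw [h2, mul_div_cancel_left₀ _ Real.pi_ne_zero, abs_sub_comm] at h1
          exact h1.le
      _ = ε / (K + 1) * ∫ y in Ioo (0 : ℝ) 1, ‖f y‖ := integral_const_mul _ _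
      _ ≤ ε / (K + 1) * (K + 1) := by gcongr; linarith
      _ = ε := by field_simp
  have hz := isOpen_Ioo.ae_eq_zero_of_integral_contDiff_smul_eq_zero (μ := volume)
    hf.locallyIntegrableOn (fun g h1 h2 h3 => by
      rw [← hcont g h1.continuous, setIntegral_eq_integral_of_forall_compl_eq_zero]
      intro y hy
      rw [image_eq_zero_of_notMem_tsupport fun hh => hy (h3 hh), zero_smul])
  rw [EventuallyEq, ae_restrict_iff' measurableSet_Ioo]
  exact hz

/-! ### Modal coefficients -/

/-- The coefficient of the mode `φₙ` of a function on the waveguide. -/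
noncomputable def coef (n : ℕ) (u : ℝ × ℝ → ℂ) (x : ℝ) : ℂ :=
  ∫ y in Ioo (0 : ℝ) 1, mode n y • u (x, y)

variable {R : ℝ} {u v : ℝ × ℝ → ℂ}

theorem coef_congr_ae (h : u =ᵐ[volume.restrict (box R)] v) (n : ℕ) :
    coef n u =ᵐ[volume.restrict (Ioo (-R) R)] coef n v := by
  rw [volume_restrict_box] at h
  filter_upwards [Measure.ae_ae_of_ae_prod h] with x hx
  exact integral_congr_ae (hx.mono fun y hy => by simp only [hy])

theorem MemLp.integrable_box (h : MemLp u 2 (volume.restrict (box R))) :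
    Integrable u (volume.restrict (box R)) := by
  rw [volume_restrict_box] at h ⊢
  exact h.integrable one_le_two

theorem ae_eq_zero_of_coef (hu : Integrable u (volume.restrict (box R)))
    (h : ∀ n, coef n u =ᵐ[volume.restrict (Ioo (-R) R)] 0) :
    u =ᵐ[volume.restrict (box R)] 0 := by
  set v := hu.1.mk u with hv
  have huv : u =ᵐ[volume.restrict (box R)] v := hu.1.ae_eq_mk
  have hvi := hu.congr huv
  have h' : ∀ n, coef n v =ᵐ[volume.restrict (Ioo (-R) R)] 0 := fun n =>
    (coef_congr_ae huv n).symm.trans (h n)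
  refine huv.trans ?_
  have hm : MeasurableSet {p | v p = (0 : ℝ × ℝ → ℂ) p} :=
    measurableSet_eq_fun hu.1.stronglyMeasurable_mk.measurable measurable_const
  rw [volume_restrict_box] at hvi ⊢
  rw [EventuallyEq, Measure.ae_prod_iff_ae_ae hm]
  filter_upwards [ae_all_iff.2 h', hvi.prod_right_ae] with x hx hxi
  exact ae_eq_zero_of_integral_mode hxi hx

theorem sq_integral_norm_le {g : ℝ → ℂ} (hg : Integrable g (volume.restrict (Ioo (0 : ℝ) 1)))
    (hg2 : Integrable (fun y => ‖g y‖ ^ 2) (volume.restrict (Ioo (0 : ℝ) 1))) :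
    (∫ y in Ioo (0 : ℝ) 1, ‖g y‖) ^ 2 ≤ ∫ y in Ioo (0 : ℝ) 1, ‖g y‖ ^ 2 := by
  set a := ∫ y in Ioo (0 : ℝ) 1, ‖g y‖ with ha
  have h0 : 0 ≤ ∫ y in Ioo (0 : ℝ) 1, (‖g y‖ ^ 2 - 2 * a * ‖g y‖ + a ^ 2) :=
    integral_nonneg fun y => by
      have : ‖g y‖ ^ 2 - 2 * a * ‖g y‖ + a ^ 2 = (‖g y‖ - a) ^ 2 := by ring
      simp only [Pi.zero_apply, this]; positivity
  have hg1 : Integrable (fun y => 2 * a * ‖g y‖) (volume.restrict (Ioo (0 : ℝ) 1)) :=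
    hg.norm.const_mul _
  have hg3 : Integrable (fun y => ‖g y‖ ^ 2 - 2 * a * ‖g y‖)
    (volume.restrict (Ioo (0 : ℝ) 1)) := hg2.sub hg1
  rw [integral_add hg3 (integrable_const _), integral_sub hg2 hg1, integral_const_mul,
    ← ha] at h0
  simp at h0
  nlinarith

theorem memLp_coef (hu : MemLp u 2 (volume.restrict (box R))) (n : ℕ) :
    MemLp (coef n u) 2 (volume.restrict (Ioo (-R) R)) := by
  have hi := MemLp.integrable_box hu
  have hi2 := (memLp_two_iff_integrable_sq_norm hu.1).1 hu
  rw [volume_restrict_box] at hi hi2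
  have hmeas : AEStronglyMeasurable (coef n u) (volume.restrict (Ioo (-R) R)) := by
    have : AEStronglyMeasurable (fun p : ℝ × ℝ => mode n p.2 • u p)
        ((volume.restrict (Ioo (-R) R)).prod (volume.restrict (Ioo (0 : ℝ) 1))) :=
      ((continuous_mode n).comp continuous_snd).aestronglyMeasurable.smul hi.1
    exact this.integral_prod_right'
  rw [memLp_two_iff_integrable_sq_norm hmeas]
  refine (hi2.integral_prod_left.const_mul 4).mono (hmeas.norm.pow 2) ?_
  filter_upwards [hi.prod_right_ae, hi2.prod_right_ae] with x hx hx2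
  have h0 : 0 ≤ ∫ y in Ioo (0 : ℝ) 1, ‖u (x, y)‖ ^ 2 := integral_nonneg fun _ => by positivity
  rw [Real.norm_of_nonneg (by positivity), Real.norm_of_nonneg (by positivity)]
  have h1 : ‖coef n u x‖ ≤ 2 * ∫ y in Ioo (0 : ℝ) 1, ‖u (x, y)‖ := by
    rw [← integral_const_mul]
    refine norm_integral_le_of_norm_le (hx.norm.const_mul 2) (ae_of_all _ fun y => ?_)
    rw [norm_smul]
    exact mul_le_mul_of_nonneg_right (abs_mode_le n y) (norm_nonneg _)
  calc ‖coef n u x‖ ^ 2 ≤ (2 * ∫ y in Ioo (0 : ℝ) 1, ‖u (x, y)‖) ^ 2 := by gcongr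
    _ = 4 * (∫ y in Ioo (0 : ℝ) 1, ‖u (x, y)‖) ^ 2 := by ring
    _ ≤ _ := by gcongr; exact sq_integral_norm_le hx hx2

theorem integral_mul_conj_sep_mode {F : ℝ → ℂ}
    (hF : MemLp F 2 (volume.restrict (Ioo (-R) R))) (n : ℕ)
    (hu : MemLp u 2 (volume.restrict (box R))) :
    ∫ p in box R, u p * (starRingEnd ℂ) (sep F (modeC n) p)
      = ∫ x in Ioo (-R) R, coef n u x * (starRingEnd ℂ) (F x) := by
  have hi : Integrable (fun p => u p * (starRingEnd ℂ) (sep F (modeC n) p))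
      (volume.restrict (box R)) := hu.integrable_mul (memLp_sep hF (memLp_modeC n)).star
  rw [volume_restrict_box] at hi ⊢
  rw [integral_prod _ hi]
  congr 1; ext x
  rw [coef, ← integral_mul_const]
  congr 1; ext y
  simp only [sep, map_mul, conj_modeC, Complex.real_smul]
  rw [modeC]; ring

theorem inner_tens_mode {F : ℝ → ℂ} (hF : MemLp F 2 (volume.restrict (Ioo (-R) R))) (n : ℕ)
    (h : L2 (box R)) :
    inner ℂ (tens R F (modeC n)) h
      = ∫ x in Ioo (-R) R, coef n h x * (starRingEnd ℂ) (F x) := by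
  rw [inner_tens hF (memLp_modeC n), integral_mul_conj_sep_mode hF n (Lp.memLp h)]

theorem tens_congr {F F' G : ℝ → ℂ} (hF : MemLp F 2 (volume.restrict (Ioo (-R) R)))
    (hG : MemLp G 2 (volume.restrict (Ioo (0 : ℝ) 1)))
    (h : F =ᵐ[volume.restrict (Ioo (-R) R)] F') : tens R F G = tens R F' G := by
  apply Lp.ext
  refine (coeFn_tens hF hG).trans (EventuallyEq.trans ?_ (coeFn_tens (hF.ae_eq h) hG).symm)
  rw [volume_restrict_box]
  have := (Measure.quasiMeasurePreserving_fst (μ := volume.restrict (Ioo (-R) R))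
    (ν := volume.restrict (Ioo (0 : ℝ) 1))).ae_eq_comp h
  filter_upwards [this] with p hp
  simp only [Function.comp] at hp
  simp only [sep, hp]

/-- The component of a function along the mode `φₙ`. -/
noncomputable def modePart (n : ℕ) (h : L2 (box R)) : L2 (box R) := tens R (coef n h) (modeC n)

theorem inner_modePart_of_ne (h : L2 (box R)) {n m : ℕ} (hnm : n ≠ m) :
    inner ℂ (modePart n h) (modePart m h) = 0 := by
  rw [modePart, modePart, inner_tens_tens (memLp_coef (Lp.memLp h) n) (memLp_modeC n)
    (memLp_coef (Lp.memLp h) m) (memLp_modeC m)]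
  rw [show (∫ y in Ioo (0 : ℝ) 1, modeC m y * (starRingEnd ℂ) (modeC n y)) = 0 from
    integral_modeDer_mul_of_ne hnm 0, mul_zero]

theorem norm_tens_mode_sq {F : ℝ → ℂ} (hF : MemLp F 2 (volume.restrict (Ioo (-R) R))) (n : ℕ) :
    ‖tens R F (modeC n)‖ ^ 2 = normSq R F := by
  rw [norm_tens_sq hF (memLp_modeC n), integral_norm_modeC_sq, mul_one]

theorem summable_normSq_coef (h : L2 (box R)) :
    Summable (fun n => normSq R (coef n h)) ∧ ∑' n, normSq R (coef n h) ≤ ‖h‖ ^ 2 := by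
  have hc := fun n => memLp_coef (Lp.memLp h) n
  have hfin : ∀ s : Finset ℕ, ∑ n ∈ s, normSq R (coef n h) ≤ ‖h‖ ^ 2 := by
    intro s
    set T := ∑ n ∈ s, modePart n h with hT
    have h1 : (inner ℂ T h : ℂ) = ((∑ n ∈ s, normSq R (coef n h) : ℝ) : ℂ) := by
      rw [hT, sum_inner, Complex.ofReal_sum]
      refine Finset.sum_congr rfl fun n _ => ?_
      rw [modePart, inner_tens_mode (hc n), integral_mul_conj]; rfl
    have h2 : ‖T‖ ^ 2 = ∑ n ∈ s, normSq R (coef n h) := by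
      apply Complex.ofReal_injective
      have : (inner ℂ T T : ℂ) = (‖T‖ : ℂ) ^ 2 := inner_self_eq_norm_sq_to_K T
      rw [Complex.ofReal_pow, ← this, hT, sum_inner, Complex.ofReal_sum]
      refine Finset.sum_congr rfl fun n hn => ?_
      rw [inner_sum, Finset.sum_eq_single n (fun m _ hmn => inner_modePart_of_ne h hmn.symm)
        (fun hh => absurd hn hh), inner_self_eq_norm_sq_to_K, ← norm_tens_mode_sq (hc n) n]
      simp [modePart]
    have h3 : ‖T‖ ^ 2 ≤ ‖T‖ * ‖h‖ := by
      have := norm_inner_le_norm (𝕜 := ℂ) T h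
      rw [h1, Complex.norm_real, ← h2] at this
      simpa using this
    rw [← h2]
    nlinarith [norm_nonneg T, norm_nonneg h, sq_nonneg (‖T‖ - ‖h‖)]
  have hs := summable_of_sum_le (fun n => normSq_nonneg R (coef n h)) hfin
  exact ⟨hs, hs.tsum_le_of_sum_le hfin⟩

theorem hasSum_modePart (h : L2 (box R)) : HasSum (fun n => modePart n h) h := by
  have hc := fun n => memLp_coef (Lp.memLp h) n
  have hs : Summable fun n => modePart n h :=
    (summable_of_orthogonal (fun n m hnm => inner_modePart_of_ne h hnm)
      (summable_normSq_coef h).1 (fun n => (norm_tens_mode_sq (hc n) n).le)).1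
  have hd : h - ∑' n, modePart n h = 0 := by
    set d := h - ∑' n, modePart n h with hd
    have hort : ∀ n (F : ℝ → ℂ), MemLp F 2 (volume.restrict (Ioo (-R) R)) →
        inner ℂ (tens R F (modeC n)) d = 0 := by
      intro n F hF
      have h1 : inner ℂ (tens R F (modeC n)) (∑' m, modePart m h)
          = ∑' m, inner ℂ (tens R F (modeC n)) (modePart m h) :=
        (innerSL ℂ (tens R F (modeC n))).map_tsum hs
      rw [hd, inner_sub_right, h1, tsum_eq_single n]
      · rw [modePart, inner_tens_tens hF (memLp_modeC n) (hc n) (memLp_modeC n),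
          integral_mul_conj, integral_norm_modeC_sq, inner_tens_mode hF]
        simp
      · intro m hmn
        rw [modePart, inner_tens_tens hF (memLp_modeC n) (hc m) (memLp_modeC m)]
        rw [show (∫ y in Ioo (0 : ℝ) 1, modeC m y * (starRingEnd ℂ) (modeC n y)) = 0 from
          integral_modeDer_mul_of_ne hmn.symm 0, mul_zero]
    apply Lp.ext
    refine (ae_eq_zero_of_coef (MemLp.integrable_box (Lp.memLp d)) fun n => ?_).trans
      (Lp.coeFn_zero ℂ 2 _).symm
    have hcd := memLp_coef (Lp.memLp d) n
    have h1 := hort n _ hcd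
    rw [inner_tens_mode hcd, integral_mul_conj] at h1
    have h2 : ∫ x in Ioo (-R) R, ‖coef n d x‖ ^ 2 = 0 := by exact_mod_cast h1
    rw [integral_eq_zero_iff_of_nonneg (fun _ => by positivity)
      ((memLp_two_iff_integrable_sq_norm hcd.1).1 hcd)] at h2
    filter_upwards [h2] with x hx
    simpa using hx
  have := hs.hasSum
  rwa [← sub_eq_zero.1 hd] at this

end Waveguide

namespace Waveguide

/-! ### The one-dimensional Helmholtz equation -/

/-- `f ∈ L²(ℝ)` vanishes outside `(-r,r)`. -/
structure IsSource (r : ℝ) (f : ℝ → ℂ) : Prop where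
  memLp : MemLp f 2
  zero : ∀ t, t ∉ Ioo (-r) r → f t = 0

variable {r R : ℝ} {f : ℝ → ℂ} {κ : ℂ}

theorem IsSource.integrable (hf : IsSource r f) : Integrable f := by
  have h : IntegrableOn f (Ioo (-r) r) := (hf.memLp.restrict _).integrable one_le_two
  exact (integrableOn_iff_integrable_of_support_subset fun t ht => by
    by_contra hh; exact ht (hf.zero t hh)).1 h

/-- The exponential `e^{iκx}`. -/
noncomputable def expI (κ : ℂ) (x : ℝ) : ℂ := Complex.exp (Complex.I * κ * x)

theorem hasDerivAt_expI (κ : ℂ) (x : ℝ) :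
    HasDerivAt (expI κ) (Complex.I * κ * expI κ x) x := by
  have h := ((hasDerivAt_id x).ofReal_comp.const_mul (Complex.I * κ)).cexp
  convert! h using 1
  simp [expI]; ring

@[fun_prop]
theorem continuous_expI (κ : ℂ) : Continuous (expI κ) := by unfold expI; fun_prop

theorem isPrimitive_expI (κ : ℂ) : IsPrimitive (expI κ) (fun x => Complex.I * κ * expI κ x) :=
  .of_hasDerivAt (hasDerivAt_expI κ) (by fun_prop)

theorem expI_mul_expI_neg (κ : ℂ) (x : ℝ) : expI κ x * expI (-κ) x = 1 := by
  rw [expI, expI, ← Complex.exp_add]; simp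

theorem norm_expI (κ : ℂ) (x : ℝ) : ‖expI κ x‖ = Real.exp (-(κ.im * x)) := by
  rw [expI, Complex.norm_exp]
  simp

theorem IsSource.integrable_expI_mul (hf : IsSource r f) (κ : ℂ) :
    Integrable fun t => expI κ t * f t := by
  have h : IntegrableOn (fun t => expI κ t * f t) (Ioo (-r) r) := by
    obtain ⟨C, hC⟩ := (isCompact_Icc (a := -r) (b := r)).exists_bound_of_continuousOn
      (continuous_expI κ).continuousOn
    refine hf.integrable.integrableOn.bdd_mul (c := C)
      (continuous_expI κ).aestronglyMeasurable ?_
    filter_upwards [ae_restrict_mem measurableSet_Ioo] with y hy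
    exact hC y (Ioo_subset_Icc_self hy)
  exact (integrableOn_iff_integrable_of_support_subset fun t ht => by
    by_contra hh; exact ht (by simp [hf.zero t hh])).1 h

/-- The amplitude of the wave travelling to the right. -/
noncomputable def ampR (κ : ℂ) (f : ℝ → ℂ) (x : ℝ) : ℂ := ∫ t in Iic x, expI (-κ) t * f t

/-- The amplitude of the wave travelling to the left. -/
noncomputable def ampL (κ : ℂ) (f : ℝ → ℂ) (x : ℝ) : ℂ := ∫ t in Ioi x, expI κ t * f t

/-- The outgoing solution of `w'' + κ² w = -f`. -/
noncomputable def outSol (κ : ℂ) (f : ℝ → ℂ) (x : ℝ) : ℂ :=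
  Complex.I / (2 * κ) * (expI κ x * ampR κ f x + expI (-κ) x * ampL κ f x)

/-- The derivative of the outgoing solution. -/
noncomputable def outSolD (κ : ℂ) (f : ℝ → ℂ) (x : ℝ) : ℂ :=
  -(1 / 2) * (expI κ x * ampR κ f x + (-1) * (expI (-κ) x * ampL κ f x))

/-- The second derivative of the outgoing solution. -/
noncomputable def outSolDD (κ : ℂ) (f : ℝ → ℂ) (x : ℝ) : ℂ := -κ ^ 2 * outSol κ f x - f x

theorem isPrimitive_ampR (hf : IsSource r f) :
    IsPrimitive (ampR κ f) fun t => expI (-κ) t * f t :=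
  ⟨(hf.integrable_expI_mul _).locallyIntegrable, fun _ _ =>
    (intervalIntegral.integral_Iic_sub_Iic (hf.integrable_expI_mul _).integrableOn
      (hf.integrable_expI_mul _).integrableOn).symm⟩

theorem isPrimitive_ampL (hf : IsSource r f) :
    IsPrimitive (ampL κ f) fun t => -(expI κ t * f t) := by
  have hi := hf.integrable_expI_mul κ
  refine ⟨hi.neg.locallyIntegrable, fun a b => ?_⟩
  have h : ∀ x, ampL κ f x = (∫ t, expI κ t * f t) - ∫ t in Iic x, expI κ t * f t := fun x => by
    rw [← intervalIntegral.integral_Iic_add_Ioi hi.integrableOn hi.integrableOn (b := x), ampL]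
    ring
  rw [intervalIntegral.integral_neg, h, h,
    ← intervalIntegral.integral_Iic_sub_Iic hi.integrableOn hi.integrableOn]
  ring

theorem isPrimitive_outSol (hκ : κ ≠ 0) (hf : IsSource r f) :
    IsPrimitive (outSol κ f) (outSolD κ f) := by
  have h := (((isPrimitive_expI κ).mul (isPrimitive_ampR (κ := κ) hf)).add
    ((isPrimitive_expI (-κ)).mul (isPrimitive_ampL (κ := κ) hf))).const_mul (Complex.I / (2 * κ))
  refine h.congr (ae_of_all _ fun x => ?_)
  simp only [outSolD]
  have hI := Complex.I_sq
  field_simp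
  linear_combination (κ * (expI κ x * ampR κ f x - expI (-κ) x * ampL κ f x)) * hI

theorem isPrimitive_outSolD (hf : IsSource r f) :
    IsPrimitive (outSolD κ f) (outSolDD κ f) := by
  have h := (((isPrimitive_expI κ).mul (isPrimitive_ampR (κ := κ) hf)).add
    (((isPrimitive_expI (-κ)).mul (isPrimitive_ampL (κ := κ) hf)).const_mul (-1))).const_mul (-(1 / 2))
  refine h.congr (ae_of_all _ fun x => ?_)
  simp only [outSolDD, outSol]
  have he := expI_mul_expI_neg κ x
  field_simp
  linear_combination (-2 * f x) * he

theorem isProfile_outSol (hκ : κ ≠ 0) (hf : IsSource r f) :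
    IsProfile (outSol κ f) (outSolD κ f) (outSolDD κ f) :=
  ⟨isPrimitive_outSol hκ hf, isPrimitive_outSolD hf, fun R =>
    ((Continuous.memLp_Ioo (isPrimitive_outSol hκ hf).continuous (-R) R).const_mul _).sub
      (hf.memLp.restrict _)⟩

theorem outSolD_of_le (hκ : κ ≠ 0) (hf : IsSource r f) {x : ℝ} (hx : r ≤ x) :
    outSolD κ f x = Complex.I * κ * outSol κ f x := by
  have h0 : ampL κ f x = 0 := by
    rw [ampL, setIntegral_eq_zero_of_forall_eq_zero]
    intro t ht
    rw [hf.zero t fun h => (lt_irrefl _ ((h.2.trans_le hx).trans ht)), mul_zero]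
  rw [outSolD, outSol, h0]
  field_simp
  rw [Complex.I_sq]; ring

theorem outSolD_of_le_neg (hκ : κ ≠ 0) (hf : IsSource r f) {x : ℝ} (hx : x ≤ -r) :
    outSolD κ f x = -(Complex.I * κ * outSol κ f x) := by
  have h0 : ampR κ f x = 0 := by
    rw [ampR, setIntegral_eq_zero_of_forall_eq_zero]
    intro t ht
    rw [hf.zero t fun h => (lt_irrefl _ ((h.1.trans_le ht).trans_le hx)), mul_zero]
  rw [outSolD, outSol, h0]
  field_simp
  rw [Complex.I_sq]; ring

/-! ### Estimates -/

/-- The convolution of `‖f‖` with `e^{-β|·|}`. -/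
noncomputable def decayConv (β r : ℝ) (f : ℝ → ℂ) (x : ℝ) : ℝ :=
  ∫ t in Ioo (-r) r, Real.exp (-(β * |x - t|)) * ‖f t‖

theorem integrable_decay_mul {β : ℝ} (hβ : 0 ≤ β) {g : ℝ → ℝ} {μ : Measure ℝ}
    (hg : Integrable g μ) (x : ℝ) :
    Integrable (fun t => Real.exp (-(β * |x - t|)) * g t) μ := by
  have hc : Continuous fun t => Real.exp (-(β * |x - t|)) := by fun_prop
  refine hg.bdd_mul (c := 1) hc.aestronglyMeasurable (ae_of_all _ fun t => ?_)
  rw [Real.norm_of_nonneg (Real.exp_pos _).le]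
  exact Real.exp_le_one_iff.2 (by have := mul_nonneg hβ (abs_nonneg (x - t)); linarith)

theorem norm_amp_le (hκ : 0 ≤ κ.im) (hf : IsSource r f) (x : ℝ) :
    ‖expI κ x * ampR κ f x‖ + ‖expI (-κ) x * ampL κ f x‖ ≤ decayConv κ.im r f x := by
  have hi := integrable_decay_mul hκ hf.integrable.norm x
  have h1 : ‖expI κ x * ampR κ f x‖ ≤ ∫ t in Iic x, Real.exp (-(κ.im * |x - t|)) * ‖f t‖ := by
    rw [ampR, ← integral_const_mul]
    refine norm_integral_le_of_norm_le hi.integrableOn ?_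
    filter_upwards [ae_restrict_mem measurableSet_Iic] with t ht
    rw [norm_mul, norm_mul, ← mul_assoc, norm_expI, norm_expI, ← Real.exp_add,
      abs_of_nonneg (sub_nonneg.2 ht)]
    refine le_of_eq ?_
    congr 2
    simp; ring
  have h2 : ‖expI (-κ) x * ampL κ f x‖ ≤ ∫ t in Ioi x, Real.exp (-(κ.im * |x - t|)) * ‖f t‖ := by
    rw [ampL, ← integral_const_mul]
    refine norm_integral_le_of_norm_le hi.integrableOn ?_
    filter_upwards [ae_restrict_mem measurableSet_Ioi] with t ht
    rw [norm_mul, norm_mul, ← mul_assoc, norm_expI, norm_expI, ← Real.exp_add,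
      abs_of_nonpos (sub_nonpos.2 (le_of_lt ht))]
    refine le_of_eq ?_
    congr 2
    simp; ring
  calc _ ≤ _ := add_le_add h1 h2
    _ = ∫ t, Real.exp (-(κ.im * |x - t|)) * ‖f t‖ :=
      intervalIntegral.integral_Iic_add_Ioi hi.integrableOn hi.integrableOn
    _ = decayConv κ.im r f x := by
      rw [decayConv, setIntegral_eq_integral_of_forall_compl_eq_zero]
      intro t ht; rw [hf.zero t ht, norm_zero, mul_zero]

theorem norm_outSol_le (hκ : 0 ≤ κ.im) (hf : IsSource r f) (x : ℝ) :
    ‖outSol κ f x‖ ≤ (2 * ‖κ‖)⁻¹ * decayConv κ.im r f x := by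
  rw [outSol, norm_mul, norm_div, Complex.norm_I, norm_mul, Complex.norm_ofNat, one_div]
  gcongr
  exact (norm_add_le _ _).trans (norm_amp_le hκ hf x)

theorem norm_outSolD_le (hκ : 0 ≤ κ.im) (hf : IsSource r f) (x : ℝ) :
    ‖outSolD κ f x‖ ≤ 2⁻¹ * decayConv κ.im r f x := by
  rw [outSolD, norm_mul, norm_neg, norm_div, norm_one, Complex.norm_ofNat, one_div]
  gcongr
  refine (norm_add_le _ _).trans (le_trans (le_of_eq ?_) (norm_amp_le hκ hf x))
  simp

theorem decayConv_nonneg (β r : ℝ) (f : ℝ → ℂ) (x : ℝ) : 0 ≤ decayConv β r f x :=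
  integral_nonneg fun _ => by positivity

theorem IsSource.integrable_sq (hf : IsSource r f) : Integrable fun t => ‖f t‖ ^ 2 :=
  (memLp_two_iff_integrable_sq_norm hf.memLp.1).1 hf.memLp

theorem sq_decayConv_le {β D : ℝ} (hβ : 0 ≤ β) (hD : 0 < D) (hf : IsSource r f) (x : ℝ)
    (hx : ∫ t in Ioo (-r) r, Real.exp (-(β * |x - t|)) ≤ D) :
    decayConv β r f x ^ 2 ≤ D * ∫ t in Ioo (-r) r, Real.exp (-(β * |x - t|)) * ‖f t‖ ^ 2 := by
  set e : ℝ → ℝ := fun t => Real.exp (-(β * |x - t|)) with he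
  set m := decayConv β r f x with hm
  set a := m / D with ha
  have i1 := integrable_decay_mul hβ (hf.integrable.norm.integrableOn (s := Ioo (-r) r)) x
  have i2 := integrable_decay_mul hβ (hf.integrable_sq.integrableOn (s := Ioo (-r) r)) x
  have i0 : Integrable e (volume.restrict (Ioo (-r) r)) := by
    simpa using integrable_decay_mul hβ (integrable_const (μ := volume.restrict (Ioo (-r) r))
      (1 : ℝ)) x
  have h0 : 0 ≤ ∫ t in Ioo (-r) r, ((e t * ‖f t‖ ^ 2 - 2 * a * (e t * ‖f t‖)) + a ^ 2 * e t) :=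
    integral_nonneg fun t => by
      have : (e t * ‖f t‖ ^ 2 - 2 * a * (e t * ‖f t‖)) + a ^ 2 * e t
          = e t * (‖f t‖ - a) ^ 2 := by ring
      simp only [Pi.zero_apply, this]
      have := (Real.exp_pos (-(β * |x - t|))).le
      positivity
  have i1' : Integrable (fun t => 2 * a * (e t * ‖f t‖)) (volume.restrict (Ioo (-r) r)) :=
    i1.const_mul _
  have i0' : Integrable (fun t => a ^ 2 * e t) (volume.restrict (Ioo (-r) r)) := i0.const_mul _
  have i3 : Integrable (fun t => e t * ‖f t‖ ^ 2 - 2 * a * (e t * ‖f t‖))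
    (volume.restrict (Ioo (-r) r)) := i2.sub i1'
  rw [integral_add i3 i0', integral_sub i2 i1', integral_const_mul, integral_const_mul] at h0
  have hm' : ∫ t in Ioo (-r) r, e t * ‖f t‖ = m := rfl
  rw [hm'] at h0
  have h1 : a ^ 2 * ∫ t in Ioo (-r) r, e t ≤ a ^ 2 * D := by gcongr
  have h2 : a * D = m := by rw [ha]; field_simp
  have h3 : a ^ 2 * D = a * m := by rw [← h2]; ring
  have h4 : a * m ≤ ∫ t in Ioo (-r) r, e t * ‖f t‖ ^ 2 := by linarith
  calc m ^ 2 = D * (a * m) := by rw [← h2]; ring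
    _ ≤ _ := by gcongr

theorem continuous_decayConv (β : ℝ) (hβ : 0 ≤ β) (hf : IsSource r f) :
    Continuous (decayConv β r f) := by
  refine continuous_of_dominated (bound := fun t => ‖f t‖) (fun x => ?_) (fun x => ?_)
    hf.integrable.norm.integrableOn (ae_of_all _ fun t => by fun_prop)
  · exact (integrable_decay_mul hβ (hf.integrable.norm.integrableOn (s := Ioo (-r) r)) x).1
  · refine ae_of_all _ fun t => ?_
    rw [Real.norm_of_nonneg (by positivity)]
    refine mul_le_of_le_one_left (norm_nonneg _) (Real.exp_le_one_iff.2 ?_)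
    have := mul_nonneg hβ (abs_nonneg (x - t)); linarith

theorem integral_sq_decayConv_le {β D D' : ℝ} (hβ : 0 ≤ β) (hD : 0 < D) (hf : IsSource r f)
    (h : ∀ x, ∫ t in Ioo (-r) r, Real.exp (-(β * |x - t|)) ≤ D)
    (h' : ∀ x, ∫ t in Ioo (-R) R, Real.exp (-(β * |x - t|)) ≤ D') :
    ∫ x in Ioo (-R) R, decayConv β r f x ^ 2 ≤ D * D' * normSq r f := by
  have hprod : Integrable (Function.uncurry fun x t : ℝ => Real.exp (-(β * |x - t|)) * ‖f t‖ ^ 2)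
      ((volume.restrict (Ioo (-R) R)).prod (volume.restrict (Ioo (-r) r))) := by
    have h1 : Integrable (fun p : ℝ × ℝ => ‖f p.2‖ ^ 2)
        ((volume.restrict (Ioo (-R) R)).prod (volume.restrict (Ioo (-r) r))) :=
      (hf.integrable_sq.integrableOn (s := Ioo (-r) r)).comp_snd _
    have hc : Continuous fun p : ℝ × ℝ => Real.exp (-(β * |p.1 - p.2|)) := by fun_prop
    refine h1.bdd_mul (c := 1) hc.aestronglyMeasurable (ae_of_all _ fun p => ?_)
    rw [Real.norm_of_nonneg (Real.exp_pos _).le]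
    exact Real.exp_le_one_iff.2 (by have := mul_nonneg hβ (abs_nonneg (p.1 - p.2)); linarith)
  have hint : Integrable (fun x => decayConv β r f x ^ 2) (volume.restrict (Ioo (-R) R)) :=
    (((continuous_decayConv β hβ hf).pow 2).integrableOn_Icc).mono_set Ioo_subset_Icc_self
  calc ∫ x in Ioo (-R) R, decayConv β r f x ^ 2
      ≤ ∫ x in Ioo (-R) R, D * ∫ t in Ioo (-r) r, Real.exp (-(β * |x - t|)) * ‖f t‖ ^ 2 :=
        integral_mono hint (hprod.integral_prod_left.const_mul _)
          fun x => sq_decayConv_le hβ hD hf x (h x)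
    _ = D * ∫ t in Ioo (-r) r, (∫ x in Ioo (-R) R, Real.exp (-(β * |x - t|))) * ‖f t‖ ^ 2 := by
        rw [integral_const_mul, integral_integral_swap hprod]
        simp only [integral_mul_const]
    _ ≤ D * ∫ t in Ioo (-r) r, D' * ‖f t‖ ^ 2 := by
        refine mul_le_mul_of_nonneg_left ?_ hD.le
        refine integral_mono_of_nonneg (ae_of_all _ fun t => ?_)
          (hf.integrable_sq.integrableOn.const_mul _) (ae_of_all _ fun t => ?_)
        · exact mul_nonneg (integral_nonneg fun _ => (Real.exp_pos _).le) (by positivity)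
        · refine mul_le_mul_of_nonneg_right ?_ (by positivity)
          simpa only [abs_sub_comm] using h' t
    _ = D * D' * normSq r f := by rw [integral_const_mul, normSq]; ring

theorem normSq_outSol_le {D D' : ℝ} (hκ : 0 ≤ κ.im) (hD : 0 < D) (hf : IsSource r f)
    (h : ∀ x, ∫ t in Ioo (-r) r, Real.exp (-(κ.im * |x - t|)) ≤ D)
    (h' : ∀ x, ∫ t in Ioo (-R) R, Real.exp (-(κ.im * |x - t|)) ≤ D') :
    normSq R (outSol κ f) ≤ ((2 * ‖κ‖)⁻¹) ^ 2 * (D * D' * normSq r f) := by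
  have hint : Integrable (fun x => decayConv κ.im r f x ^ 2) (volume.restrict (Ioo (-R) R)) :=
    (((continuous_decayConv _ hκ hf).pow 2).integrableOn_Icc).mono_set Ioo_subset_Icc_self
  refine le_trans ?_ (mul_le_mul_of_nonneg_left (integral_sq_decayConv_le hκ hD hf h h')
    (by positivity))
  rw [← integral_const_mul]
  refine integral_mono_of_nonneg (ae_of_all _ fun t => by positivity) (hint.const_mul _)
    (ae_of_all _ fun t => ?_)
  simp only [← mul_pow]
  gcongr
  exact norm_outSol_le hκ hf t

theorem normSq_outSolD_le {D D' : ℝ} (hκ : 0 ≤ κ.im) (hD : 0 < D) (hf : IsSource r f)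
    (h : ∀ x, ∫ t in Ioo (-r) r, Real.exp (-(κ.im * |x - t|)) ≤ D)
    (h' : ∀ x, ∫ t in Ioo (-R) R, Real.exp (-(κ.im * |x - t|)) ≤ D') :
    normSq R (outSolD κ f) ≤ (2⁻¹) ^ 2 * (D * D' * normSq r f) := by
  have hint : Integrable (fun x => decayConv κ.im r f x ^ 2) (volume.restrict (Ioo (-R) R)) :=
    (((continuous_decayConv _ hκ hf).pow 2).integrableOn_Icc).mono_set Ioo_subset_Icc_self
  refine le_trans ?_ (mul_le_mul_of_nonneg_left (integral_sq_decayConv_le hκ hD hf h h')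
    (by positivity))
  rw [← integral_const_mul]
  refine integral_mono_of_nonneg (ae_of_all _ fun t => by positivity) (hint.const_mul _)
    (ae_of_all _ fun t => ?_)
  simp only [← mul_pow]
  gcongr
  exact norm_outSolD_le hκ hf t

theorem normSq_sub_le {F G : ℝ → ℂ} (hF : MemLp F 2 (volume.restrict (Ioo (-R) R)))
    (hG : MemLp G 2 (volume.restrict (Ioo (-R) R))) :
    normSq R (fun x => F x - G x) ≤ 2 * normSq R F + 2 * normSq R G := by
  have i1 := (memLp_two_iff_integrable_sq_norm hF.1).1 hF
  have i2 := (memLp_two_iff_integrable_sq_norm hG.1).1 hG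
  simp only [normSq]
  rw [← integral_const_mul, ← integral_const_mul,
    ← integral_add (i1.const_mul 2) (i2.const_mul 2)]
  refine integral_mono_of_nonneg (ae_of_all _ fun t => by positivity)
    ((i1.const_mul 2).add (i2.const_mul 2)) (ae_of_all _ fun x => ?_)
  simp only
  have := norm_sub_le (F x) (G x)
  nlinarith [sq_nonneg (‖F x‖ - ‖G x‖), norm_nonneg (F x - G x), norm_nonneg (F x),
    norm_nonneg (G x)]

theorem normSq_const_mul (c : ℂ) (F : ℝ → ℂ) :
    normSq R (fun x => c * F x) = ‖c‖ ^ 2 * normSq R F := by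
  simp only [normSq, norm_mul, mul_pow, integral_const_mul]

theorem IsSource.normSq_le (hf : IsSource r f) (R : ℝ) : normSq R f ≤ normSq r f := by
  have e : normSq r f = ∫ x, ‖f x‖ ^ 2 := by
    rw [normSq, setIntegral_eq_integral_of_forall_compl_eq_zero]
    intro t ht; rw [hf.zero t ht, norm_zero, zero_pow two_ne_zero]
  rw [e]
  exact setIntegral_le_integral hf.integrable_sq (ae_of_all _ fun t => by positivity)

theorem normSq_outSolDD_le {D D' : ℝ} (hκ0 : κ ≠ 0) (hκ : 0 ≤ κ.im) (hD : 0 < D)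
    (hf : IsSource r f)
    (h : ∀ x, ∫ t in Ioo (-r) r, Real.exp (-(κ.im * |x - t|)) ≤ D)
    (h' : ∀ x, ∫ t in Ioo (-R) R, Real.exp (-(κ.im * |x - t|)) ≤ D') :
    normSq R (outSolDD κ f)
      ≤ 2 * (‖κ‖ ^ 2 * ((2⁻¹) ^ 2 * (D * D' * normSq r f))) + 2 * normSq r f := by
  have h1 := normSq_sub_le (R := R)
    ((Continuous.memLp_Ioo (isPrimitive_outSol hκ0 hf).continuous (-R) R).const_mul (-κ ^ 2))
    (hf.memLp.restrict (Ioo (-R) R))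
  rw [normSq_const_mul] at h1
  have h2 := normSq_outSol_le hκ hD hf h h'
  have hn : ‖κ‖ ≠ 0 := norm_ne_zero_iff.2 hκ0
  have h3 : ‖-κ ^ 2‖ ^ 2 * normSq R (outSol κ f)
      ≤ ‖κ‖ ^ 2 * ((2⁻¹) ^ 2 * (D * D' * normSq r f)) := by
    calc ‖-κ ^ 2‖ ^ 2 * normSq R (outSol κ f)
        ≤ ‖-κ ^ 2‖ ^ 2 * (((2 * ‖κ‖)⁻¹) ^ 2 * (D * D' * normSq r f)) := by gcongr
      _ = _ := by rw [norm_neg, norm_pow]; field_simp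
  have h4 := hf.normSq_le R
  have h5 : normSq R (outSolDD κ f) = normSq R fun x => -κ ^ 2 * outSol κ f x - f x := rfl
  rw [h5]
  linarith

theorem decayConv_le {β : ℝ} (hβ : 0 ≤ β) (hr : 0 < r) (hf : IsSource r f) (x : ℝ) :
    decayConv β r f x ^ 2 ≤ 2 * r * normSq r f := by
  have h1 : ∀ t, Real.exp (-(β * |x - t|)) ≤ 1 := fun t =>
    Real.exp_le_one_iff.2 (by have := mul_nonneg hβ (abs_nonneg (x - t)); linarith)
  have hD : ∫ t in Ioo (-r) r, Real.exp (-(β * |x - t|)) ≤ 2 * r := by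
    have := integral_mono_of_nonneg (μ := volume.restrict (Ioo (-r) r))
      (ae_of_all _ fun t => (Real.exp_pos (-(β * |x - t|))).le) (integrable_const (1 : ℝ))
      (ae_of_all _ h1)
    simp at this
    rcases this with h | h <;> linarith
  refine (sq_decayConv_le hβ (by linarith) hf x hD).trans ?_
  refine mul_le_mul_of_nonneg_left ?_ (by linarith)
  refine integral_mono_of_nonneg (ae_of_all _ fun t => by positivity)
    hf.integrable_sq.integrableOn (ae_of_all _ fun t => ?_)
  exact mul_le_of_le_one_left (by positivity) (h1 t)

end Waveguide

namespace Waveguide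

/-! ### The modal wavenumbers -/

variable {r R : ℝ}

theorem waveNumber_of_le {k : ℝ} {n : ℕ} (h : freq n ≤ k) :
    waveNumber k n = (Real.sqrt (k ^ 2 - freq n ^ 2) : ℂ) := if_pos h

theorem waveNumber_of_lt {k : ℝ} {n : ℕ} (h : k < freq n) :
    waveNumber k n = Complex.I * (Real.sqrt (freq n ^ 2 - k ^ 2) : ℂ) := if_neg h.not_ge

theorem waveNumber_sq {k : ℝ} (hk : 0 < k) (n : ℕ) :
    waveNumber k n ^ 2 = (k : ℂ) ^ 2 - (freq n : ℂ) ^ 2 := by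
  have h0 := freq_nonneg n
  rcases le_or_gt (freq n) k with h | h
  · rw [waveNumber_of_le h, ← Complex.ofReal_pow, Real.sq_sqrt (by nlinarith)]
    simp
  · rw [waveNumber_of_lt h, mul_pow, Complex.I_sq, ← Complex.ofReal_pow,
      Real.sq_sqrt (by nlinarith)]
    simp

theorem waveNumber_im_nonneg (k : ℝ) (n : ℕ) : 0 ≤ (waveNumber k n).im := by
  rcases le_or_gt (freq n) k with h | h
  · rw [waveNumber_of_le h, Complex.ofReal_im]
  · rw [waveNumber_of_lt h, Complex.I_mul_im, Complex.ofReal_re]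
    exact Real.sqrt_nonneg _

theorem norm_waveNumber_sq {k : ℝ} (hk : 0 < k) (n : ℕ) :
    ‖waveNumber k n‖ ^ 2 = |k ^ 2 - freq n ^ 2| := by
  rw [← norm_pow, waveNumber_sq hk, ← Real.norm_eq_abs, ← Complex.norm_real]
  simp

theorem Frequency.sq_ne (k : Frequency) (n : ℕ) : (k : ℝ) ^ 2 - freq n ^ 2 ≠ 0 := by
  intro h
  exact k.2.2 n ((pow_left_inj₀ k.2.1.le (freq_nonneg n) two_ne_zero).1 (sub_eq_zero.1 h))

theorem waveNumber_ne_zero (k : Frequency) (n : ℕ) : waveNumber k n ≠ 0 := by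
  rw [← norm_ne_zero_iff]
  intro h
  have := norm_waveNumber_sq k.2.1 n
  rw [h] at this
  exact k.sq_ne n (by simpa using this.symm)

theorem integral_decay_le_two_mul {β a : ℝ} (hβ : 0 ≤ β) (ha : 0 < a) (x : ℝ) :
    ∫ t in Ioo (-a) a, Real.exp (-(β * |x - t|)) ≤ 2 * a := by
  have h1 : ∀ t, Real.exp (-(β * |x - t|)) ≤ 1 := fun t =>
    Real.exp_le_one_iff.2 (by have := mul_nonneg hβ (abs_nonneg (x - t)); linarith)
  have := integral_mono_of_nonneg (μ := volume.restrict (Ioo (-a) a))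
    (ae_of_all _ fun t => (Real.exp_pos (-(β * |x - t|))).le) (integrable_const (1 : ℝ))
    (ae_of_all _ h1)
  simp at this
  rcases this with h | h <;> linarith

theorem integral_decay_le_two_div {β : ℝ} (hβ : 0 < β) (a x : ℝ) :
    ∫ t in Ioo (-a) a, Real.exp (-(β * |x - t|)) ≤ 2 / β := by
  have e1 : ∀ t ∈ Iic x, Real.exp (-(β * |x - t|)) = Real.exp (-(β * x)) * Real.exp (β * t) := by
    intro t ht
    rw [← Real.exp_add, abs_of_nonneg (sub_nonneg.2 ht)]; congr 1; ring
  have e2 : ∀ t ∈ Ioi x, Real.exp (-(β * |x - t|)) = Real.exp (β * x) * Real.exp (-β * t) := by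
    intro t ht
    rw [← Real.exp_add, abs_of_nonpos (sub_nonpos.2 (le_of_lt ht))]; congr 1; ring
  have i1 : IntegrableOn (fun t => Real.exp (-(β * |x - t|))) (Iic x) :=
    IntegrableOn.congr_fun ((integrableOn_exp_mul_Iic hβ x).const_mul _)
      (fun t ht => (e1 t ht).symm) measurableSet_Iic
  have i2 : IntegrableOn (fun t => Real.exp (-(β * |x - t|))) (Ioi x) :=
    IntegrableOn.congr_fun ((integrableOn_exp_mul_Ioi (neg_lt_zero.2 hβ) x).const_mul _)
      (fun t ht => (e2 t ht).symm) measurableSet_Ioi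
  have hi : Integrable fun t => Real.exp (-(β * |x - t|)) := by
    rw [← integrableOn_univ, ← Iic_union_Ioi (a := x)]
    exact i1.union i2
  refine (setIntegral_le_integral hi (ae_of_all _ fun t => (Real.exp_pos _).le)).trans
    (le_of_eq ?_)
  rw [← intervalIntegral.integral_Iic_add_Ioi i1 i2, setIntegral_congr_fun measurableSet_Iic e1,
    setIntegral_congr_fun measurableSet_Ioi e2, integral_const_mul, integral_const_mul,
    integral_exp_mul_Iic hβ, integral_exp_mul_Ioi (neg_lt_zero.2 hβ), neg_div_neg_eq,
    ← mul_div_assoc, ← mul_div_assoc, ← Real.exp_add, ← Real.exp_add]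
  simp
  ring

theorem integral_decay_waveNumber_le (k : Frequency) (n : ℕ) {a : ℝ} (ha : 0 < a) (x : ℝ) :
    ∫ t in Ioo (-a) a, Real.exp (-((waveNumber k n).im * |x - t|))
      ≤ (2 * a * k + 2) / ‖waveNumber k n‖ := by
  have hk := k.2.1
  have hn : 0 < ‖waveNumber k n‖ := norm_pos_iff.2 (waveNumber_ne_zero k n)
  have h0 := freq_nonneg n
  rcases le_or_gt (freq n) (k : ℝ) with h | h
  · refine (integral_decay_le_two_mul (waveNumber_im_nonneg k n) ha x).trans ?_
    rw [le_div_iff₀ hn]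
    have : ‖waveNumber k n‖ ≤ k := by
      refine le_of_sq_le_sq ?_ hk.le
      rw [norm_waveNumber_sq hk, abs_of_nonneg (by nlinarith)]
      nlinarith
    nlinarith [mul_le_mul_of_nonneg_left this (by linarith : 0 ≤ 2 * a)]
  · have him : (waveNumber k n).im = ‖waveNumber k n‖ := by
      rw [waveNumber_of_lt h, Complex.I_mul_im, Complex.ofReal_re, norm_mul, Complex.norm_I,
        one_mul, Complex.norm_real, Real.norm_of_nonneg (Real.sqrt_nonneg _)]
    rw [him]
    refine (integral_decay_le_two_div hn a x).trans ?_
    gcongr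
    nlinarith [mul_pos ha hk]

theorem exists_freq_le (k : Frequency) :
    ∃ C : ℝ, 0 < C ∧ ∀ n, 1 + freq n ^ 2 ≤ C * ‖waveNumber k n‖ ^ 2 := by
  have hk := k.2.1
  obtain ⟨N, hN⟩ := exists_nat_ge (2 * (k : ℝ) ^ 2 + 1)
  have hpos : ∀ n, 0 < ‖waveNumber k n‖ ^ 2 := fun n => by
    have := norm_pos_iff.2 (waveNumber_ne_zero k n); positivity
  refine ⟨2 + ∑ n ∈ Finset.range (N + 1), (1 + freq n ^ 2) / ‖waveNumber k n‖ ^ 2,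
    ?_, fun n => ?_⟩
  · have := Finset.sum_nonneg fun n (_ : n ∈ Finset.range (N + 1)) =>
      (div_nonneg (by positivity) (hpos n).le : 0 ≤ (1 + freq n ^ 2) / ‖waveNumber k n‖ ^ 2)
    linarith
  · by_cases hn : n < N + 1
    · have h1 : (1 + freq n ^ 2) / ‖waveNumber k n‖ ^ 2 ≤
          ∑ n ∈ Finset.range (N + 1), (1 + freq n ^ 2) / ‖waveNumber k n‖ ^ 2 :=
        Finset.single_le_sum (f := fun n => (1 + freq n ^ 2) / ‖waveNumber k n‖ ^ 2)
          (fun n _ => div_nonneg (by positivity) (hpos n).le) (Finset.mem_range.2 hn)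
      rw [div_le_iff₀ (hpos n)] at h1
      refine h1.trans (mul_le_mul_of_nonneg_right (by linarith) (hpos n).le)
    · have hnN : (N : ℝ) + 1 ≤ n := by exact_mod_cast not_lt.1 hn
      have h2 : (n : ℝ) ≤ freq n := by
        unfold freq
        nlinarith [Real.pi_gt_three, (Nat.cast_nonneg n : (0 : ℝ) ≤ n)]
      have h3 : 2 * (k : ℝ) ^ 2 + 1 ≤ freq n ^ 2 := by
        have : (1 : ℝ) ≤ freq n := by
          have := (Nat.cast_nonneg N : (0 : ℝ) ≤ N); linarith
        nlinarith
      have h4 : 1 + freq n ^ 2 ≤ 2 * ‖waveNumber k n‖ ^ 2 := by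
        rw [norm_waveNumber_sq hk, abs_of_nonpos (by nlinarith)]
        linarith
      refine h4.trans (mul_le_mul_of_nonneg_right ?_ (hpos n).le)
      have := Finset.sum_nonneg fun n (_ : n ∈ Finset.range (N + 1)) =>
        (div_nonneg (by positivity) (hpos n).le : 0 ≤ (1 + freq n ^ 2) / ‖waveNumber k n‖ ^ 2)
      linarith

theorem summable_inv_norm_waveNumber_sq (k : Frequency) :
    Summable fun n => (‖waveNumber k n‖ ^ 2)⁻¹ := by
  obtain ⟨C, hC, h⟩ := exists_freq_le k
  have hs : Summable fun n : ℕ => 2 * C * (1 / ((n : ℝ) + 1) ^ 2) := by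
    have := (summable_nat_add_iff 1).2 (Real.summable_one_div_nat_pow.2 (one_lt_two))
    simpa using this.mul_left (2 * C)
  refine Summable.of_nonneg_of_le (fun n => by positivity) (fun n => ?_) hs
  have hpos : 0 < ‖waveNumber k n‖ ^ 2 := by
    have := norm_pos_iff.2 (waveNumber_ne_zero k n); positivity
  have h2 : (n : ℝ) ≤ freq n := by
    unfold freq
    nlinarith [Real.pi_gt_three, (Nat.cast_nonneg n : (0 : ℝ) ≤ n)]
  have h3 := h n
  have h4 : ((n : ℝ) + 1) ^ 2 ≤ 2 * (C * ‖waveNumber k n‖ ^ 2) := by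
    nlinarith [sq_nonneg ((n : ℝ) - 1), (Nat.cast_nonneg n : (0 : ℝ) ≤ n)]
  rw [mul_one_div, inv_eq_one_div, div_le_div_iff₀ hpos (by positivity)]
  linarith

/-! ### The modal solution -/

theorem memLp_extendByZero (s : L2 (box r)) : MemLp (extendByZero s) 2 volume :=
  (memLp_indicator_iff_restrict (isOpen_box r).measurableSet).2 (Lp.memLp s)

/-- The modal coefficients of a source. -/
noncomputable def src (s : L2 (box r)) (n : ℕ) : ℝ → ℂ := coef n (extendByZero s)

theorem src_eq_zero (s : L2 (box r)) (n : ℕ) {t : ℝ} (ht : t ∉ Ioo (-r) r) : src s n t = 0 := by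
  unfold src coef extendByZero
  have : ∀ y, (box r).indicator s (t, y) = 0 := fun y =>
    indicator_of_notMem (fun h => ht h.1) _
  simp [this]

theorem src_eq_coef (s : L2 (box r)) (n : ℕ) {t : ℝ} (ht : t ∈ Ioo (-r) r) :
    src s n t = coef n s t := by
  unfold src coef extendByZero
  refine setIntegral_congr_fun measurableSet_Ioo fun y hy => ?_
  rw [indicator_of_mem (show (t, y) ∈ box r from ⟨ht, hy⟩)]

theorem isSource_src (s : L2 (box r)) (n : ℕ) : IsSource r (src s n) := by
  refine ⟨?_, fun t ht => src_eq_zero s n ht⟩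
  have h : MemLp (src s n) 2 (volume.restrict (Ioo (-r) r)) :=
    memLp_coef ((memLp_extendByZero s).restrict _) n
  have e : (Ioo (-r) r).indicator (src s n) = src s n :=
    indicator_eq_self.2 fun t ht => by by_contra hh; exact ht (src_eq_zero s n hh)
  rw [← e]
  exact (memLp_indicator_iff_restrict measurableSet_Ioo).2 h

theorem summable_normSq_src (s : L2 (box r)) :
    Summable (fun n => normSq r (src s n)) ∧ ∑' n, normSq r (src s n) ≤ ‖s‖ ^ 2 := by
  have e : ∀ n, normSq r (src s n) = normSq r (coef n s) := fun n =>
    setIntegral_congr_fun measurableSet_Ioo fun t ht => by simp only [src_eq_coef s n ht]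
  simp only [e]
  exact summable_normSq_coef s

/-- The coefficients of the outgoing solution. -/
noncomputable def sol (k : Frequency) (s : L2 (box r)) (n : ℕ) : ℝ → ℂ :=
  outSol (waveNumber k n) (src s n)

theorem isProfile_sol (k : Frequency) (s : L2 (box r)) (n : ℕ) :
    IsProfile (sol k s n) (outSolD (waveNumber k n) (src s n))
      (outSolDD (waveNumber k n) (src s n)) :=
  isProfile_outSol (waveNumber_ne_zero k n) (isSource_src s n)

/-- The jets of the modes of the outgoing solution. -/
noncomputable def solJet (hR : 0 < R) (k : Frequency) (s : L2 (box r)) (n : ℕ) : H2 (box R) :=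
  jet hR (isProfile_sol k s n) n

theorem exists_norm_solJet_sq_le (hr : 0 < r) (hR : 0 < R) (k : Frequency) :
    ∃ C : ℝ, 0 < C ∧ ∀ (s : L2 (box r)) (n : ℕ),
      ‖solJet hR k s n‖ ^ 2 ≤ C * normSq r (src s n) := by
  obtain ⟨C, hC, hCf⟩ := exists_freq_le k
  have hk := k.2.1
  set K := (2 * r * k + 2) * (2 * R * k + 2) with hK
  have hKpos : 0 < K := by positivity
  refine ⟨C ^ 2 * K / 4 + C * K / 2 + K / 2 + 2, by positivity, fun s n => ?_⟩
  have hf := isSource_src s n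
  have hi := waveNumber_im_nonneg k n
  have h1 := integral_decay_waveNumber_le k n hr
  have h2 := integral_decay_waveNumber_le k n hR
  have hn : 0 < ‖waveNumber k n‖ := norm_pos_iff.2 (waveNumber_ne_zero k n)
  have hD : 0 < (2 * r * k + 2) / ‖waveNumber k n‖ := by positivity
  have b0 := normSq_outSol_le hi hD hf h1 h2
  have b1 := normSq_outSolD_le hi hD hf h1 h2
  have b2 := normSq_outSolDD_le (waveNumber_ne_zero k n) hi hD hf h1 h2
  have hcf := hCf n
  set m := ‖waveNumber k n‖ with hm
  set N := normSq r (src s n) with hN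
  have hN0 : 0 ≤ N := normSq_nonneg _ _
  have hDD : (2 * r * k + 2) / m * ((2 * R * k + 2) / m) * N = K / m ^ 2 * N := by
    rw [hK]; field_simp
  rw [hDD] at b0 b1 b2
  rw [solJet, norm_jet_sq]
  have c0 : (1 + freq n ^ 2 + freq n ^ 4) * normSq R (sol k s n) ≤ C ^ 2 * K / 4 * N := by
    have : 1 + freq n ^ 2 + freq n ^ 4 ≤ (C * m ^ 2) ^ 2 := by
      have h5 : (1 + freq n ^ 2) ^ 2 ≤ (C * m ^ 2) ^ 2 := by gcongr
      nlinarith [sq_nonneg (freq n)]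
    calc _ ≤ (C * m ^ 2) ^ 2 * (((2 * m)⁻¹) ^ 2 * (K / m ^ 2 * N)) := by
          refine mul_le_mul this b0 (normSq_nonneg _ _) (by positivity)
      _ = _ := by field_simp; ring
  have c1 : (1 + 2 * freq n ^ 2) * normSq R (outSolD (waveNumber k n) (src s n))
      ≤ C * K / 2 * N := by
    have : 1 + 2 * freq n ^ 2 ≤ 2 * (C * m ^ 2) := by linarith
    calc _ ≤ 2 * (C * m ^ 2) * ((2⁻¹) ^ 2 * (K / m ^ 2 * N)) := by
          refine mul_le_mul this b1 (normSq_nonneg _ _) (by positivity)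
      _ = _ := by field_simp
  have c2 : 2 * (m ^ 2 * ((2⁻¹) ^ 2 * (K / m ^ 2 * N))) + 2 * N = (K / 2 + 2) * N := by
    field_simp
  rw [c2] at b2
  calc _ ≤ C ^ 2 * K / 4 * N + C * K / 2 * N + (K / 2 + 2) * N := by gcongr
    _ = _ := by ring

theorem inner_solJet_of_ne (hR : 0 < R) (k : Frequency) (s : L2 (box r)) (n m : ℕ)
    (h : n ≠ m) : inner ℂ (solJet hR k s n) (solJet hR k s m) = 0 :=
  inner_jet_of_ne hR _ _ h

/-- The solution as an element of `H²` of a bounded part of the waveguide. -/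
noncomputable def solH2 (hR : 0 < R) (k : Frequency) (s : L2 (box r)) : H2 (box R) :=
  ∑' n, solJet hR k s n

theorem hasSum_solJet (hr : 0 < r) (hR : 0 < R) (k : Frequency) (s : L2 (box r)) :
    HasSum (solJet hR k s) (solH2 hR k s) := by
  obtain ⟨C, _, h⟩ := exists_norm_solJet_sq_le hr hR k
  exact (summable_of_orthogonal (inner_solJet_of_ne hR k s)
    ((summable_normSq_src s).1.mul_left C) (h s)).1.hasSum

theorem exists_norm_solH2_le (hr : 0 < r) (hR : 0 < R) (k : Frequency) :
    ∃ C : ℝ, 0 < C ∧ ∀ s : L2 (box r), ‖solH2 hR k s‖ ≤ C * ‖s‖ := by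
  obtain ⟨C, hC, h⟩ := exists_norm_solJet_sq_le hr hR k
  refine ⟨Real.sqrt C, Real.sqrt_pos.2 hC, fun s => ?_⟩
  have h1 := (summable_of_orthogonal (inner_solJet_of_ne hR k s)
    ((summable_normSq_src s).1.mul_left C) (h s)).2
  refine le_of_sq_le_sq ?_ (by positivity)
  rw [mul_pow, Real.sq_sqrt hC.le]
  refine h1.trans ?_
  rw [tsum_mul_left]
  exact mul_le_mul_of_nonneg_left (summable_normSq_src s).2 hC.le

/-! ### The pointwise sum of the modal series -/

/-- The outgoing solution as a function. -/
noncomputable def solFun (k : Frequency) (s : L2 (box r)) (p : ℝ × ℝ) : ℂ :=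
  ∑' n, sol k s n p.1 * modeC n p.2

/-- A summable majorant of the modal series. -/
noncomputable def solBound (k : Frequency) (s : L2 (box r)) (n : ℕ) : ℝ :=
  (‖waveNumber k n‖ ^ 2)⁻¹ + 2 * r * normSq r (src s n)

theorem summable_solBound (k : Frequency) (s : L2 (box r)) : Summable (solBound k s) :=
  (summable_inv_norm_waveNumber_sq k).add ((summable_normSq_src s).1.mul_left _)

theorem norm_sol_mul_modeC_le (hr : 0 < r) (k : Frequency) (s : L2 (box r)) (n : ℕ) (x y : ℝ) :
    ‖sol k s n x * modeC n y‖ ≤ solBound k s n := by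
  have hi := waveNumber_im_nonneg k n
  have hf := isSource_src s n
  have h1 := norm_outSol_le hi hf x
  have h2 := decayConv_le hi hr hf x
  have h3 := norm_modeC_le n y
  have hn : 0 < ‖waveNumber k n‖ := norm_pos_iff.2 (waveNumber_ne_zero k n)
  rw [norm_mul]
  set m := decayConv (waveNumber k n).im r (src s n) x
  have hm : 0 ≤ m := decayConv_nonneg _ _ _ _
  calc ‖sol k s n x‖ * ‖modeC n y‖ ≤ ((2 * ‖waveNumber k n‖)⁻¹ * m) * 2 :=
        mul_le_mul h1 h3 (norm_nonneg _) (by positivity)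
    _ = ‖waveNumber k n‖⁻¹ * m := by field_simp
    _ ≤ (‖waveNumber k n‖⁻¹) ^ 2 + m ^ 2 := by
        have : 0 ≤ ‖waveNumber k n‖⁻¹ := by positivity
        nlinarith [sq_nonneg (‖waveNumber k n‖⁻¹ - m)]
    _ ≤ solBound k s n := by rw [inv_pow, solBound]; gcongr

theorem hasSum_solFun (hr : 0 < r) (k : Frequency) (s : L2 (box r)) (p : ℝ × ℝ) :
    HasSum (fun n => sol k s n p.1 * modeC n p.2) (solFun k s p) :=
  (Summable.of_norm_bounded (summable_solBound k s)
    fun n => norm_sol_mul_modeC_le hr k s n p.1 p.2).hasSum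

theorem coef_solFun (hr : 0 < r) (k : Frequency) (s : L2 (box r)) (n : ℕ) (x : ℝ) :
    coef n (solFun k s) x = sol k s n x := by
  have hs : HasSum (fun m => ∫ y in Ioo (0 : ℝ) 1, mode n y • (sol k s m x * modeC m y))
      (coef n (solFun k s) x) := by
    have hle : ∀ m y, ‖mode n y • (sol k s m x * modeC m y)‖ ≤ 2 * solBound k s m := by
      intro m y
      rw [norm_smul]
      exact mul_le_mul (abs_mode_le n y) (norm_sol_mul_modeC_le hr k s m x y) (norm_nonneg _)
        zero_le_two
    refine hasSum_integral_of_dominated_convergence (fun m _ => 2 * solBound k s m)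
      (fun m => ?_) (fun m => ae_of_all _ (hle m))
      (ae_of_all _ fun _ => (summable_solBound k s).mul_left 2) (integrable_const _)
      (ae_of_all _ fun y => (hasSum_solFun hr k s (x, y)).const_smul _)
    exact Continuous.aestronglyMeasurable (by fun_prop)
  have hz : ∀ m, ∫ y in Ioo (0 : ℝ) 1, mode n y • (sol k s m x * modeC m y)
      = sol k s m x * ∫ y in (0 : ℝ)..1, modeC n y * modeC m y := by
    intro m
    rw [← integral_Ioo_eq zero_le_one, ← integral_const_mul]
    congr 1; ext y
    rw [Complex.real_smul, modeC, modeC]; ring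
  simp only [hz] at hs
  refine hs.unique ?_
  have h1 := hasSum_single (f := fun m => sol k s m x * ∫ y in (0 : ℝ)..1, modeC n y * modeC m y)
    n fun m hm => by simp only [integral_modeC_mul_modeC_of_ne hm.symm, mul_zero]
  simpa only [integral_modeC_mul_self, mul_one] using h1

theorem ae_eq_of_hasSum {U : Set (ℝ × ℝ)} [IsFiniteMeasure (volume.restrict U)]
    {h : ℕ → L2 U} {H : L2 U} {g : ℕ → ℝ × ℝ → ℂ} {G : ℝ × ℝ → ℂ}
    (hH : HasSum h H) (hg : ∀ n, h n =ᵐ[volume.restrict U] g n) (hG : ∀ p, HasSum (g · p) (G p)) :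
    H =ᵐ[volume.restrict U] G := by
  have h1 := tendstoInMeasure_of_tendsto_Lp hH.tendsto_sum_nat
  have hsum : ∀ N, (∑ n ∈ Finset.range N, h n : L2 U) =ᵐ[volume.restrict U]
      fun p => ∑ n ∈ Finset.range N, g n p := by
    intro N
    induction N with
    | zero => simpa using! Lp.coeFn_zero ℂ 2 (volume.restrict U)
    | succ N ih =>
      simp only [Finset.sum_range_succ]
      filter_upwards [Lp.coeFn_add (∑ n ∈ Finset.range N, h n) (h N), ih, hg N] with p h1 h2 h3
      rw [h1, Pi.add_apply, h2, h3]
  have h2 : TendstoInMeasure (volume.restrict U)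
      (fun N => ((∑ n ∈ Finset.range N, h n : L2 U) : ℝ × ℝ → ℂ)) atTop G := by
    refine tendstoInMeasure_of_tendsto_ae (fun N => Lp.aestronglyMeasurable _) ?_
    filter_upwards [ae_all_iff.2 hsum] with p hp
    simp only [hp]
    exact (hG p).tendsto_sum_nat
  exact tendstoInMeasure_ae_unique h1 h2

instance isFiniteMeasure_box (R : ℝ) :
    IsFiniteMeasure ((volume : Measure (ℝ × ℝ)).restrict (box R)) := by
  rw [volume_restrict_box]; infer_instance

theorem isRestriction_solH2 (hr : 0 < r) (hR : 0 < R) (k : Frequency) (s : L2 (box r)) :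
    IsRestriction (solH2 hR k s) (solFun k s) := by
  unfold IsRestriction
  rw [val_eq]
  refine ae_eq_of_hasSum ((jetCLM (box R) (.inl ())).hasSum (hasSum_solJet hr hR k s))
    (fun n => ?_) (hasSum_solFun hr k s)
  exact coeFn_tens ((isProfile_sol k s n).memLp_der R 0) (memLp_modeC n)

end Waveguide

namespace Waveguide

/-! ### Existence -/

variable {r R : ℝ} {φ : ℝ × ℝ → ℝ}

theorem IsRestriction.unique {v v' : H2 (box R)} {u u' : ℝ × ℝ → ℂ} (h : IsRestriction v u)
    (h' : IsRestriction v' u') (hu : u =ᵐ[volume.restrict (box R)] u') : v = v' :=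
  H2.ext (isOpen_box R) (Lp.ext (h.trans (hu.trans h'.symm)))

theorem helmholtz_solJet (hR : 0 < R) (k : Frequency) (s : L2 (box r)) (n : ℕ) :
    hess (solJet hR k s n) 0 0 + hess (solJet hR k s n) 1 1
      + ((k : ℝ) : ℂ) ^ 2 • val (solJet hR k s n) = -tens R (src s n) (modeC n) := by
  have hp := isProfile_sol k s n
  have h0 := coeFn_tens (hp.memLp_der R 2) (memLp_modeC n)
  have h1 := coeFn_tens (hp.memLp_der R 0) (memLp_modeDD n)
  have h2 := coeFn_tens (hp.memLp_der R 0) (memLp_modeC n)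
  have h3 := coeFn_tens ((isSource_src s n).memLp.restrict (Ioo (-R) R)) (memLp_modeC n)
  have e0 : hess (solJet hR k s n) 0 0
      = tens R (outSolDD (waveNumber k n) (src s n)) (modeC n) := rfl
  have e1 : hess (solJet hR k s n) 1 1
      = tens R (sol k s n) (fun y => -(freq n : ℂ) ^ 2 * modeC n y) := rfl
  have e2 : val (solJet hR k s n) = tens R (sol k s n) (modeC n) := rfl
  rw [e0, e1, e2]
  apply Lp.ext
  refine (Lp.coeFn_add _ _).trans ?_
  filter_upwards [Lp.coeFn_add (tens R (outSolDD (waveNumber k n) (src s n)) (modeC n))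
    (tens R (sol k s n) (fun y => -(freq n : ℂ) ^ 2 * modeC n y)),
    Lp.coeFn_smul (((k : ℝ) : ℂ) ^ 2) (tens R (sol k s n) (modeC n)),
    Lp.coeFn_neg (tens R (src s n) (modeC n)), h0, h1, h2, h3] with p q1 q2 q3 q4 q5 q6 q7
  simp only [Pi.add_apply, Pi.neg_apply, Pi.smul_apply, q1, q2, q3, q7, smul_eq_mul]
  rw [show tens R (outSolDD (waveNumber k n) (src s n)) (modeC n) p = _ from q4,
    show tens R (sol k s n) (fun y => -(freq n : ℂ) ^ 2 * modeC n y) p = _ from q5,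
    show tens R (sol k s n) (modeC n) p = _ from q6]
  simp only [sep, der, outSolDD, waveNumber_sq k.2.1, neg_mul]
  simp only [sol]
  ring

theorem hasSum_tens_src (R : ℝ) (s : L2 (box r)) :
    HasSum (fun n => tens R (src s n) (modeC n))
      ((memLp_extendByZero s).restrict (box R)).toLp := by
  have h := hasSum_modePart ((memLp_extendByZero s).restrict (box R)).toLp
  refine (congrArg (fun f => HasSum f _) (funext fun n => ?_)).mp h
  exact tens_congr (memLp_coef (Lp.memLp _) n) (memLp_modeC n)
    (coef_congr_ae ((memLp_extendByZero s).restrict (box R)).coeFn_toLp n)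

theorem solvesHelmholtz_solFun (hr : 0 < r) (k : Frequency) (s : L2 (box r)) :
    SolvesHelmholtz k (extendByZero s) (solFun k s) := by
  intro R hR v hv
  obtain rfl := IsRestriction.unique hv (isRestriction_solH2 hr hR k s) EventuallyEq.rfl
  set v := solH2 hR k s with hvdef
  have hs := hasSum_solJet hr hR k s
  have h1 : HasSum (fun n => hess (solJet hR k s n) 0 0 + hess (solJet hR k s n) 1 1
      + ((k : ℝ) : ℂ) ^ 2 • val (solJet hR k s n))
      (hess v 0 0 + hess v 1 1 + ((k : ℝ) : ℂ) ^ 2 • val v) :=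
    (((jetCLM _ _).hasSum hs).add ((jetCLM _ _).hasSum hs)).add
      (((jetCLM _ _).hasSum hs).const_smul _)
  simp only [helmholtz_solJet] at h1
  have h2 := h1.unique (hasSum_tens_src R s).neg
  filter_upwards [Lp.coeFn_add (hess v 0 0 + hess v 1 1) (((k : ℝ) : ℂ) ^ 2 • val v),
    Lp.coeFn_add (hess v 0 0) (hess v 1 1), Lp.coeFn_smul (((k : ℝ) : ℂ) ^ 2) (val v), hv,
    Lp.coeFn_neg ((memLp_extendByZero s).restrict (box R)).toLp,
    ((memLp_extendByZero s).restrict (box R)).coeFn_toLp] with p q1 q2 q3 q4 q5 q6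
  rw [h2, q5, Pi.neg_apply, q6, Pi.add_apply, q2, q3, Pi.add_apply, Pi.smul_apply, q4,
    smul_eq_mul] at q1
  exact q1.symm

/-- The boundary term of Green's formula, as a functional of the function. -/
noncomputable def greenCLM (hφ : IsTest (Ioo (-R) R ×ˢ univ) φ) : H2 (box R) →L[ℂ] ℂ :=
  (testCLM (hφ.memLp _)).comp (jetCLM (box R) (.inr (.inr (0, 0))))
    + (testCLM (hφ.memLp _)).comp (jetCLM (box R) (.inr (.inr (1, 1))))
    + ((testCLM (hφ.memLp_partialDeriv 0 _)).comp (jetCLM (box R) (.inr (.inl 0)))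
      + (testCLM (hφ.memLp_partialDeriv 1 _)).comp (jetCLM (box R) (.inr (.inl 1))))

theorem greenCLM_apply (hφ : IsTest (Ioo (-R) R ×ˢ univ) φ) (v : H2 (box R)) :
    greenCLM hφ v = (∫ p in box R, φ p • hess v 0 0 p) + (∫ p in box R, φ p • hess v 1 1 p)
      + ((∫ p in box R, partialDeriv 0 φ p • grad v 0 p)
        + ∫ p in box R, partialDeriv 1 φ p • grad v 1 p) := by
  simp only [greenCLM, _root_.add_apply, ContinuousLinearMap.comp_apply,
    testCLM_apply]
  rfl

theorem greenCLM_eq_integral (hφ : IsTest (Ioo (-R) R ×ˢ univ) φ) (v : H2 (box R)) :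
    greenCLM hφ v = ∫ p in box R, (φ p • (hess v 0 0 p + hess v 1 1 p) +
        (partialDeriv 0 φ p • grad v 0 p + partialDeriv 1 φ p • grad v 1 p)) := by
  have i1 := integrable_test_smul (hφ.memLp _) (hess v 0 0)
  have i2 := integrable_test_smul (hφ.memLp _) (hess v 1 1)
  have i3 := integrable_test_smul (hφ.memLp_partialDeriv 0 _) (grad v 0)
  have i4 := integrable_test_smul (hφ.memLp_partialDeriv 1 _) (grad v 1)
  have i12 : IntegrableOn (fun p => φ p • hess v 0 0 p + φ p • hess v 1 1 p) (box R) := i1.add i2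
  have i34 : IntegrableOn (fun p => partialDeriv 0 φ p • grad v 0 p +
    partialDeriv 1 φ p • grad v 1 p) (box R) := i3.add i4
  rw [greenCLM_apply, ← integral_add i1 i2, ← integral_add i3 i4, ← integral_add i12 i34]
  simp only [smul_add]

theorem greenCLM_jet (hR : 0 < R) {w q p : ℝ → ℂ} (h : IsProfile w q p) (n : ℕ)
    (hφ : IsTest (Ioo (-R) R ×ˢ univ) φ) : greenCLM hφ (jet hR h n) = 0 := by
  have key : ∀ (ψ : ℝ × ℝ → ℝ) (a b : ℕ), ∫ x in box R, ψ x •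
      tens R (der w q p a) (modeDer n b) x
      = ∫ x in box R, ψ x • sep (der w q p a) (modeDer n b) x := fun ψ a b =>
    integral_congr_ae (by
      filter_upwards [coeFn_tens (h.memLp_der R a) (memLp_modeDer n b)] with x hx
      rw [hx])
  have e1 := key φ 2 0
  have e2 := key φ 0 2
  have e3 := key (partialDeriv 0 φ) 1 0
  have e4 := key (partialDeriv 1 φ) 0 1
  have g1 := integral_partialDeriv_zero_smul_sep hR hφ h.snd (continuous_modeC n)
  have g2 := integral_partialDeriv_one_smul_sep (R := R) hφ
    (h.fst.continuous.locallyIntegrable (μ := volume)) (isPrimitive_modeD n)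
    (by simp) (by simp)
  rw [greenCLM_apply]
  change (∫ x in box R, φ x • tens R (der w q p 2) (modeDer n 0) x)
    + (∫ x in box R, φ x • tens R (der w q p 0) (modeDer n 2) x)
    + ((∫ x in box R, partialDeriv 0 φ x • tens R (der w q p 1) (modeDer n 0) x)
      + ∫ x in box R, partialDeriv 1 φ x • tens R (der w q p 0) (modeDer n 1) x) = 0
  rw [e1, e2, e3, e4]
  simp only [modeDer, der] at g1 g2 ⊢
  rw [g1, g2]
  ring

theorem neumannCondition_solFun (hr : 0 < r) (k : Frequency) (s : L2 (box r)) :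
    NeumannCondition (solFun k s) := by
  intro R hR v hv φ hφ
  obtain rfl := IsRestriction.unique hv (isRestriction_solH2 hr hR k s) EventuallyEq.rfl
  rw [← greenCLM_eq_integral hφ]
  have h := (greenCLM hφ).hasSum (hasSum_solJet hr hR k s)
  have hz : ∀ n, greenCLM hφ (solJet hR k s n) = 0 := fun n => greenCLM_jet hR _ n hφ
  simp only [hz] at h
  exact h.unique hasSum_zero

/-- A function whose derivative is `±iκ` times the function near `±∞`. -/
theorem tendsto_radiation {w q : ℝ → ℂ} {κ : ℂ} (h1 : ∀ x, r ≤ x → q x = Complex.I * κ * w x)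
    (h2 : ∀ x, x ≤ -r → q x = -(Complex.I * κ * w x)) (hr : 0 < r) :
    Tendsto (fun x : ℝ => ‖q x * ((x / |x| : ℝ) : ℂ) - Complex.I * κ * w x‖)
      (cocompact ℝ) (𝓝 0) := by
  refine tendsto_const_nhds.congr' ?_
  filter_upwards [(isCompact_Icc (a := -r) (b := r)).compl_mem_cocompact] with x hx
  rcases le_or_gt r x with h | h
  · have hx0 : 0 < x := hr.trans_le h
    rw [abs_of_pos hx0, div_self hx0.ne', h1 x h]; simp
  · have hx' : x ≤ -r := by
      by_contra hh; exact hx ⟨(not_le.1 hh).le, h.le⟩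
    have hx0 : x < 0 := by linarith
    rw [abs_of_neg hx0, div_neg, div_self hx0.ne, h2 x hx']; simp

theorem isOutgoing_solFun (hr : 0 < r) (k : Frequency) (s : L2 (box r)) :
    IsOutgoing k (solFun k s) := by
  intro n
  have hp := isProfile_sol k s n
  have hκ := waveNumber_ne_zero k n
  have hf := isSource_src s n
  refine ⟨sol k s n, hp.fst.contDiff_one hp.snd.continuous,
    ae_of_all _ fun x => (coef_solFun hr k s n x).symm, ?_⟩
  have hd : deriv (sol k s n) = outSolD (waveNumber k n) (src s n) :=
    funext fun x => (hp.fst.hasDerivAt hp.snd.continuous x).deriv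
  rw [hd]
  exact tendsto_radiation (fun x hx => outSolD_of_le hκ hf hx)
    (fun x hx => outSolD_of_le_neg hκ hf hx) hr

theorem isSolution_solFun (hr : 0 < r) (k : Frequency) (s : L2 (box r)) :
    IsSolution k (extendByZero s) (solFun k s) where
  memH2loc _ hR := ⟨solH2 hR k s, isRestriction_solH2 hr hR k s⟩
  helmholtz := solvesHelmholtz_solFun hr k s
  neumann := neumannCondition_solFun hr k s
  outgoing := isOutgoing_solFun hr k s

end Waveguide

namespace Waveguide

/-! ### Weak derivatives against test functions that do not vanish on the boundary -/

variable {r R : ℝ} {χ χ' ψ ψ' : ℝ → ℝ}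

/-- A smooth function that vanishes for `t ≤ 1` and equals `1` for `t ≥ 2`. -/
noncomputable def ramp (t : ℝ) : ℝ := Real.smoothTransition (t - 1)

theorem contDiff_ramp : ContDiff ℝ ((⊤ : ℕ∞) : WithTop ℕ∞) ramp :=
  Real.smoothTransition.contDiff.comp (contDiff_id.sub contDiff_const)

theorem hasDerivAt_ramp (t : ℝ) : HasDerivAt ramp (deriv ramp t) t :=
  (contDiff_ramp.differentiable (by simp) t).hasDerivAt

theorem continuous_deriv_ramp : Continuous (deriv ramp) := contDiff_ramp.continuous_deriv (by simp)

theorem ramp_of_le {t : ℝ} (h : t ≤ 1) : ramp t = 0 :=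
  Real.smoothTransition.zero_of_nonpos (by linarith)

theorem ramp_of_ge {t : ℝ} (h : 2 ≤ t) : ramp t = 1 :=
  Real.smoothTransition.one_of_one_le (by linarith)

theorem abs_ramp_le (t : ℝ) : |ramp t| ≤ 1 := by
  rw [ramp, abs_of_nonneg (Real.smoothTransition.nonneg _)]
  exact Real.smoothTransition.le_one _

theorem deriv_ramp_of_gt {t : ℝ} (h : 2 < t) : deriv ramp t = 0 := by
  have : ramp =ᶠ[𝓝 t] fun _ => 1 := by
    filter_upwards [lt_mem_nhds h] with x hx using ramp_of_ge hx.le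
  rw [this.deriv_eq]; simp

theorem exists_mul_deriv_ramp_le : ∃ T : ℝ, 0 ≤ T ∧ ∀ t, 0 ≤ t → |t * deriv ramp t| ≤ T := by
  have hc : Continuous fun t : ℝ => t * deriv ramp t := continuous_id.mul continuous_deriv_ramp
  obtain ⟨T, hT⟩ := (isCompact_Icc (a := (0 : ℝ)) (b := 2)).exists_bound_of_continuousOn
    hc.continuousOn
  have hT0 : 0 ≤ T := (norm_nonneg _).trans (hT 0 (by simp))
  refine ⟨T, hT0, fun t ht => ?_⟩
  rcases le_or_gt t 2 with h | h
  · exact hT t ⟨ht, h⟩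
  · rw [deriv_ramp_of_gt h]; simpa using hT0

/-- Smooth cutoff functions exhausting `(0,1)`. -/
noncomputable def cutoff (m : ℕ) (y : ℝ) : ℝ :=
  ramp ((m + 1 : ℝ) * y) * ramp ((m + 1 : ℝ) * (1 - y))

/-- The derivative of a cutoff function. -/
noncomputable def cutoffD (m : ℕ) (y : ℝ) : ℝ :=
  (m + 1 : ℝ) * deriv ramp ((m + 1 : ℝ) * y) * ramp ((m + 1 : ℝ) * (1 - y))
    - ramp ((m + 1 : ℝ) * y) * ((m + 1 : ℝ) * deriv ramp ((m + 1 : ℝ) * (1 - y)))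

theorem hasDerivAt_cutoff (m : ℕ) (y : ℝ) : HasDerivAt (cutoff m) (cutoffD m y) y := by
  have h1 : HasDerivAt (fun y => ramp ((m + 1 : ℝ) * y))
      (deriv ramp ((m + 1 : ℝ) * y) * (m + 1)) y := by
    have := (hasDerivAt_ramp ((m + 1 : ℝ) * y)).comp y ((hasDerivAt_id y).const_mul (m + 1 : ℝ))
    simpa using! this
  have h2 : HasDerivAt (fun y => ramp ((m + 1 : ℝ) * (1 - y)))
      (deriv ramp ((m + 1 : ℝ) * (1 - y)) * (-(m + 1))) y := by
    have := (hasDerivAt_ramp ((m + 1 : ℝ) * (1 - y))).comp y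
      (((hasDerivAt_id y).const_sub 1).const_mul (m + 1 : ℝ))
    simpa using! this
  convert! h1.mul h2 using 1
  rw [cutoffD]; ring

theorem contDiff_cutoff (m : ℕ) : ContDiff ℝ ((⊤ : ℕ∞) : WithTop ℕ∞) (cutoff m) :=
  (contDiff_ramp.comp (contDiff_const.mul contDiff_id)).mul
    (contDiff_ramp.comp (contDiff_const.mul (contDiff_const.sub contDiff_id)))

theorem abs_cutoff_le (m : ℕ) (y : ℝ) : |cutoff m y| ≤ 1 := by
  rw [cutoff, abs_mul]
  exact mul_le_one₀ (abs_ramp_le _) (abs_nonneg _) (abs_ramp_le _)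

theorem cutoff_eq_zero {m : ℕ} {y : ℝ} (h : y ∉ Icc (1 / (m + 1 : ℝ)) (1 - 1 / (m + 1 : ℝ))) :
    cutoff m y = 0 := by
  have hm : (0 : ℝ) < m + 1 := by positivity
  by_cases h1 : 1 / (m + 1 : ℝ) ≤ y
  · have h2 : 1 - 1 / (m + 1 : ℝ) < y := by
      by_contra hh; exact h ⟨h1, not_lt.1 hh⟩
    have : (m + 1 : ℝ) * (1 - y) ≤ 1 := by
      have : 1 - y ≤ 1 / (m + 1 : ℝ) := by linarith
      calc (m + 1 : ℝ) * (1 - y) ≤ (m + 1 : ℝ) * (1 / (m + 1)) := by gcongr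
        _ = 1 := by field_simp
    rw [cutoff, ramp_of_le this, mul_zero]
  · have : (m + 1 : ℝ) * y ≤ 1 := by
      calc (m + 1 : ℝ) * y ≤ (m + 1 : ℝ) * (1 / (m + 1)) := by gcongr; exact (not_le.1 h1).le
        _ = 1 := by field_simp
    rw [cutoff, ramp_of_le this, zero_mul]

theorem eventually_cutoff {y : ℝ} (hy : y ∈ Ioo (0 : ℝ) 1) :
    ∀ᶠ m : ℕ in atTop, cutoff m y = 1 ∧ cutoffD m y = 0 := by
  have hm : Tendsto (fun m : ℕ => (m + 1 : ℝ)) atTop atTop :=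
    tendsto_atTop_add_const_right _ _ tendsto_natCast_atTop_atTop
  have h1 := (hm.atTop_mul_const hy.1).eventually_gt_atTop 2
  have h2 := (hm.atTop_mul_const (sub_pos.2 hy.2)).eventually_gt_atTop 2
  filter_upwards [h1, h2] with m h1 h2
  rw [cutoff, cutoffD, ramp_of_ge h1.le, ramp_of_ge h2.le, deriv_ramp_of_gt h1,
    deriv_ramp_of_gt h2]
  simp

theorem exists_cutoffD_mul_le {L : ℝ} (h0 : ∀ y ∈ Ioo (0 : ℝ) 1, |ψ y| ≤ L * y)
    (h1 : ∀ y ∈ Ioo (0 : ℝ) 1, |ψ y| ≤ L * (1 - y)) :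
    ∃ C : ℝ, ∀ (m : ℕ), ∀ y ∈ Ioo (0 : ℝ) 1, |cutoffD m y * ψ y| ≤ C := by
  obtain ⟨T, hT0, hT⟩ := exists_mul_deriv_ramp_le
  refine ⟨T * L + T * L, fun m y hy => ?_⟩
  have hm : (0 : ℝ) < m + 1 := by positivity
  have hL : 0 ≤ L := by
    have := (abs_nonneg _).trans (h0 y hy)
    by_contra hh
    nlinarith [hy.1]
  have key : ∀ z, 0 < z → |ψ y| ≤ L * z → |(m + 1 : ℝ) * deriv ramp ((m + 1 : ℝ) * z)| * |ψ y|
      ≤ T * L := by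
    intro z hz hψ
    have h2 := hT ((m + 1 : ℝ) * z) (by positivity)
    calc |(m + 1 : ℝ) * deriv ramp ((m + 1 : ℝ) * z)| * |ψ y|
        ≤ |(m + 1 : ℝ) * deriv ramp ((m + 1 : ℝ) * z)| * (L * z) := by gcongr
      _ = |(m + 1 : ℝ) * z * deriv ramp ((m + 1 : ℝ) * z)| * L := by
          rw [abs_mul, abs_mul, abs_mul, abs_of_pos hz]; ring
      _ ≤ T * L := by gcongr
  have e : cutoffD m y * ψ y = (m + 1 : ℝ) * deriv ramp ((m + 1 : ℝ) * y) * ψ y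
        * ramp ((m + 1 : ℝ) * (1 - y))
      - (m + 1 : ℝ) * deriv ramp ((m + 1 : ℝ) * (1 - y)) * ψ y * ramp ((m + 1 : ℝ) * y) := by
    rw [cutoffD]; ring
  rw [e]
  refine (abs_sub _ _).trans (add_le_add ?_ ?_)
  · rw [abs_mul, abs_mul]
    exact (mul_le_of_le_one_right (by positivity) (abs_ramp_le _)).trans
      (key y hy.1 (h0 y hy))
  · rw [abs_mul, abs_mul]
    exact (mul_le_of_le_one_right (by positivity) (abs_ramp_le _)).trans
      (key (1 - y) (sub_pos.2 hy.2) (h1 y hy))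

/-- One-dimensional test functions. -/
structure IsTestLine (χ χ' : ℝ → ℝ) : Prop where
  smooth : ContDiff ℝ ((⊤ : ℕ∞) : WithTop ℕ∞) χ
  compact : HasCompactSupport χ
  hasDerivAt : ∀ x, HasDerivAt χ (χ' x) x

theorem IsTestLine.deriv_eq (h : IsTestLine χ χ') : deriv χ = χ' :=
  funext fun x => (h.hasDerivAt x).deriv

theorem IsTestLine.smooth_deriv (h : IsTestLine χ χ') :
    ContDiff ℝ ((⊤ : ℕ∞) : WithTop ℕ∞) χ' := by
  rw [← h.deriv_eq]
  exact (contDiff_infty_iff_deriv.1 h.smooth).2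

theorem IsTestLine.compact_deriv (h : IsTestLine χ χ') : HasCompactSupport χ' := by
  rw [← h.deriv_eq]; exact h.compact.deriv

theorem IsTestLine.tsupport_deriv (h : IsTestLine χ χ') : tsupport χ' ⊆ tsupport χ := by
  rw [← h.deriv_eq]; exact tsupport_deriv_subset

theorem isTestLine (hs : ContDiff ℝ ((⊤ : ℕ∞) : WithTop ℕ∞) χ) (hc : HasCompactSupport χ) :
    IsTestLine χ (deriv χ) :=
  ⟨hs, hc, fun x => (hs.differentiable (by simp) x).hasDerivAt⟩

theorem isTest_mul {K : Set ℝ} {V : Set (ℝ × ℝ)} (hχ : IsTestLine χ χ')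
    (hψ : ContDiff ℝ ((⊤ : ℕ∞) : WithTop ℕ∞) ψ) (hK : IsCompact K) (hψK : ∀ y ∉ K, ψ y = 0)
    (hV : tsupport χ ×ˢ K ⊆ V) : IsTest V fun p => χ p.1 * ψ p.2 := by
  have hc : IsCompact (tsupport χ ×ˢ K) := hχ.compact.isCompact.prod hK
  have hsub : Function.support (fun p : ℝ × ℝ => χ p.1 * ψ p.2) ⊆ tsupport χ ×ˢ K := by
    intro p hp
    refine ⟨subset_tsupport _ fun h => hp (by simp [h]), ?_⟩
    by_contra h
    exact hp (by simp [hψK _ h])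
  exact ⟨(hχ.smooth.comp contDiff_fst).mul (hψ.comp contDiff_snd),
    HasCompactSupport.of_support_subset_isCompact hc hsub,
    (closure_minimal hsub hc.isClosed).trans hV⟩

theorem partialDeriv_zero_mul {V : Set (ℝ × ℝ)} (hφ : IsTest V fun p => χ p.1 * ψ p.2)
    (hχ : ∀ x, HasDerivAt χ (χ' x) x) (p : ℝ × ℝ) :
    partialDeriv 0 (fun p => χ p.1 * ψ p.2) p = χ' p.1 * ψ p.2 :=
  (hasDerivAt_slice_fst hφ.smooth p.1 p.2).unique ((hχ p.1).mul_const (ψ p.2))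

theorem partialDeriv_one_mul {V : Set (ℝ × ℝ)} (hφ : IsTest V fun p => χ p.1 * ψ p.2)
    {p : ℝ × ℝ} {c : ℝ} (hψ : HasDerivAt ψ c p.2) :
    partialDeriv 1 (fun p => χ p.1 * ψ p.2) p = χ p.1 * c :=
  (hasDerivAt_slice_snd hφ.smooth p.1 p.2).unique (hψ.const_mul (χ p.1))

theorem isTest_cutoff (hχ : IsTestLine χ χ') (hR : tsupport χ ⊆ Ioo (-R) R)
    (hψ : ContDiff ℝ ((⊤ : ℕ∞) : WithTop ℕ∞) ψ) (m : ℕ) :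
    IsTest (box R) fun p => χ p.1 * (cutoff m p.2 * ψ p.2) := by
  refine isTest_mul (ψ := fun y => cutoff m y * ψ y) hχ ((contDiff_cutoff m).mul hψ)
    (isCompact_Icc (a := 1 / (m + 1 : ℝ)) (b := 1 - 1 / (m + 1 : ℝ)))
    (fun y hy => by rw [cutoff_eq_zero hy, zero_mul]) (prod_mono hR fun y hy => ?_)
  have hm : (0 : ℝ) < 1 / (m + 1 : ℝ) := by positivity
  exact ⟨hm.trans_le hy.1, hy.2.trans_lt (by linarith)⟩

theorem tendsto_integral_smul {g : ℕ → ℝ × ℝ → ℝ} {G : ℝ × ℝ → ℝ} {C : ℝ} (a : L2 (box R))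
    (hg : ∀ m, Continuous (g m)) (hC : ∀ m, ∀ p ∈ box R, |g m p| ≤ C)
    (hlim : ∀ p ∈ box R, ∀ᶠ m in atTop, g m p = G p) :
    Tendsto (fun m => ∫ p in box R, g m p • a p) atTop (𝓝 (∫ p in box R, G p • a p)) := by
  refine tendsto_integral_of_dominated_convergence (fun p => C * ‖a p‖)
    (fun m => (hg m).aestronglyMeasurable.smul (Lp.aestronglyMeasurable a))
    ((MemLp.integrable_box (Lp.memLp a)).norm.const_mul C) (fun m => ?_) ?_
  · filter_upwards [ae_restrict_mem (isOpen_box R).measurableSet] with p hp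
    rw [norm_smul]
    exact mul_le_mul_of_nonneg_right (hC m p hp) (norm_nonneg _)
  · filter_upwards [ae_restrict_mem (isOpen_box R).measurableSet] with p hp
    refine tendsto_const_nhds.congr' ?_
    filter_upwards [hlim p hp] with m hm
    rw [hm]

theorem IsWeakPartial.integral_zero {a b : L2 (box R)} (h : IsWeakPartial (box R) 0 a b)
    (hχ : IsTestLine χ χ') (hR : tsupport χ ⊆ Ioo (-R) R)
    (hψ : ContDiff ℝ ((⊤ : ℕ∞) : WithTop ℕ∞) ψ) :
    ∫ p in box R, (χ' p.1 * ψ p.2) • a p = -∫ p in box R, (χ p.1 * ψ p.2) • b p := by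
  have hχc := hχ.smooth.continuous
  have hχ'c := hχ.smooth_deriv.continuous
  have hψc := hψ.continuous
  have hηc := fun m => (contDiff_cutoff m).continuous
  obtain ⟨A, hA⟩ := hχc.bounded_above_of_compact_support hχ.compact
  obtain ⟨A', hA'⟩ := hχ'c.bounded_above_of_compact_support hχ.compact_deriv
  obtain ⟨B, hB⟩ := (isCompact_Icc (a := (0 : ℝ)) (b := 1)).exists_bound_of_continuousOn
    hψc.continuousOn
  have hb : ∀ (θ : ℝ → ℝ) (A : ℝ), (∀ x, ‖θ x‖ ≤ A) → ∀ (m : ℕ), ∀ p ∈ box R,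
      |θ p.1 * (cutoff m p.2 * ψ p.2)| ≤ A * (1 * B) := by
    intro θ A hA m p hp
    rw [abs_mul, abs_mul]
    have hA0 : 0 ≤ A := (norm_nonneg _).trans (hA 0)
    exact mul_le_mul (hA _) (mul_le_mul (abs_cutoff_le _ _) (hB _ (Ioo_subset_Icc_self hp.2))
      (abs_nonneg _) zero_le_one) (by positivity) hA0
  have hl : ∀ (θ : ℝ → ℝ), ∀ p ∈ box R, ∀ᶠ m : ℕ in atTop,
      θ p.1 * (cutoff m p.2 * ψ p.2) = θ p.1 * ψ p.2 := by
    intro θ p hp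
    filter_upwards [eventually_cutoff hp.2] with m hm
    rw [hm.1, one_mul]
  have t1 := tendsto_integral_smul (g := fun m p => χ' p.1 * (cutoff m p.2 * ψ p.2)) a
    (fun m => by have := hηc m; fun_prop) (hb χ' A' hA') (hl χ')
  have t2 := tendsto_integral_smul (g := fun m p => χ p.1 * (cutoff m p.2 * ψ p.2)) b
    (fun m => by have := hηc m; fun_prop) (hb χ A hA) (hl χ)
  refine tendsto_nhds_unique t1 (t2.neg.congr fun m => ?_)
  have hφ := isTest_cutoff hχ hR hψ m
  rw [← h _ hφ]
  simp only [partialDeriv_zero_mul (ψ := fun y => cutoff m y * ψ y) hφ hχ.hasDerivAt]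

theorem IsWeakPartial.integral_one {a b : L2 (box R)} (h : IsWeakPartial (box R) 1 a b)
    (hχ : IsTestLine χ χ') (hR : tsupport χ ⊆ Ioo (-R) R)
    (hψ : ContDiff ℝ ((⊤ : ℕ∞) : WithTop ℕ∞) ψ) (hψ' : ∀ y, HasDerivAt ψ (ψ' y) y)
    (h0 : ψ 0 = 0) (h1 : ψ 1 = 0) :
    ∫ p in box R, (χ p.1 * ψ' p.2) • a p = -∫ p in box R, (χ p.1 * ψ p.2) • b p := by
  have hχc := hχ.smooth.continuous
  have hψc := hψ.continuous
  have hψ'c : Continuous ψ' := by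
    rw [← funext fun y => (hψ' y).deriv]; exact hψ.continuous_deriv (by simp)
  have hηc := fun m => (contDiff_cutoff m).continuous
  have hη'c : ∀ m, Continuous (cutoffD m) := fun m => by
    rw [← funext fun y => (hasDerivAt_cutoff m y).deriv]
    exact (contDiff_cutoff m).continuous_deriv (by simp)
  obtain ⟨A, hA⟩ := hχc.bounded_above_of_compact_support hχ.compact
  have hA0 : 0 ≤ A := (norm_nonneg _).trans (hA 0)
  obtain ⟨B, hB⟩ := (isCompact_Icc (a := (0 : ℝ)) (b := 1)).exists_bound_of_continuousOn
    hψc.continuousOn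
  obtain ⟨L, hL⟩ := (isCompact_Icc (a := (0 : ℝ)) (b := 1)).exists_bound_of_continuousOn
    hψ'c.continuousOn
  have hlip : ∀ x ∈ Icc (0 : ℝ) 1, ∀ y ∈ Icc (0 : ℝ) 1, ‖ψ y - ψ x‖ ≤ L * ‖y - x‖ :=
    fun x hx y hy => (convex_Icc (0 : ℝ) 1).norm_image_sub_le_of_norm_hasDerivWithin_le
      (fun z _ => (hψ' z).hasDerivWithinAt) hL hx hy
  obtain ⟨C, hC⟩ := exists_cutoffD_mul_le (ψ := ψ) (L := L)
    (fun y hy => by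
      have := hlip 0 (by simp) y (Ioo_subset_Icc_self hy)
      rwa [h0, sub_zero, sub_zero, Real.norm_eq_abs, Real.norm_eq_abs, abs_of_pos hy.1] at this)
    (fun y hy => by
      have := hlip 1 (by simp) y (Ioo_subset_Icc_self hy)
      rwa [h1, sub_zero, Real.norm_eq_abs, Real.norm_eq_abs, abs_sub_comm,
        abs_of_pos (sub_pos.2 hy.2)] at this)
  have t1 := tendsto_integral_smul (C := A * (C + 1 * L)) (G := fun p => χ p.1 * ψ' p.2)
    (g := fun m p => χ p.1 * (cutoffD m p.2 * ψ p.2 + cutoff m p.2 * ψ' p.2)) a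
    (fun m => by have := hηc m; have := hη'c m; fun_prop)
    (fun m p hp => by
      rw [abs_mul]
      refine mul_le_mul (hA _) ((abs_add_le _ _).trans (add_le_add (hC m _ hp.2) ?_))
        (abs_nonneg _) hA0
      rw [abs_mul]
      exact mul_le_mul (abs_cutoff_le _ _) (hL _ (Ioo_subset_Icc_self hp.2))
        (abs_nonneg _) zero_le_one)
    (fun p hp => by
      filter_upwards [eventually_cutoff hp.2] with m hm
      rw [hm.1, hm.2]; ring)
  have t2 := tendsto_integral_smul (C := A * (1 * B)) (G := fun p => χ p.1 * ψ p.2)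
    (g := fun m p => χ p.1 * (cutoff m p.2 * ψ p.2)) b
    (fun m => by have := hηc m; fun_prop)
    (fun m p hp => by
      rw [abs_mul, abs_mul]
      exact mul_le_mul (hA _) (mul_le_mul (abs_cutoff_le _ _) (hB _ (Ioo_subset_Icc_self hp.2))
        (abs_nonneg _) zero_le_one) (by positivity) hA0)
    (fun p hp => by
      filter_upwards [eventually_cutoff hp.2] with m hm
      rw [hm.1, one_mul])
  refine tendsto_nhds_unique t1 (t2.neg.congr fun m => ?_)
  have hφ := isTest_cutoff hχ hR hψ m
  rw [← h _ hφ]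
  simp only [fun p : ℝ × ℝ => partialDeriv_one_mul (ψ := fun y => cutoff m y * ψ y) hφ
    ((hasDerivAt_cutoff m p.2).mul (hψ' p.2))]

end Waveguide

namespace Waveguide

/-! ### One-dimensional uniqueness -/

variable {r R : ℝ} {χ χ' χ'' : ℝ → ℝ}

theorem exists_tsupport_subset_Ioo {ρ : ℝ → ℝ} (hc : HasCompactSupport ρ) :
    ∃ A : ℝ, 0 < A ∧ tsupport ρ ⊆ Ioo (-A) A := by
  obtain ⟨A, hA⟩ := hc.isCompact.isBounded.subset_ball 0
  refine ⟨max A 1, by positivity, fun x hx => ?_⟩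
  have h := hA hx
  rw [Real.ball_eq_Ioo] at h
  have h1 := le_max_left A 1
  exact ⟨by linarith [h.1], by linarith [h.2]⟩

theorem isTestLine_primitive {ρ : ℝ → ℝ} (hρ : ContDiff ℝ ((⊤ : ℕ∞) : WithTop ℕ∞) ρ)
    (hc : HasCompactSupport ρ) (h0 : ∫ x, ρ x = 0) : ∃ χ : ℝ → ℝ, IsTestLine χ ρ := by
  obtain ⟨A, hA0, hA⟩ := exists_tsupport_subset_Ioo hc
  have hz : ∀ x, x ∉ Ioo (-A) A → ρ x = 0 := fun x hx =>
    image_eq_zero_of_notMem_tsupport fun h => hx (hA h)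
  have hd : ∀ x, HasDerivAt (fun x => ∫ t in (-A)..x, ρ t) (ρ x) x := fun x =>
    (hρ.continuous.integral_hasStrictDerivAt (-A) x).hasDerivAt
  have hint : ∫ t in (-A)..A, ρ t = 0 := by
    rw [intervalIntegral.integral_of_le (by linarith), integral_Ioc_eq_integral_Ioo,
      setIntegral_eq_integral_of_forall_compl_eq_zero hz, h0]
  refine ⟨fun x => ∫ t in (-A)..x, ρ t, ?_, ?_, hd⟩
  · rw [contDiff_infty_iff_deriv]
    refine ⟨fun x => (hd x).differentiableAt, ?_⟩
    rwa [funext fun x => (hd x).deriv]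
  · refine HasCompactSupport.intro (isCompact_Icc (a := -A) (b := A)) fun x hx => ?_
    rcases le_or_gt x (-A) with h | h
    · refine (intervalIntegral.integral_congr fun t ht => ?_).trans intervalIntegral.integral_zero
      rw [uIcc_of_ge h] at ht
      exact hz t fun hh => (hh.1.trans_le ht.2).false
    · have hxA : A < x := by
        by_contra hh; exact hx ⟨h.le, not_lt.1 hh⟩
      have e := intervalIntegral.integral_add_adjacent_intervals
        (hρ.continuous.intervalIntegrable (μ := volume) (-A) A)
        (hρ.continuous.intervalIntegrable (μ := volume) A x)
      rw [← e, hint, zero_add]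
      refine (intervalIntegral.integral_congr fun t ht => ?_).trans intervalIntegral.integral_zero
      rw [uIcc_of_le hxA.le] at ht
      exact hz t fun hh => (hh.2.trans_le ht.1).false

theorem integrable_smul_of_compact {ψ : ℝ → ℝ} (hψ : Continuous ψ) (hc : HasCompactSupport ψ)
    {g : ℝ → ℂ} (hg : Continuous g) : Integrable fun x => ψ x • g x :=
  (hψ.smul hg).integrable_of_hasCompactSupport hc.smul_right

/-- The lemma of du Bois-Reymond. -/
theorem exists_eq_const_of_integral_deriv {g : ℝ → ℂ} (hg : Continuous g)
    (h : ∀ χ χ' : ℝ → ℝ, IsTestLine χ χ' → ∫ x, χ' x • g x = 0) : ∃ c, ∀ x, g x = c := by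
  let b : ContDiffBump (0 : ℝ) := ⟨1, 2, by norm_num, by norm_num⟩
  set θ : ℝ → ℝ := b.normed volume with hθ
  have hθs : ContDiff ℝ ((⊤ : ℕ∞) : WithTop ℕ∞) θ := b.contDiff_normed
  have hθc : HasCompactSupport θ := b.hasCompactSupport_normed
  have hθ1 : ∫ x, θ x = 1 := b.integral_normed
  set c := ∫ x, θ x • g x with hc
  refine ⟨c, ?_⟩
  have hae : ∀ᵐ x, g x - c = 0 := by
    refine ae_eq_zero_of_integral_contDiff_smul_eq_zero
      (hg.sub continuous_const).locallyIntegrable fun ψ hψ hψc => ?_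
    set I := ∫ x, ψ x with hI
    have iψ : Integrable ψ := hψ.continuous.integrable_of_hasCompactSupport hψc
    have iθ : Integrable θ := hθs.continuous.integrable_of_hasCompactSupport hθc
    obtain ⟨χ, hχ⟩ := isTestLine_primitive (ρ := fun x => ψ x - I * θ x)
      (hψ.sub (contDiff_const.mul hθs)) (hψc.sub (hθc.mul_left (f := fun _ => I))) (by
        rw [integral_sub iψ (iθ.const_mul I), integral_const_mul, hθ1, mul_one, sub_self])
    have h1 := h χ _ hχ
    have i1 := integrable_smul_of_compact hψ.continuous hψc hg
    have i2 := integrable_smul_of_compact hθs.continuous hθc hg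
    have i3 : Integrable fun x => I • (θ x • g x) := i2.smul I
    simp only [sub_smul, mul_smul] at h1
    rw [integral_sub i1 i3, integral_smul, ← hc] at h1
    simp only [smul_sub]
    rw [integral_sub i1 (iψ.smul_const c), integral_smul_const, h1]
  have := (Continuous.ae_eq_iff_eq (μ := (volume : Measure ℝ)) (hg.sub continuous_const)
    continuous_const).1 hae
  exact fun x => sub_eq_zero.1 (congrFun this x)

theorem integral_testLine_deriv (h : IsTestLine χ χ') {F f : ℝ → ℂ}
    (hF : IsPrimitive F f) : ∫ x, χ' x • F x = -∫ x, χ x • f x := by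
  obtain ⟨A, hA0, hA⟩ := exists_tsupport_subset_Ioo h.compact
  have hz : ∀ x, x ∉ Ioo (-A) A → χ x = 0 := fun x hx =>
    image_eq_zero_of_notMem_tsupport fun hh => hx (hA hh)
  have hz' : ∀ x, x ∉ Ioo (-A) A → χ' x = 0 := fun x hx =>
    image_eq_zero_of_notMem_tsupport fun hh => hx (hA (h.tsupport_deriv hh))
  have h1 := integral_parts (a := -A) (b := A) (by linarith) hF h.hasDerivAt
    h.smooth_deriv.continuous (by rw [hz _ (by simp), zero_smul]) (by rw [hz _ (by simp), zero_smul])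
  rwa [setIntegral_eq_integral_of_forall_compl_eq_zero fun x hx => by rw [hz' x hx, zero_smul],
    setIntegral_eq_integral_of_forall_compl_eq_zero fun x hx => by rw [hz x hx, zero_smul]] at h1

/-- An outgoing solution of the homogeneous equation vanishes. -/
theorem eq_zero_of_outgoing {d d' : ℝ → ℂ} {κ : ℂ} (hκ : κ ≠ 0) (hi : 0 ≤ κ.im)
    (h1 : IsPrimitive d d') (h2 : IsPrimitive d' fun x => -κ ^ 2 * d x)
    (hout : Tendsto (fun x : ℝ => ‖d' x * ((x / |x| : ℝ) : ℂ) - Complex.I * κ * d x‖)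
      (cocompact ℝ) (𝓝 0)) : ∀ x, d x = 0 := by
  have key : ∀ μ : ℂ, μ ^ 2 = κ ^ 2 → ∃ c, ∀ x,
      (d' x + (-(Complex.I * μ)) * d x) * expI μ x = c := by
    intro μ hμ
    have h := (h2.add (h1.const_mul (-(Complex.I * μ)))).mul (isPrimitive_expI μ)
    refine ⟨(d' 0 + (-(Complex.I * μ)) * d 0) * expI μ 0, fun x => ?_⟩
    have h3 := h.integral_eq 0 x
    have hz : ∀ t, (-κ ^ 2 * d t + -(Complex.I * μ) * d' t) * expI μ t
        + (d' t + -(Complex.I * μ) * d t) * (Complex.I * μ * expI μ t) = 0 := by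
      intro t
      rw [← hμ]
      linear_combination (-μ ^ 2 * d t * expI μ t) * Complex.I_sq
    simp only [hz, intervalIntegral.integral_zero] at h3
    exact (sub_eq_zero.1 h3.symm)
  have htop : Tendsto (fun x : ℝ => ‖d' x * ((x / |x| : ℝ) : ℂ) - Complex.I * κ * d x‖) atTop
      (𝓝 0) := hout.mono_left atTop_le_cocompact
  have hbot : Tendsto (fun x : ℝ => ‖d' x * ((x / |x| : ℝ) : ℂ) - Complex.I * κ * d x‖) atBot
      (𝓝 0) := hout.mono_left atBot_le_cocompact
  obtain ⟨a, ha⟩ := key κ rfl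
  obtain ⟨b, hb⟩ := key (-κ) (by ring)
  have ha0 : a = 0 := by
    rw [← norm_le_zero_iff]
    refine ge_of_tendsto htop ?_
    filter_upwards [eventually_gt_atTop 0] with x hx
    rw [← ha x, norm_mul, abs_of_pos hx, div_self hx.ne', norm_expI]
    have e1 : Real.exp (-(κ.im * x)) ≤ 1 :=
      Real.exp_le_one_iff.2 (by have := mul_nonneg hi hx.le; linarith)
    refine (mul_le_of_le_one_right (norm_nonneg _) e1).trans (le_of_eq ?_)
    congr 1; push_cast; ring
  have hb0 : b = 0 := by
    rw [← norm_le_zero_iff]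
    refine ge_of_tendsto hbot ?_
    filter_upwards [eventually_lt_atBot 0] with x hx
    rw [← hb x, norm_mul, abs_of_neg hx, div_neg, div_self hx.ne, norm_expI]
    have e1 : Real.exp (-((-κ).im * x)) ≤ 1 :=
      Real.exp_le_one_iff.2 (by
        have := mul_nonneg hi (neg_nonneg.2 hx.le)
        rw [Complex.neg_im]; linarith)
    refine (mul_le_of_le_one_right (norm_nonneg _) e1).trans (le_of_eq ?_)
    rw [← norm_neg]
    congr 1; push_cast; ring
  intro x
  have hne : ∀ μ : ℂ, expI μ x ≠ 0 := fun μ => Complex.exp_ne_zero _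
  have e1 := (mul_eq_zero.1 ((ha x).trans ha0)).resolve_right (hne _)
  have e2 := (mul_eq_zero.1 ((hb x).trans hb0)).resolve_right (hne _)
  have e3 : 2 * Complex.I * κ * d x = 0 := by linear_combination e2 - e1
  simpa [hκ] using e3

/-! ### The modal equations of a solution -/

theorem integral_smul_mode_eq_integral_coef {u : ℝ × ℝ → ℂ}
    (hu : MemLp u 2 (volume.restrict (box R))) (hχ : Continuous χ) (n : ℕ) :
    ∫ p in box R, (χ p.1 * mode n p.2) • u p = ∫ x in Ioo (-R) R, χ x • coef n u x := by
  have h := integral_mul_conj_sep_mode (F := fun x => (χ x : ℂ))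
    (Continuous.memLp_Ioo (by fun_prop) (-R) R) n hu
  refine Eq.trans ?_ (h.trans ?_)
  · congr 1; ext p
    rw [sep, map_mul, Complex.conj_ofReal, conj_modeC, Complex.real_smul, modeC]
    push_cast; ring
  · congr 1; ext x
    rw [Complex.conj_ofReal, Complex.real_smul, mul_comm]

/-- The derivative of a mode as a real function. -/
noncomputable def modeDR (n : ℕ) (y : ℝ) : ℝ := -(modeAmp n * freq n * Real.sin (freq n * y))

theorem contDiff_mode (n : ℕ) : ContDiff ℝ ((⊤ : ℕ∞) : WithTop ℕ∞) (mode n) := by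
  have : mode n = fun y => modeAmp n * Real.cos (freq n * y) := funext (mode_eq n)
  rw [this]
  exact contDiff_const.mul (Real.contDiff_cos.comp (contDiff_const.mul contDiff_id))

theorem contDiff_modeDR (n : ℕ) : ContDiff ℝ ((⊤ : ℕ∞) : WithTop ℕ∞) (modeDR n) :=
  (contDiff_const.mul (Real.contDiff_sin.comp (contDiff_const.mul contDiff_id))).neg

theorem hasDerivAt_mode (n : ℕ) (y : ℝ) : HasDerivAt (mode n) (modeDR n y) y := by
  have : mode n = fun y => modeAmp n * Real.cos (freq n * y) := funext (mode_eq n)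
  rw [this]
  have := (((hasDerivAt_id y).const_mul (freq n)).cos).const_mul (modeAmp n)
  convert! this using 1
  simp [modeDR]; ring

theorem hasDerivAt_modeDR (n : ℕ) (y : ℝ) :
    HasDerivAt (modeDR n) (-(freq n ^ 2 * mode n y)) y := by
  have := ((((hasDerivAt_id y).const_mul (freq n)).sin).const_mul (modeAmp n * freq n)).neg
  convert! this using 1
  simp [mode_eq]; ring

theorem modal_equation {k : ℝ} {s u : ℝ × ℝ → ℂ} (hs : MemLp s 2) (h : IsSolution k s u) (n : ℕ)
    (hχ : IsTestLine χ χ') (hχ' : IsTestLine χ' χ'') :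
    ∫ x, (χ'' x + (k ^ 2 - freq n ^ 2) * χ x) • coef n u x = -∫ x, χ x • coef n s x := by
  obtain ⟨R, hR, hRs⟩ := exists_tsupport_subset_Ioo hχ.compact
  have hRs' : tsupport χ' ⊆ Ioo (-R) R := hχ.tsupport_deriv.trans hRs
  have hRs'' : tsupport χ'' ⊆ Ioo (-R) R := hχ'.tsupport_deriv.trans hRs'
  obtain ⟨v, hv⟩ := h.memH2loc R hR
  have hcχ := hχ.smooth.continuous
  have hcχ'' := hχ'.smooth_deriv.continuous
  have hcm := continuous_mode n
  -- Green's formula with the test function `χ(x) φₙ(y)`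
  let b : ContDiffBump (0 : ℝ) := ⟨2, 3, by norm_num, by norm_num⟩
  have hφ : IsTest (Ioo (-R) R ×ˢ univ) fun p => χ p.1 * (mode n p.2 * b p.2) := by
    refine isTest_mul (ψ := fun y => mode n y * b y) hχ ((contDiff_mode n).mul b.contDiff)
      b.hasCompactSupport.isCompact (fun y hy => ?_) (prod_mono hRs (subset_univ _))
    rw [image_eq_zero_of_notMem_tsupport hy, mul_zero]
  have hb1 : ∀ y ∈ Ioo (0 : ℝ) 1, b =ᶠ[𝓝 y] 1 := fun y hy => by
    refine b.eventuallyEq_one_of_mem_ball ?_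
    rw [Real.ball_eq_Ioo]
    exact ⟨by change 0 - 2 < y; linarith [hy.1], by change y < 0 + 2; linarith [hy.2]⟩
  have hφ0 : ∀ p ∈ box R, χ p.1 * (mode n p.2 * b p.2) = χ p.1 * mode n p.2 := fun p hp => by
    rw [(hb1 p.2 hp.2).eq_of_nhds, Pi.one_apply, mul_one]
  have hφx : ∀ p ∈ box R, partialDeriv 0 (fun p => χ p.1 * (mode n p.2 * b p.2)) p
      = χ' p.1 * mode n p.2 := fun p hp => by
    rw [partialDeriv_zero_mul (ψ := fun y => mode n y * b y) hφ hχ.hasDerivAt,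
      (hb1 p.2 hp.2).eq_of_nhds, Pi.one_apply, mul_one]
  have hφy : ∀ p ∈ box R, partialDeriv 1 (fun p => χ p.1 * (mode n p.2 * b p.2)) p
      = χ p.1 * modeDR n p.2 := fun p hp => by
    refine partialDeriv_one_mul (ψ := fun y => mode n y * b y) hφ ?_
    refine (hasDerivAt_mode n p.2).congr_of_eventuallyEq ?_
    filter_upwards [hb1 p.2 hp.2] with y hy
    rw [hy, Pi.one_apply, mul_one]
  have hgreen := h.neumann R hR v hv _ hφ
  rw [← greenCLM_eq_integral hφ, greenCLM_apply] at hgreen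
  have hm := (isOpen_box R).measurableSet
  have q1 : ∫ p in box R, partialDeriv 0 (fun p => χ p.1 * (mode n p.2 * b p.2)) p • grad v 0 p
      = ∫ p in box R, (χ' p.1 * mode n p.2) • grad v 0 p :=
    setIntegral_congr_fun hm fun p hp => by simp only [hφx p hp]
  have q2 : ∫ p in box R, partialDeriv 1 (fun p => χ p.1 * (mode n p.2 * b p.2)) p • grad v 1 p
      = ∫ p in box R, (χ p.1 * modeDR n p.2) • grad v 1 p :=
    setIntegral_congr_fun hm fun p hp => by simp only [hφy p hp]
  have q3 : ∫ p in box R, (χ p.1 * (mode n p.2 * b p.2)) • hess v 0 0 p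
      = ∫ p in box R, (χ p.1 * mode n p.2) • hess v 0 0 p :=
    setIntegral_congr_fun hm fun p hp => by simp only [hφ0 p hp]
  have q4 : ∫ p in box R, (χ p.1 * (mode n p.2 * b p.2)) • hess v 1 1 p
      = ∫ p in box R, (χ p.1 * mode n p.2) • hess v 1 1 p :=
    setIntegral_congr_fun hm fun p hp => by simp only [hφ0 p hp]
  rw [q1, q2, q3, q4] at hgreen
  -- removal of the first derivatives
  have hx := IsWeakPartial.integral_zero (v.2.1 0) hχ' hRs' (contDiff_mode n)
  have hy := IsWeakPartial.integral_one (v.2.1 1) hχ hRs (contDiff_modeDR n)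
    (hasDerivAt_modeDR n) (by simp [modeDR]) (by simp [modeDR, freq, Real.sin_nat_mul_pi])
  change ∫ p in box R, (χ'' p.1 * mode n p.2) • val v p
    = -∫ p in box R, (χ' p.1 * mode n p.2) • grad v 0 p at hx
  change ∫ p in box R, (χ p.1 * (-(freq n ^ 2 * mode n p.2))) • val v p
    = -∫ p in box R, (χ p.1 * modeDR n p.2) • grad v 1 p at hy
  have hgrad : (∫ p in box R, (χ' p.1 * mode n p.2) • grad v 0 p)
      + ∫ p in box R, (χ p.1 * modeDR n p.2) • grad v 1 p
      = -((∫ p in box R, (χ'' p.1 * mode n p.2) • val v p)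
        + ∫ p in box R, (χ p.1 * (-(freq n ^ 2 * mode n p.2))) • val v p) := by
    rw [hx, hy]; ring
  rw [hgrad] at hgreen
  -- the equation
  have hus : MemLp u 2 (volume.restrict (box R)) := (Lp.memLp (val v)).ae_eq hv
  have hss : MemLp s 2 (volume.restrict (box R)) := hs.restrict _
  have hint : ∀ {θ : ℝ × ℝ → ℝ}, Continuous θ → ∀ {a : ℝ × ℝ → ℂ},
      MemLp a 2 (volume.restrict (box R)) → IntegrableOn (fun p => θ p • a p) (box R) := by
    intro θ hθ a ha
    obtain ⟨C, hC⟩ := ((isCompact_Icc (a := -R) (b := R)).prod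
      (isCompact_Icc (a := (0 : ℝ)) (b := 1))).exists_bound_of_continuousOn hθ.continuousOn
    refine (MemLp.integrable_box ha).bdd_smul C hθ.aestronglyMeasurable ?_
    filter_upwards [ae_restrict_mem hm] with p hp
    exact hC p ⟨Ioo_subset_Icc_self hp.1, Ioo_subset_Icc_self hp.2⟩
  have c1 : Continuous fun p : ℝ × ℝ => χ p.1 * mode n p.2 := by fun_prop
  have c2 : Continuous fun p : ℝ × ℝ => χ'' p.1 * mode n p.2 := by fun_prop
  have c3 : Continuous fun p : ℝ × ℝ => χ p.1 * (-(freq n ^ 2 * mode n p.2)) := by fun_prop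
  have c4 : Continuous fun p : ℝ × ℝ =>
    (χ'' p.1 + (k ^ 2 - freq n ^ 2) * χ p.1) * mode n p.2 := by fun_prop
  have e : (∫ p in box R, (χ p.1 * mode n p.2) • hess v 0 0 p)
      + (∫ p in box R, (χ p.1 * mode n p.2) • hess v 1 1 p)
      + -((∫ p in box R, (χ'' p.1 * mode n p.2) • val v p)
        + ∫ p in box R, (χ p.1 * (-(freq n ^ 2 * mode n p.2))) • val v p)
      = -(∫ p in box R, (χ p.1 * mode n p.2) • s p)
        - ∫ p in box R, ((χ'' p.1 + (k ^ 2 - freq n ^ 2) * χ p.1) * mode n p.2) • u p := by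
    have i0 := hint c1 (Lp.memLp (hess v 0 0))
    have i1 := hint c1 (Lp.memLp (hess v 1 1))
    have i2 := hint c2 (Lp.memLp (val v))
    have i3 := hint c3 (Lp.memLp (val v))
    have i4 := hint c1 hss
    have i5 := hint c4 hus
    rw [← integral_add i0 i1, ← integral_add i2 i3, ← integral_neg, ← integral_neg]
    refine (integral_add (i0.add i1) (i2.add i3).neg).symm.trans
      (Eq.trans (integral_congr_ae ?_) (integral_sub i4.neg i5))
    filter_upwards [h.helmholtz R hR v hv, hv] with p q1 q2
    simp only [Pi.add_apply, Pi.neg_apply, Complex.real_smul]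
    rw [q2]
    push_cast
    linear_combination ((χ p.1 : ℂ) * (mode n p.2 : ℂ)) * q1
  rw [e, integral_smul_mode_eq_integral_coef hss hcχ,
    integral_smul_mode_eq_integral_coef (χ := fun x => χ'' x + (k ^ 2 - freq n ^ 2) * χ x) hus
      (by fun_prop)] at hgreen
  have hz : ∀ x ∉ Ioo (-R) R, χ x = 0 := fun x hx =>
    image_eq_zero_of_notMem_tsupport fun hh => hx (hRs hh)
  have hz'' : ∀ x ∉ Ioo (-R) R, χ'' x = 0 := fun x hx =>
    image_eq_zero_of_notMem_tsupport fun hh => hx (hRs'' hh)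
  rw [setIntegral_eq_integral_of_forall_compl_eq_zero fun x hx => by rw [hz x hx, zero_smul],
    setIntegral_eq_integral_of_forall_compl_eq_zero fun x hx => by
      rw [hz x hx, hz'' x hx, mul_zero, add_zero, zero_smul]] at hgreen
  linear_combination -hgreen

/-! ### Uniqueness -/

theorem coef_ae_eq_of_isSolution (k : Frequency) {s u u' : ℝ × ℝ → ℂ} (hs : MemLp s 2)
    (h : IsSolution k s u) (h' : IsSolution k s u') (n : ℕ) :
    coef n u =ᵐ[volume] coef n u' := by
  obtain ⟨w, hw, hwu, hwo⟩ := h.outgoing n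
  obtain ⟨w', hw', hwu', hwo'⟩ := h'.outgoing n
  have hpw : ∀ {w : ℝ → ℂ}, ContDiff ℝ 1 w → IsPrimitive w (deriv w) := fun hw =>
    .of_hasDerivAt (fun x => (hw.differentiable (by simp) x).hasDerivAt)
      (hw.continuous_deriv (by simp))
  have hcw := hw.continuous_deriv (by simp)
  have hcw' := hw'.continuous_deriv (by simp)
  set d : ℝ → ℂ := fun x => w x + (-1) * w' x with hd
  set d' : ℝ → ℂ := fun x => deriv w x + (-1) * deriv w' x with hd'
  have hp : IsPrimitive d d' := (hpw hw).add ((hpw hw').const_mul (-1))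
  have hcd : Continuous d := hp.continuous
  have hcd' : Continuous d' := by fun_prop
  have hweak : ∀ χ χ' χ'' : ℝ → ℝ, IsTestLine χ χ' → IsTestLine χ' χ'' →
      ∫ x, (χ'' x + ((k : ℝ) ^ 2 - freq n ^ 2) * χ x) • d x = 0 := by
    intro χ χ' χ'' h1 h2
    have m1 := modal_equation hs h n h1 h2
    have m2 := modal_equation hs h' n h1 h2
    rw [← integral_congr_ae (f := fun x => (χ'' x + ((k : ℝ) ^ 2 - freq n ^ 2) * χ x) • w x)
      (hwu.mono fun x hx => by simp only [hx, coef])] at m1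
    rw [← integral_congr_ae (f := fun x => (χ'' x + ((k : ℝ) ^ 2 - freq n ^ 2) * χ x) • w' x)
      (hwu'.mono fun x hx => by simp only [hx, coef])] at m2
    have hc : Continuous fun x => χ'' x + ((k : ℝ) ^ 2 - freq n ^ 2) * χ x := by
      have := h1.smooth.continuous
      have := h2.smooth_deriv.continuous
      fun_prop
    have hcs : HasCompactSupport fun x => χ'' x + ((k : ℝ) ^ 2 - freq n ^ 2) * χ x :=
      h2.compact_deriv.add (h1.compact.mul_left (f := fun _ => (k : ℝ) ^ 2 - freq n ^ 2))
    have i1 := integrable_smul_of_compact hc hcs hw.continuous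
    have i2 := integrable_smul_of_compact hc hcs hw'.continuous
    have e : ∀ x, (χ'' x + ((k : ℝ) ^ 2 - freq n ^ 2) * χ x) • d x
        = (χ'' x + ((k : ℝ) ^ 2 - freq n ^ 2) * χ x) • w x
          - (χ'' x + ((k : ℝ) ^ 2 - freq n ^ 2) * χ x) • w' x := fun x => by
      rw [← smul_sub, hd]; congr 1; ring
    simp only [e]
    rw [integral_sub i1 i2, m1, m2, sub_self]
  set c : ℂ := waveNumber k n ^ 2 with hc
  have hcr : c = (((k : ℝ) ^ 2 - freq n ^ 2 : ℝ) : ℂ) := by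
    rw [hc, waveNumber_sq k.2.1]; push_cast; ring
  -- the second derivative
  set D : ℝ → ℂ := fun x => ∫ t in (0 : ℝ)..x, d t with hD
  have hDp : IsPrimitive D d := .of_hasDerivAt
    (fun x => (hcd.integral_hasStrictDerivAt 0 x).hasDerivAt) hcd
  have hcD := hDp.continuous
  obtain ⟨a, ha⟩ := exists_eq_const_of_integral_deriv (g := fun x => d' x + c * D x)
    (by fun_prop) fun χ χ' hχ => by
      have hχ' := isTestLine hχ.smooth_deriv hχ.compact_deriv
      have e1 := integral_testLine_deriv hχ' hp
      have e2 := integral_testLine_deriv hχ hDp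
      have hcχ := hχ.smooth.continuous
      have i1 := integrable_smul_of_compact hχ.smooth_deriv.continuous hχ.compact_deriv hcd'
      have i2 := integrable_smul_of_compact hχ.smooth_deriv.continuous hχ.compact_deriv hcD
      have i3 := integrable_smul_of_compact hχ'.smooth_deriv.continuous hχ'.compact_deriv hcd
      have i4 := integrable_smul_of_compact hcχ hχ.compact hcd
      have h0 := hweak χ χ' _ hχ hχ'
      have e3 : ∀ x, (deriv χ' x + ((k : ℝ) ^ 2 - freq n ^ 2) * χ x) • d x
          = deriv χ' x • d x + c * (χ x • d x) := fun x => by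
        rw [hcr]; simp only [Complex.real_smul]; push_cast; ring
      simp only [e3] at h0
      rw [integral_add i3 (i4.const_mul c), integral_const_mul] at h0
      have e4 : ∀ x, χ' x • (d' x + c * D x) = χ' x • d' x + c * (χ' x • D x) := fun x => by
        simp only [Complex.real_smul]; ring
      simp only [e4]
      rw [integral_add i1 (i2.const_mul c), integral_const_mul, e2]
      linear_combination e1 - h0
  have hp2 : IsPrimitive d' fun x => -waveNumber k n ^ 2 * d x := by
    have h1 := hDp.const_mul (-c)
    refine ⟨h1.locInt, fun x y => ?_⟩
    rw [h1.integral_eq x y]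
    linear_combination ha x - ha y
  have hout : Tendsto (fun x : ℝ => ‖d' x * ((x / |x| : ℝ) : ℂ)
      - Complex.I * waveNumber k n * d x‖) (cocompact ℝ) (𝓝 0) := by
    have hsum := hwo.add hwo'
    rw [add_zero] at hsum
    refine squeeze_zero (fun _ => norm_nonneg _) (fun x => ?_) hsum
    refine le_trans (le_of_eq ?_) (norm_sub_le _ _)
    congr 1
    rw [hd, hd']; ring
  have hz := eq_zero_of_outgoing (waveNumber_ne_zero k n) (waveNumber_im_nonneg k n) hp hp2 hout
  filter_upwards [hwu, hwu'] with x q1 q2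
  have h0 := hz x
  rw [hd] at h0
  rw [coef, coef, ← q1, ← q2]
  linear_combination h0

theorem guide_subset : guide ⊆ ⋃ N : ℕ, box (N + 1) := by
  intro p hp
  obtain ⟨N, hN⟩ := exists_nat_gt |p.1|
  refine mem_iUnion.2 ⟨N, ?_, hp.2⟩
  have := abs_lt.1 hN
  exact ⟨by linarith [this.1], by linarith [this.2]⟩

theorem IsSolution.unique (k : Frequency) {s u u' : ℝ × ℝ → ℂ} (hs : MemLp s 2)
    (h : IsSolution k s u) (h' : IsSolution k s u') : u =ᵐ[volume.restrict guide] u' := by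
  have hbox : ∀ R : ℝ, 0 < R → u =ᵐ[volume.restrict (box R)] u' := by
    intro R hR
    have hint : ∀ {u}, IsSolution k s u → Integrable u (volume.restrict (box R)) := by
      intro u h
      obtain ⟨v, hv⟩ := h.memH2loc R hR
      exact (MemLp.integrable_box (Lp.memLp (val v))).congr hv
    have i1 := hint h
    have i2 := hint h'
    have hz : (fun p => u p - u' p) =ᵐ[volume.restrict (box R)] 0 := by
      refine ae_eq_zero_of_coef (i1.sub i2) fun n => ?_
      rw [volume_restrict_box] at i1 i2
      filter_upwards [i1.prod_right_ae, i2.prod_right_ae,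
        ae_restrict_of_ae (coef_ae_eq_of_isSolution k hs h h' n)] with x j1 j2 hx
      have hm : ∀ {g : ℝ → ℂ}, Integrable g (volume.restrict (Ioo (0 : ℝ) 1)) →
          Integrable (fun y => mode n y • g y) (volume.restrict (Ioo (0 : ℝ) 1)) := fun hg =>
        hg.bdd_smul 2 (continuous_mode n).aestronglyMeasurable
          (ae_of_all _ fun y => abs_mode_le n y)
      have e : coef n (fun p => u p - u' p) x = coef n u x - coef n u' x := by
        simp only [coef, smul_sub]
        exact integral_sub (hm j1) (hm j2)
      rw [e, hx, sub_self]; rfl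
    filter_upwards [hz] with p hp
    exact sub_eq_zero.1 hp
  refine ae_restrict_of_ae_restrict_of_subset guide_subset ?_
  rw [ae_restrict_iUnion_iff]
  exact fun N => hbox (N + 1) (by positivity)

end Waveguide

namespace Waveguide

variable {r R : ℝ} {f f' : ℝ → ℂ} {κ : ℂ}

/-! ### Outgoing profiles and their sources -/

theorem outSol_congr (h : f =ᵐ[volume] f') : outSol κ f = outSol κ f' := by
  funext x
  have h1 : ampR κ f x = ampR κ f' x :=
    integral_congr_ae ((ae_restrict_of_ae h).mono fun t ht => by simp only [ht])
  have h2 : ampL κ f x = ampL κ f' x :=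
    integral_congr_ae ((ae_restrict_of_ae h).mono fun t ht => by simp only [ht])
  rw [outSol, outSol, h1, h2]

theorem outSol_zero : outSol κ (fun _ => 0) = 0 := by
  funext x
  simp [outSol, ampR, ampL]

theorem outSol_eq_of_outgoing (hr : 0 < r) (hκ : κ ≠ 0) (hi : 0 ≤ κ.im) (hf : IsSource r f)
    {w w' : ℝ → ℂ} (h1 : IsPrimitive w w') (h2 : IsPrimitive w' fun x => -κ ^ 2 * w x - f x)
    (hR : ∀ x, r ≤ x → w' x = Complex.I * κ * w x)
    (hL : ∀ x, x ≤ -r → w' x = -(Complex.I * κ * w x)) : outSol κ f = w := by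
  have p1 := (isPrimitive_outSol hκ hf).add (h1.const_mul (-1))
  have p2 := ((isPrimitive_outSolD (κ := κ) hf).add (h2.const_mul (-1))).congr
    (f' := fun x => -κ ^ 2 * (outSol κ f x + (-1) * w x))
    (ae_of_all _ fun x => by simp only [outSolDD]; ring)
  have hz := eq_zero_of_outgoing hκ hi p1 p2 (tendsto_radiation (r := r)
    (fun x hx => by simp only [outSolD_of_le hκ hf hx, hR x hx]; ring)
    (fun x hx => by simp only [outSolD_of_le_neg hκ hf hx, hL x hx]; ring) hr)
  funext x
  linear_combination hz x

/-- There is a smooth transition from `-1` to `1` in `(-r,r)`. -/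
theorem exists_transition (hr : 0 < r) : ∃ (B : ℝ) (c c' : ℝ → ℝ), 0 ≤ B ∧ Continuous c' ∧
    (∀ x, HasDerivAt c (c' x) x) ∧ (∀ x, |c x| ≤ 1) ∧ (∀ x, |c' x| ≤ B) ∧
    (∀ x, r ≤ x → c x = 1) ∧ (∀ x, x ≤ -r → c x = -1) ∧ ∀ x, x ∉ Ioo (-r) r → c' x = 0 := by
  set c : ℝ → ℝ := fun x => 2 * Real.smoothTransition ((x / r + 1) / 2) - 1 with hc
  have hs : ContDiff ℝ 1 c := by
    have h : ContDiff ℝ 1 Real.smoothTransition := Real.smoothTransition.contDiff (n := 1)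
    exact (contDiff_const.mul (h.comp (by fun_prop))).sub contDiff_const
  have hb : ∀ x, |c x| ≤ 1 := fun x => abs_le.2
    ⟨by have := Real.smoothTransition.nonneg ((x / r + 1) / 2); simp only [hc]; linarith,
      by have := Real.smoothTransition.le_one ((x / r + 1) / 2); simp only [hc]; linarith⟩
  have hR : ∀ x, r ≤ x → c x = 1 := fun x hx => by
    have : 1 ≤ x / r := (one_le_div hr).2 hx
    simp only [hc]
    rw [Real.smoothTransition.one_of_one_le (by linarith)]; norm_num
  have hL : ∀ x, x ≤ -r → c x = -1 := fun x hx => by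
    have : x / r ≤ -1 := by rw [div_le_iff₀ hr]; linarith
    simp only [hc]
    rw [Real.smoothTransition.zero_of_nonpos (by linarith)]; norm_num
  have hz : ∀ x, x ∉ Ioo (-r) r → deriv c x = 0 := fun x hx => by
    rcases le_or_gt r x with h | h
    · refine IsLocalMax.deriv_eq_zero (Eventually.of_forall fun y => ?_)
      rw [hR x h]; exact (abs_le.1 (hb y)).2
    · refine IsLocalMin.deriv_eq_zero (Eventually.of_forall fun y => ?_)
      rw [hL x (by by_contra hh; exact hx ⟨not_le.1 hh, h⟩)]; exact (abs_le.1 (hb y)).1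
  have hcd : Continuous (deriv c) := hs.continuous_deriv (by simp)
  obtain ⟨B, hB⟩ := (HasCompactSupport.intro (isCompact_Icc (a := -r) (b := r)) fun x hx =>
    hz x fun h => hx (Ioo_subset_Icc_self h)).exists_bound_of_continuous hcd
  exact ⟨B, c, deriv c, (norm_nonneg _).trans (hB 0), hcd,
    fun x => (hs.differentiable (by simp) x).hasDerivAt, hb, hB, hR, hL, hz⟩

/-- An outgoing profile without zeros whose source is small for small wave numbers. -/
theorem exists_source (hr : 0 < r) : ∃ B : ℝ, 0 ≤ B ∧ ∀ κ : ℂ, κ ≠ 0 → 0 ≤ κ.im →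
    ∃ f : ℝ → ℂ, IsSource r f ∧ Continuous (outSol κ f) ∧ (∀ x, outSol κ f x ≠ 0) ∧
      ∀ x, ‖f x‖ ≤ (B * ‖κ‖ + ‖κ‖ ^ 2) * ‖outSol κ f x‖ := by
  obtain ⟨B, c, c', hB, hcc', hd, hb, hb', hR, hL, hz⟩ := exists_transition hr
  have hcc : Continuous c := continuous_iff_continuousAt.2 fun x => (hd x).continuousAt
  refine ⟨B, hB, fun κ hκ hi => ?_⟩
  set g : ℝ → ℝ := fun x => ∫ t in (0 : ℝ)..x, c t with hg
  have hgd : ∀ x, HasDerivAt g (c x) x := fun x =>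
    (hcc.integral_hasStrictDerivAt 0 x).hasDerivAt
  have hgc : Continuous g := continuous_iff_continuousAt.2 fun x => (hgd x).continuousAt
  set w : ℝ → ℂ := fun x => Complex.exp (Complex.I * κ * g x) with hw
  have hwc : Continuous w := by fun_prop
  have hwd : ∀ x, HasDerivAt w (Complex.I * κ * c x * w x) x := fun x => by
    have := ((hgd x).ofReal_comp.const_mul (Complex.I * κ)).cexp
    convert! this using 1
    simp only [hw]; ring
  have hwd' : ∀ x, HasDerivAt (fun x => Complex.I * κ * c x * w x)
      (Complex.I * κ * c' x * w x + Complex.I * κ * c x * (Complex.I * κ * c x * w x)) x := fun x =>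
    ((hd x).ofReal_comp.const_mul (Complex.I * κ)).mul (hwd x)
  set f : ℝ → ℂ := fun x => -((Complex.I * κ * c' x + κ ^ 2 * ((1 - c x ^ 2 : ℝ) : ℂ)) * w x)
    with hf
  have hfc : Continuous f := by fun_prop
  have hf0 : ∀ t, t ∉ Ioo (-r) r → f t = 0 := fun t ht => by
    have h1 : c t ^ 2 = 1 := by
      rcases le_or_gt r t with h | h
      · rw [hR t h]; norm_num
      · rw [hL t (by by_contra hh; exact ht ⟨not_le.1 hh, h⟩)]; norm_num
    simp only [hf, hz t ht, h1]; simp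
  have hfs : IsSource r f := ⟨hfc.memLp_of_hasCompactSupport
    (HasCompactSupport.intro (isCompact_Icc (a := -r) (b := r)) fun x hx =>
      hf0 x fun h => hx (Ioo_subset_Icc_self h)), hf0⟩
  have hsol : outSol κ f = w := by
    refine outSol_eq_of_outgoing hr hκ hi hfs (.of_hasDerivAt hwd (by fun_prop))
      ((IsPrimitive.of_hasDerivAt hwd' (by fun_prop)).congr (ae_of_all _ fun x => ?_))
      (fun x hx => ?_) fun x hx => ?_
    · simp only [hf]; push_cast
      linear_combination (κ ^ 2 * (c x : ℂ) ^ 2 * w x) * Complex.I_sq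
    · rw [hR x hx]; simp
    · rw [hL x hx]; simp
  refine ⟨f, hfs, hsol ▸ hwc, fun x => hsol ▸ Complex.exp_ne_zero _, fun x => ?_⟩
  rw [hsol]
  simp only [hf, norm_neg]
  rw [norm_mul]
  refine mul_le_mul_of_nonneg_right ((norm_add_le _ _).trans (add_le_add ?_ ?_)) (norm_nonneg _)
  · rw [norm_mul, norm_mul, Complex.norm_I, one_mul, Complex.norm_real, mul_comm]
    exact mul_le_mul_of_nonneg_right (hb' x) (norm_nonneg _)
  · rw [norm_mul, norm_pow, Complex.norm_real, Real.norm_eq_abs]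
    refine mul_le_of_le_one_right (by positivity) (abs_le.2 ?_)
    have := (sq_le_one_iff_abs_le_one _).2 (hb x)
    exact ⟨by linarith, by linarith [sq_nonneg (c x)]⟩

/-! ### Sources with a single mode -/

theorem src_tens (hf : IsSource r f) (n m : ℕ) :
    src (tens r f (modeC n)) m =ᵐ[volume] if m = n then f else fun _ => 0 := by
  have h : ∀ᵐ x, x ∈ Ioo (-r) r → coef m (tens r f (modeC n)) x = coef m (sep f (modeC n)) x :=
    (ae_restrict_iff' measurableSet_Ioo).1
      (coef_congr_ae (coeFn_tens (hf.memLp.restrict _) (memLp_modeC n)) m)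
  filter_upwards [h] with x hx
  by_cases hxr : x ∈ Ioo (-r) r
  · rw [src_eq_coef _ _ hxr, hx hxr]
    have e : coef m (sep f (modeC n)) x = f x * ∫ y in (0 : ℝ)..1, modeC m y * modeC n y := by
      rw [coef, ← integral_Ioo_eq zero_le_one, ← integral_const_mul]
      congr 1; ext y
      simp only [sep, modeC, Complex.real_smul]; ring
    rw [e]
    split_ifs with hmn
    · rw [hmn, integral_modeC_mul_self, mul_one]
    · rw [integral_modeC_mul_modeC_of_ne hmn, mul_zero]
  · rw [src_eq_zero _ _ hxr]
    split_ifs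
    · exact (hf.zero x hxr).symm
    · rfl

theorem sol_tens (k : Frequency) (hf : IsSource r f) (n m : ℕ) :
    sol k (tens r f (modeC n)) m = if m = n then outSol (waveNumber k n) f else 0 := by
  rw [sol, outSol_congr (src_tens hf n m)]
  split_ifs with h
  · rw [h]
  · exact outSol_zero

theorem jetCLM_solH2_tens (hr : 0 < r) (hR : 0 < R) (k : Frequency) (hf : IsSource r f) (n : ℕ)
    (i : JetIndex) (hi : order 0 i = 0) :
    jetCLM (box R) i (solH2 hR k (tens r f (modeC n)))
      = tens R (outSol (waveNumber k n) f) (modeDer n (order 1 i)) := by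
  have h := (jetCLM (box R) i).hasSum (hasSum_solJet hr hR k (tens r f (modeC n)))
  have e : ∀ m, jetCLM (box R) i (solJet hR k (tens r f (modeC n)) m)
      = tens R (sol k (tens r f (modeC n)) m) (modeDer m (order 1 i)) := fun m => by
    rw [solJet, jetCLM_jet, hi]; rfl
  refine h.unique ?_
  have hn := hasSum_single (f := fun m => jetCLM (box R) i (solJet hR k (tens r f (modeC n)) m)) n
    fun m hm => by
      rw [e, sol_tens k hf, if_neg hm, ← norm_eq_zero, ← sq_eq_zero_iff,
        norm_tens_sq (F := 0) (Continuous.memLp_Ioo continuous_zero _ _) (memLp_modeDer m _)]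
      simp [normSq]
  rwa [e, sol_tens k hf, if_pos rfl] at hn

/-- Sources for which the solution is large compared to the source. -/
theorem exists_source_solH2_ge (hr : 0 < r) : ∃ B : ℝ, 0 ≤ B ∧ ∀ (k : Frequency) (n : ℕ),
    ∃ s : L2 (box r), 0 < ‖solH2 hr k s‖ ∧
      ‖s‖ * max 1 (freq n ^ 2)
        ≤ (B * ‖waveNumber k n‖ + ‖waveNumber k n‖ ^ 2) * ‖solH2 hr k s‖ := by
  obtain ⟨B, hB, h⟩ := exists_source hr
  refine ⟨B, hB, fun k n => ?_⟩
  obtain ⟨f, hf, hc, hne, hle⟩ := h (waveNumber k n) (waveNumber_ne_zero k n)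
    (waveNumber_im_nonneg k n)
  set κ := waveNumber k n
  set W := outSol κ f
  set K := B * ‖κ‖ + ‖κ‖ ^ 2 with hK
  have hK0 : 0 ≤ K := by positivity
  have hWm : MemLp W 2 (volume.restrict (Ioo (-r) r)) := Continuous.memLp_Ioo hc _ _
  have hWi : Integrable (fun x => ‖W x‖ ^ 2) (volume.restrict (Ioo (-r) r)) :=
    (memLp_two_iff_integrable_sq_norm hWm.1).1 hWm
  have hN : 0 < normSq r W := by
    rw [normSq, setIntegral_pos_iff_support_of_nonneg_ae (ae_of_all _ fun x => by positivity) hWi]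
    have : Function.support (fun x => ‖W x‖ ^ 2) = univ := by
      ext x; simpa using hne x
    rw [this, univ_inter, Real.volume_Ioo]
    exact ENNReal.ofReal_pos.2 (by linarith)
  set s := tens r f (modeC n) with hs
  set N := Real.sqrt (normSq r W) with hNd
  have hNp : 0 < N := Real.sqrt_pos.2 hN
  have hN2 : N ^ 2 = normSq r W := Real.sq_sqrt hN.le
  have hsn : ‖s‖ ≤ K * N := by
    refine le_of_sq_le_sq ?_ (by positivity)
    rw [hs, norm_tens_mode_sq (hf.memLp.restrict _), mul_pow, hN2, normSq, normSq,
      ← integral_const_mul]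
    refine integral_mono_of_nonneg (ae_of_all _ fun x => by positivity) (hWi.const_mul _)
      (ae_of_all _ fun x => ?_)
    simp only
    rw [← mul_pow]
    exact pow_le_pow_left₀ (norm_nonneg _) (hle x) 2
  have h1 : N ≤ ‖solH2 hr k s‖ := by
    refine le_trans (le_of_eq ?_) (norm_jetCLM_le (solH2 hr k s) (.inl ()))
    rw [jetCLM_solH2_tens hr hr k hf n _ rfl, hNd, ← norm_tens_mode_sq hWm n,
      Real.sqrt_sq (norm_nonneg _)]
    rfl
  have h2 : N * freq n ^ 2 ≤ ‖solH2 hr k s‖ := by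
    refine le_trans ?_ (norm_jetCLM_le (solH2 hr k s) (.inr (.inr (1, 1))))
    rw [jetCLM_solH2_tens hr hr k hf n _ (by simp [order])]
    refine le_of_sq_le_sq ?_ (norm_nonneg _)
    rw [norm_tens_sq hWm (memLp_modeDer n _), integral_norm_modeDer_sq n _ (by simp [order]),
      mul_pow, hN2]
    simp [order]
  refine ⟨s, hNp.trans_le h1, ?_⟩
  have h3 : N * max 1 (freq n ^ 2) ≤ ‖solH2 hr k s‖ := by
    rcases max_choice 1 (freq n ^ 2) with h | h <;> rw [h]
    · rwa [mul_one]
    · exact h2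
  calc ‖s‖ * max 1 (freq n ^ 2) ≤ K * N * max 1 (freq n ^ 2) := by gcongr
    _ = K * (N * max 1 (freq n ^ 2)) := by ring
    _ ≤ K * ‖solH2 hr k s‖ := by gcongr

/-- Wave numbers are small close to the cutoffs. -/
theorem norm_waveNumber_sq_le (k : Frequency) (n : ℕ) {δ : ℝ} (hδ : δ ≤ 1)
    (h : |(k : ℝ) - freq n| < δ) : ‖waveNumber k n‖ ^ 2 ≤ 3 * δ * max 1 (freq n ^ 2) := by
  have h0 := freq_nonneg n
  have hk := k.2.1
  have h1 : freq n ≤ max 1 (freq n ^ 2) := by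
    rcases le_or_gt (freq n) 1 with h | h
    · exact h.trans (le_max_left _ _)
    · exact le_trans (by nlinarith) (le_max_right _ _)
  have h2 := le_max_left 1 (freq n ^ 2)
  have h3 := (abs_lt.1 h).2
  rw [norm_waveNumber_sq hk, show (k : ℝ) ^ 2 - freq n ^ 2 = (k - freq n) * (k + freq n) by ring,
    abs_mul, abs_of_nonneg (by linarith : 0 ≤ (k : ℝ) + freq n), mul_assoc, mul_left_comm]
  have h4 : (k : ℝ) + freq n ≤ 3 * max 1 (freq n ^ 2) := by linarith
  calc |(k : ℝ) - freq n| * (k + freq n) ≤ δ * (3 * max 1 (freq n ^ 2)) :=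
        mul_le_mul h.le h4 (by linarith) ((abs_nonneg _).trans h.le)
    _ = 3 * (δ * max 1 (freq n ^ 2)) := by ring
    _ ≤ _ := by linarith

end Waveguide

namespace Waveguide

variable {r R : ℝ}

/-! ### The solution operator -/

theorem outSol_add {f g : ℝ → ℂ} {κ : ℂ} (hf : IsSource r f) (hg : IsSource r g) :
    outSol κ (fun x => f x + g x) = fun x => outSol κ f x + outSol κ g x := by
  funext x
  have h1 : ampR κ (fun x => f x + g x) x = ampR κ f x + ampR κ g x := by
    simp only [ampR, mul_add]
    exact integral_add (hf.integrable_expI_mul _).integrableOn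
      (hg.integrable_expI_mul _).integrableOn
  have h2 : ampL κ (fun x => f x + g x) x = ampL κ f x + ampL κ g x := by
    simp only [ampL, mul_add]
    exact integral_add (hf.integrable_expI_mul _).integrableOn
      (hg.integrable_expI_mul _).integrableOn
  rw [outSol, outSol, outSol, h1, h2]
  ring

theorem outSol_const_mul {f : ℝ → ℂ} {κ : ℂ} (c : ℂ) :
    outSol κ (fun x => c * f x) = fun x => c * outSol κ f x := by
  funext x
  have h1 : ampR κ (fun x => c * f x) x = c * ampR κ f x := by
    simp only [ampR, mul_left_comm _ c, integral_const_mul]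
  have h2 : ampL κ (fun x => c * f x) x = c * ampL κ f x := by
    simp only [ampL, mul_left_comm _ c, integral_const_mul]
  rw [outSol, outSol, h1, h2]
  ring

theorem ae_integrable_mode_smul {u : ℝ × ℝ → ℂ} (hu : Integrable u (volume.restrict (box r)))
    (n : ℕ) : ∀ᵐ x, x ∈ Ioo (-r) r →
      Integrable (fun y => mode n y • u (x, y)) (volume.restrict (Ioo (0 : ℝ) 1)) := by
  rw [← ae_restrict_iff' measurableSet_Ioo]
  rw [volume_restrict_box] at hu
  filter_upwards [hu.prod_right_ae] with x hx
  exact hx.bdd_smul 2 (continuous_mode n).aestronglyMeasurable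
    (ae_of_all _ fun y => abs_mode_le n y)

theorem src_add (s t : L2 (box r)) (n : ℕ) :
    src (s + t) n =ᵐ[volume] fun x => src s n x + src t n x := by
  have hi := fun s : L2 (box r) => ae_integrable_mode_smul (MemLp.integrable_box (Lp.memLp s)) n
  filter_upwards [hi s, hi t, (ae_restrict_iff' measurableSet_Ioo).1
    (coef_congr_ae (Lp.coeFn_add s t) n)] with x h1 h2 h3
  by_cases hx : x ∈ Ioo (-r) r
  · rw [src_eq_coef _ _ hx, src_eq_coef _ _ hx, src_eq_coef _ _ hx, h3 hx]
    simp only [coef, Pi.add_apply, smul_add]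
    exact integral_add (h1 hx) (h2 hx)
  · rw [src_eq_zero _ _ hx, src_eq_zero _ _ hx, src_eq_zero _ _ hx, add_zero]

theorem src_smul (c : ℂ) (s : L2 (box r)) (n : ℕ) :
    src (c • s) n =ᵐ[volume] fun x => c * src s n x := by
  filter_upwards [(ae_restrict_iff' measurableSet_Ioo).1
    (coef_congr_ae (Lp.coeFn_smul c s) n)] with x h3
  by_cases hx : x ∈ Ioo (-r) r
  · rw [src_eq_coef _ _ hx, src_eq_coef _ _ hx, h3 hx]
    simp only [coef, Pi.smul_apply, smul_eq_mul, Complex.real_smul, mul_left_comm _ c,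
      integral_const_mul]
  · rw [src_eq_zero _ _ hx, src_eq_zero _ _ hx, mul_zero]

theorem solFun_add (hr : 0 < r) (k : Frequency) (s t : L2 (box r)) (p : ℝ × ℝ) :
    solFun k (s + t) p = solFun k s p + solFun k t p := by
  refine (hasSum_solFun hr k (s + t) p).unique ?_
  convert! (hasSum_solFun hr k s p).add (hasSum_solFun hr k t p) using 2 with n
  rw [sol, outSol_congr (src_add s t n), outSol_add (isSource_src s n) (isSource_src t n), sol, sol]
  ring

theorem solFun_smul (hr : 0 < r) (k : Frequency) (c : ℂ) (s : L2 (box r)) (p : ℝ × ℝ) :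
    solFun k (c • s) p = c * solFun k s p := by
  refine (hasSum_solFun hr k (c • s) p).unique ?_
  convert! (hasSum_solFun hr k s p).mul_left c using 2 with n
  rw [sol, outSol_congr (src_smul c s n), outSol_const_mul, sol]
  ring

/-- The operator `s ↦ u_k`, with values in `H²((-R,R) × (0,1))`. -/
noncomputable def solOp (hr : 0 < r) (hR : 0 < R) (k : Frequency) : L2 (box r) →ₗ[ℂ] H2 (box R) where
  toFun := solH2 hR k
  map_add' s t := by
    refine H2.ext (isOpen_box R) (Lp.ext ?_)
    refine (isRestriction_solH2 hr hR k (s + t)).trans ?_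
    change _ =ᵐ[_] (val (solH2 hR k s) + val (solH2 hR k t) : L2 (box R))
    filter_upwards [isRestriction_solH2 hr hR k s, isRestriction_solH2 hr hR k t,
      Lp.coeFn_add (val (solH2 hR k s)) (val (solH2 hR k t))] with p h1 h2 h3
    rw [h3, Pi.add_apply, h1, h2, solFun_add hr]
  map_smul' c s := by
    refine H2.ext (isOpen_box R) (Lp.ext ?_)
    refine (isRestriction_solH2 hr hR k (c • s)).trans ?_
    change _ =ᵐ[_] (c • val (solH2 hR k s) : L2 (box R))
    filter_upwards [isRestriction_solH2 hr hR k s, Lp.coeFn_smul c (val (solH2 hR k s))]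
      with p h1 h2
    rw [h2, Pi.smul_apply, h1, solFun_smul hr, smul_eq_mul]

/-- The operator `s ↦ u_k` as a continuous linear map. -/
noncomputable def solCLM (hr : 0 < r) (k : Frequency) : L2 (box r) →L[ℂ] H2 (box r) :=
  (solOp hr hr k).mkContinuous (exists_norm_solH2_le hr hr k).choose
    (exists_norm_solH2_le hr hr k).choose_spec.2

/-- The operator norm blows up at the cutoffs. -/
theorem exists_lt_norm_solCLM (hr : 0 < r) (M : ℝ) : ∃ δ : ℝ, 0 < δ ∧ ∀ k : Frequency,
    Metric.infDist (k : ℝ) cutoffs < δ → M < ‖solCLM hr k‖ := by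
  obtain ⟨B, hB, h⟩ := exists_source_solH2_ge hr
  set ε : ℝ := ((B + 1) * (|M| + 1))⁻¹ with hε
  have hM := abs_nonneg M
  have hε0 : 0 < ε := by positivity
  have hε1 : ε ≤ 1 := inv_le_one_of_one_le₀ (by nlinarith)
  refine ⟨ε ^ 2 / 3, by positivity, fun k hk => ?_⟩
  obtain ⟨-, ⟨n, rfl⟩, hn⟩ := (Metric.infDist_lt_iff (range_nonempty _)).1 hk
  obtain ⟨s, hs, hsn⟩ := h k n
  set X := max 1 (freq n ^ 2) with hX
  have hX1 : 1 ≤ X := le_max_left _ _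
  have hκ2 : ‖waveNumber k n‖ ^ 2 ≤ ε ^ 2 * X := by
    refine (norm_waveNumber_sq_le k n (δ := ε ^ 2 / 3) (by nlinarith) hn).trans (le_of_eq ?_)
    ring
  have hκ1 : ‖waveNumber k n‖ ≤ ε * X := by
    refine le_of_sq_le_sq (hκ2.trans ?_) (by positivity)
    rw [mul_pow]
    exact mul_le_mul_of_nonneg_left (by nlinarith) (by positivity)
  have hK : B * ‖waveNumber k n‖ + ‖waveNumber k n‖ ^ 2 ≤ (B + 1) * ε * X := by
    have h1 : ε ^ 2 * X ≤ ε * X := mul_le_mul_of_nonneg_right (by nlinarith) (by linarith)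
    have h2 := mul_le_mul_of_nonneg_left hκ1 hB
    linarith
  have hop : ‖solH2 hr k s‖ ≤ ‖solCLM hr k‖ * ‖s‖ := (solCLM hr k).le_opNorm s
  have hT := norm_nonneg (solCLM hr k)
  have h1 : X * ‖solH2 hr k s‖ ≤ ‖solCLM hr k‖ * ((B + 1) * ε * X) * ‖solH2 hr k s‖ :=
    calc X * ‖solH2 hr k s‖ ≤ X * (‖solCLM hr k‖ * ‖s‖) := by gcongr
      _ = ‖solCLM hr k‖ * (‖s‖ * X) := by ring
      _ ≤ ‖solCLM hr k‖ * ((B * ‖waveNumber k n‖ + ‖waveNumber k n‖ ^ 2) * ‖solH2 hr k s‖) := by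
        gcongr
      _ ≤ ‖solCLM hr k‖ * ((B + 1) * ε * X * ‖solH2 hr k s‖) := by gcongr
      _ = _ := by ring
  have h2 := le_of_mul_le_mul_right h1 hs
  have h3 : 1 * X ≤ ‖solCLM hr k‖ * ((B + 1) * ε) * X := by linarith
  have h4 := le_of_mul_le_mul_right h3 (by linarith)
  have h5 : (B + 1) * ε = (|M| + 1)⁻¹ := by
    rw [hε]; field_simp
  rw [h5, ← div_eq_mul_inv, one_le_div (by positivity)] at h4
  linarith [le_abs_self M]

end Waveguide

theorem mainTheorem9 (r : ℝ) (hr : 0 < r) :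
    ∃ H : Waveguide.Frequency → Waveguide.L2 (Waveguide.box r) →L[ℂ]
        Waveguide.H2 (Waveguide.box r),
      (∀ (k : Waveguide.Frequency) (s : Waveguide.L2 (Waveguide.box r)),
        ∃ u : ℝ × ℝ → ℂ,
          Waveguide.IsSolution k (Waveguide.extendByZero s) u ∧
          (∀ u' : ℝ × ℝ → ℂ, Waveguide.IsSolution k (Waveguide.extendByZero s) u' →
            u' =ᵐ[volume.restrict Waveguide.guide] u) ∧
          Waveguide.IsRestriction (H k s) u) ∧
      (∀ k : Waveguide.Frequency, ∃ C : ℝ, 0 < C ∧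
        ∀ s : Waveguide.L2 (Waveguide.box r), ‖H k s‖ ≤ C * ‖s‖) ∧
      (∀ M : ℝ, ∃ δ : ℝ, 0 < δ ∧ ∀ k : Waveguide.Frequency,
        Metric.infDist (k : ℝ) Waveguide.cutoffs < δ → M < ‖H k‖) :=
  ⟨fun k => Waveguide.solCLM hr k,
    fun k s => ⟨Waveguide.solFun k s, Waveguide.isSolution_solFun hr k s,
      fun _ hu' => Waveguide.IsSolution.unique k (Waveguide.memLp_extendByZero s) hu'
        (Waveguide.isSolution_solFun hr k s),
      Waveguide.isRestriction_solH2 hr hr k s⟩,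
    fun k => Waveguide.exists_norm_solH2_le hr hr k,
    Waveguide.exists_lt_norm_solCLM hr⟩
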